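/- **Setting.** Let $R$ be the ring of integers of a finite extension of $\mathbb{Q}_p$, $\pi$ a uniformizer, $k$ the residue field and $q=|k|$. For $m,c\in\mathbb{N}$ let $[m,c]\subset R[[X_1,\dots,X_n]]$ be the $R$-module of all $\sum_{j\ge0}\pi^jp_j$ with $p_j\in R[X_1,\dots,X_n]$ of total degree $\deg p_j\le m+cj$, and let $R[X]^\dagger=\bigcup_{m,c}[m,c]$. Let $A=R[X_1,\dots,X_n]^\dagger/(g_1,\dots,g_r)$ with polynomials $g_j\in R[X_1,\dots,X_n]$, and assume that $A$ is $R$-flat, that $A/\pi A$ is a smooth $k$-algebra and that $\operatorname{Spec}(A/\pi A)$ is connected. Let $\sigma$ be an $R$-algebra endomorphism of $A$ lifting the $q$-th power Frobenius of $A/\pi A$. Let $\widehat A$ be the $\pi$-adic completion of $A$, and write $\sigma$ also for the induced endomorphism of $\widehat A$. **Matrices.** Index sets are countable. A matrix $(a_{i_1,i_2})_{i_1,i_2\in I}$ with entries in an $R$-module $E$ is *nuclear* if for every $N$ all but finitely many of its columns $(a_{i_1,i_2})_{i_1\in I}$ have all their entries in $\pi^NE$. A matrix over $\widehat A$ is *nuclear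 overconvergent* if it is the image of a nuclear matrix with entries in $[m,c]$ for some $m,c\ge 1$. Nuclear matrices $\mathcal M_1,\mathcal M_2$ over $\widehat A$, indexed by $I_1,I_2$, are *$\sigma$-similar* if there are an $I_1\times I_2$-matrix $\mathcal S$ and an $I_2\times I_1$-matrix $\mathcal S'$ over $\widehat A$, all of whose rows tend to $0$ $\pi$-adically (so that they act on formal columns $\prod_I\widehat A$), with $\mathcal S\mathcal S'=1$, $\mathcal S'\mathcal S=1$ and $\mathcal S'\mathcal M_1\mathcal S^\sigma=\mathcal M_2$. **The Grothendieck group.** $\Delta(\widehat A)$ is the quotient of the free abelian group on the $\sigma$-similarity classes of nuclear matrices over $\widehat A$ by the subgroup generated by all $[\mathcal M]-[\mathcal M']-[\mathcal M'']$, where $\mathcal M=(a_{i_1,i_2})_{i_1,i_2\in I}$, $I=I'\sqcup I''$ is a partition with $a_{i_1,i_2}=0$ for all $(i_1,i_2)\in I'\times I''$, and $\mathcal M'$, $\mathcal M''$ are the diagonal blocks of $\mathcal M$ on $I'$, $I''$. A series $\sum_{r\ge1}\varepsilon_r[\mathcal C_r]$ with signs $\varepsilon_r=\pm1$ and nuclear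 $\mathcal C_r$ is *convergent* if for every $N$ all entries of $\mathcal C_r$ lie in $\pi^N\widehat A$ for all but finitely many $r$; it then represents the element $[\operatorname{diag}(\mathcal C_r)_{\varepsilon_r=1}]-[\operatorname{diag}(\mathcal C_r)_{\varepsilon_r=-1}]$ of $\Delta(\widehat A)$. **$\sigma$-modules.** A finite rank $\sigma$-module over $\widehat A$ (resp. $A$) is a free module of finite rank together with a $\sigma$-linear endomorphism $\phi$; its matrix $(m_{ij})$ in a basis $(b_i)$ is given by $\phi(b_j)=\sum_im_{ij}b_i$. It is *unit root* if its linearization $a\otimes u\mapsto a\phi(u)$ is bijective. A finite rank $\sigma$-module over $\widehat A$ is *overconvergent* if it arises by base change $A\to\widehat A$ from a finite rank $\sigma$-module over $A$. It is *ordinary* if it admits an exhausting $\phi$-stable filtration $0=M_0\subset M_1\subset M_2\subset\dots$ by free submodules with free quotients $U_i=M_{i+1}/M_i$ such that, for each $i\ge0$, $\phi$ acts on $U_i$ as $\pi^i\phi_i$ with $(U_i,\phi_i)$ a unit root $\sigma$-module. The $(U_i,\phi_i)$ are its *graded pieces* (they need not be overconvergent). **Theorem (Hodge–Newton slope decomposition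 for overconvergent $\sigma$-modules).** Let $(M,\phi)$ be an ordinary and overconvergent finite rank $\sigma$-module over $\widehat A$, and let $\mathcal M$ be the matrix, in some basis, of one of its graded pieces $(U_i,\phi_i)$. Then there exist nuclear overconvergent matrices $\mathcal C_r$ ($r\ge1$) and signs such that $\sum_{r\ge1}\pm[\mathcal C_r]$ is a convergent series and $$[\mathcal M]=\sum_{r\ge 1}\pm[\mathcal C_r]\qquad\text{in }\Delta(\widehat A).$$ -/

import Mathlib

open scoped TensorProduct

noncomputable section

namespace HodgeNewton

universe u v

/-! ### Overconvergent power series and the algebras `A` -/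

section Overconvergent

variable {R : Type u} [CommRing R]

/-- The `R`-module `[m, c]` of power series `z = ∑_j π ^ j p_j` with polynomials `p_j` of total
degree at most `m + c j`. The sum converges `π`-adically: its `N`-th partial sum is congruent to
`z` modulo `π ^ N`. -/
def growth (π : R) (n m c : ℕ) : Submodule R (MvPowerSeries (Fin n) R) where
  carrier := {z | ∃ p : ℕ → MvPolynomial (Fin n) R, (∀ j, (p j).totalDegree ≤ m + c * j) ∧
    ∀ N : ℕ, ∃ w : MvPowerSeries (Fin n) R,
      z = ((∑ j ∈ Finset.range N, π ^ j • p j : MvPolynomial (Fin n) R) :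
        MvPowerSeries (Fin n) R) + π ^ N • w}
  add_mem' := by
    rintro a b ⟨p, hp, hpa⟩ ⟨p', hp', hpb⟩
    refine ⟨fun j => p j + p' j, fun j => ?_, fun N => ?_⟩
    · exact (MvPolynomial.totalDegree_add _ _).trans (max_le (hp j) (hp' j))
    · obtain ⟨w, hw⟩ := hpa N
      obtain ⟨w', hw'⟩ := hpb N
      refine ⟨w + w', ?_⟩
      rw [hw, hw']
      simp only [smul_add, Finset.sum_add_distrib, MvPolynomial.coe_add]
      abel
  zero_mem' := ⟨fun _ => 0, fun j => by simp, fun N => ⟨0, by simp⟩⟩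
  smul_mem' := by
    rintro r a ⟨p, hp, hpa⟩
    refine ⟨fun j => r • p j, fun j => ?_, fun N => ?_⟩
    · exact (MvPolynomial.totalDegree_smul_le _ _).trans (hp j)
    · obtain ⟨w, hw⟩ := hpa N
      refine ⟨r • w, ?_⟩
      rw [hw, smul_add, smul_comm r (π ^ N) w]
      congr 1
      rw [← MvPolynomial.coe_smul, Finset.smul_sum]
      congr 2
      funext j
      exact smul_comm _ _ _

theorem coeff_dvd_of_mem_growth {π : R} {n m c : ℕ} {z : MvPowerSeries (Fin n) R}
    (hz : z ∈ growth π n m c) (α : Fin n →₀ ℕ) (j : ℕ) (hα : m + c * j < α.degree) :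
    π ^ (j + 1) ∣ MvPowerSeries.coeff α z := by
  obtain ⟨p, hp, h⟩ := hz
  obtain ⟨w, hw⟩ := h (j + 1)
  have h0 : ∀ i ∈ Finset.range (j + 1), (π ^ i • p i).coeff α = 0 := by
    intro i hi
    rw [MvPolynomial.coeff_smul]
    have : (p i).coeff α = 0 := by
      apply MvPolynomial.coeff_eq_zero_of_totalDegree_lt
      have h1 : c * i ≤ c * j := Nat.mul_le_mul_left c (Nat.lt_succ_iff.mp (Finset.mem_range.mp hi))
      have h2 := hp i
      rw [Finsupp.degree_apply] at hα
      omega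
    simp [this]
  refine ⟨MvPowerSeries.coeff α w, ?_⟩
  rw [hw, map_add, MvPolynomial.coeff_coe, MvPolynomial.coeff_sum, Finset.sum_eq_zero h0, zero_add]
  simp

theorem mem_growth_iff {π : R} {n m c : ℕ} (hc : 0 < c) {z : MvPowerSeries (Fin n) R} :
    z ∈ growth π n m c ↔ ∀ (α : Fin n →₀ ℕ) (j : ℕ), m + c * j < α.degree →
      π ^ (j + 1) ∣ MvPowerSeries.coeff α z := by
  classical
  refine ⟨fun hz => coeff_dvd_of_mem_growth hz, fun h => ?_⟩
  have hex : ∀ d : ℕ, ∃ k, d ≤ m + c * k := fun d => ⟨d, by nlinarith⟩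
  set lev : (Fin n →₀ ℕ) → ℕ := fun α => Nat.find (hex α.degree) with hlev
  have hlev1 : ∀ α, α.degree ≤ m + c * lev α := fun α => Nat.find_spec (hex α.degree)
  have hdiv : ∀ α, ∃ y, MvPowerSeries.coeff α z = π ^ lev α * y := by
    intro α
    rcases Nat.eq_zero_or_pos (lev α) with h0 | h0
    · exact ⟨MvPowerSeries.coeff α z, by simp [h0]⟩
    · have h1 : ¬ α.degree ≤ m + c * (lev α - 1) := Nat.find_min (hex α.degree) (Nat.sub_lt h0 one_pos)
      obtain ⟨y, hy⟩ := h α (lev α - 1) (not_le.mp h1)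
      exact ⟨y, by rw [hy, Nat.sub_add_cancel h0]⟩
  choose y hy using hdiv
  have hfin : ∀ j, {α : Fin n →₀ ℕ | α.degree ≤ m + c * j}.Finite := fun j =>
    Finsupp.finite_of_degree_le (m + c * j)
  let p : ℕ → MvPolynomial (Fin n) R := fun j =>
    ∑ α ∈ (hfin j).toFinset, MvPolynomial.monomial α (if lev α = j then y α else 0)
  have hpc : ∀ j α, (p j).coeff α = if lev α = j then y α else 0 := by
    intro j α
    simp only [p, MvPolynomial.coeff_sum, MvPolynomial.coeff_monomial]
    rw [Finset.sum_ite_eq']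
    split_ifs with h1 h2 h2
    · rfl
    · rfl
    · exact absurd ((hfin j).mem_toFinset.mpr (by simpa [h2] using hlev1 α)) h1
    · rfl
  refine ⟨p, fun j => ?_, fun N => ?_⟩
  · refine MvPolynomial.totalDegree_finsetSum_le fun α hα => ?_
    refine (MvPolynomial.totalDegree_monomial_le _ _).trans ?_
    have := (hfin j).mem_toFinset.mp hα
    simpa [Finsupp.degree_apply, Finsupp.sum] using this
  · obtain ⟨w, hw⟩ : ∃ w : MvPowerSeries (Fin n) R, ∀ α, MvPowerSeries.coeff α w =
        if lev α < N then 0 else π ^ (lev α - N) * y α := ⟨fun α => _, fun α => rfl⟩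
    refine ⟨w, ?_⟩
    ext α
    rw [map_add, MvPolynomial.coeff_coe, MvPolynomial.coeff_sum, map_smul, hw,
      hy α]
    simp only [MvPolynomial.coeff_smul, hpc, smul_eq_mul, mul_ite, mul_zero]
    rw [Finset.sum_ite_eq]
    split_ifs with h1 h2 h2
    · simp
    · exact absurd (Finset.mem_range.mp h1) h2
    · exact absurd (Finset.mem_range.mpr h2) h1
    · rw [zero_add, ← mul_assoc, ← pow_add, Nat.add_sub_cancel' (not_lt.mp h2)]

theorem growth_mono {π : R} {n m m' c c' : ℕ} (hm : m ≤ m') (hc : c ≤ c') :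
    growth π n m c ≤ growth π n m' c' := by
  rintro z ⟨p, hp, h⟩
  exact ⟨p, fun j => (hp j).trans (add_le_add hm (Nat.mul_le_mul_right j hc)), h⟩

theorem coe_mem_growth (π : R) {n m c : ℕ} (f : MvPolynomial (Fin n) R)
    (hf : f.totalDegree ≤ m) : (f : MvPowerSeries (Fin n) R) ∈ growth π n m c := by
  refine ⟨fun j => if j = 0 then f else 0, fun j => ?_, fun N => ?_⟩
  · by_cases h : j = 0 <;> simp [h, hf]
  · rcases N with _ | N
    · exact ⟨f, by simp⟩
    · refine ⟨0, ?_⟩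
      rw [Finset.sum_range_succ']
      simp

theorem mul_mem_growth {π : R} {n m m' c : ℕ} (hc : 0 < c) {z z' : MvPowerSeries (Fin n) R}
    (hz : z ∈ growth π n m c) (hz' : z' ∈ growth π n m' c) :
    z * z' ∈ growth π n (m + m') c := by
  classical
  rw [mem_growth_iff hc] at *
  intro α j hα
  rw [MvPowerSeries.coeff_mul]
  refine Finset.dvd_sum fun x hx => ?_
  have hdeg : x.1.degree + x.2.degree = α.degree := by
    rw [← map_add, Finset.HasAntidiagonal.mem_antidiagonal.mp hx]
  have hex : ∃ k, x.1.degree ≤ m + c * k := ⟨x.1.degree, by nlinarith⟩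
  obtain ⟨a, ha, hmin⟩ : ∃ a, x.1.degree ≤ m + c * a ∧ ∀ b < a, ¬ x.1.degree ≤ m + c * b :=
    ⟨Nat.find hex, Nat.find_spec hex, fun b hb => Nat.find_min hex hb⟩
  have h1 : π ^ a ∣ MvPowerSeries.coeff x.1 z := by
    rcases a with _ | a
    · simp
    · exact hz x.1 a (not_le.mp (hmin a (Nat.lt_succ_self a)))
  by_cases haj : j + 1 ≤ a
  · exact Dvd.dvd.mul_right ((pow_dvd_pow π haj).trans h1) _
  · obtain ⟨b, rfl⟩ : ∃ b, j = a + b := ⟨j - a, by omega⟩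
    have h2 : π ^ (b + 1) ∣ MvPowerSeries.coeff x.2 z' := by
      apply hz' x.2 b
      rw [mul_add] at hα
      omega
    rw [add_assoc, pow_add]
    exact mul_dvd_mul h1 h2

/-- The ring `R[X_1, …, X_n]†`, the union of all `[m, c]` with `m, c ≥ 1`. -/
def Dagger (π : R) (n : ℕ) : Subalgebra R (MvPowerSeries (Fin n) R) where
  carrier := {z | ∃ m c : ℕ, 0 < m ∧ 0 < c ∧ z ∈ growth π n m c}
  mul_mem' := by
    rintro a b ⟨m, c, hm, hc, ha⟩ ⟨m', c', _, _, hb⟩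
    exact ⟨m + m', max c c', by omega, by omega, mul_mem_growth (by omega)
      (growth_mono le_rfl (le_max_left c c') ha) (growth_mono le_rfl (le_max_right c c') hb)⟩
  add_mem' := by
    rintro a b ⟨m, c, hm, hc, ha⟩ ⟨m', c', _, _, hb⟩
    exact ⟨max m m', max c c', by omega, by omega, (growth π n _ _).add_mem
      (growth_mono (le_max_left m m') (le_max_left c c') ha)
      (growth_mono (le_max_right m m') (le_max_right c c') hb)⟩
  algebraMap_mem' r := by
    refine ⟨1, 1, one_pos, one_pos, ?_⟩
    have := coe_mem_growth (m := 1) (c := 1) π (MvPolynomial.C r : MvPolynomial (Fin n) R)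
      (by simp)
    simpa [MvPowerSeries.algebraMap_apply] using this

theorem mem_dagger_of_mem_growth {π : R} {n m c : ℕ} (hm : 0 < m) (hc : 0 < c)
    {z : MvPowerSeries (Fin n) R} (hz : z ∈ growth π n m c) : z ∈ Dagger π n :=
  ⟨m, c, hm, hc, hz⟩

/-- A polynomial, viewed as an element of `R[X]†`. -/
def Dagger.ofPoly (π : R) {n : ℕ} (f : MvPolynomial (Fin n) R) : Dagger π n :=
  ⟨f, f.totalDegree + 1, 1, Nat.succ_pos _, one_pos, coe_mem_growth π f (Nat.le_succ _)⟩

/-- The algebra `A = R[X_1, …, X_n]† / (g_1, …, g_r)`. -/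
def DaggerAlg (π : R) {n r : ℕ} (g : Fin r → MvPolynomial (Fin n) R) : Type u :=
  Dagger π n ⧸ Ideal.span (Set.range fun j => Dagger.ofPoly π (g j))

instance (π : R) {n r : ℕ} (g : Fin r → MvPolynomial (Fin n) R) : CommRing (DaggerAlg π g) :=
  inferInstanceAs (CommRing (Dagger π n ⧸ Ideal.span (Set.range fun j => Dagger.ofPoly π (g j))))

instance (π : R) {n r : ℕ} (g : Fin r → MvPolynomial (Fin n) R) : Algebra R (DaggerAlg π g) :=
  inferInstanceAs
    (Algebra R (Dagger π n ⧸ Ideal.span (Set.range fun j => Dagger.ofPoly π (g j))))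

/-- The canonical projection `R[X]† → A`. -/
def DaggerAlg.mk (π : R) {n r : ℕ} (g : Fin r → MvPolynomial (Fin n) R) :
    Dagger π n →ₐ[R] DaggerAlg π g :=
  Ideal.Quotient.mkₐ R (Ideal.span (Set.range fun j => Dagger.ofPoly π (g j)))

/-- The `π`-adic completion of an `R`-algebra `A`. -/
abbrev Compl (π : R) (A : Type u) [CommRing A] [Algebra R A] : Type u :=
  AdicCompletion (Ideal.span {algebraMap R A π}) A

/-- `σ` lifts the `q`-th power Frobenius endomorphism of `A / π A`. -/
def IsFrobeniusLift (π : R) (q : ℕ) {A : Type u} [CommRing A] [Algebra R A] (σ : A →ₐ[R] A) :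
    Prop :=
  ∀ a, σ a - a ^ q ∈ Ideal.span {algebraMap R A π}

theorem span_pow_le_comap (π : R) {A : Type u} [CommRing A] [Algebra R A] (σ : A →ₐ[R] A) (n : ℕ) :
    Ideal.span {algebraMap R A π} ^ n ≤
      (Ideal.span {algebraMap R A π} ^ n).comap (σ : A →+* A) := by
  rw [← Ideal.map_le_iff_le_comap, Ideal.map_pow, Ideal.map_span]
  simp

/-- The endomorphism of `A / π ^ n A` induced by `σ`, composed with `Â → A / π ^ n A`. -/
def complEndAux (π : R) {A : Type u} [CommRing A] [Algebra R A] (σ : A →ₐ[R] A) (n : ℕ) :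
    Compl π A →+* A ⧸ Ideal.span {algebraMap R A π} ^ n :=
  (Ideal.quotientMap (Ideal.span {algebraMap R A π} ^ n) (σ : A →+* A)
    (span_pow_le_comap π σ n)).comp
      (AdicCompletion.evalₐ (Ideal.span {algebraMap R A π}) n : Compl π A →+* _)

theorem complEndAux_compat (π : R) {A : Type u} [CommRing A] [Algebra R A] (σ : A →ₐ[R] A)
    {m n : ℕ} (hle : m ≤ n) :
    (Ideal.Quotient.factorPow (Ideal.span {algebraMap R A π}) hle).comp (complEndAux π σ n) =
      complEndAux π σ m := by
  ext x
  obtain ⟨a, ha⟩ := Ideal.Quotient.mk_surjective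
    (AdicCompletion.evalₐ (Ideal.span {algebraMap R A π}) n x)
  have hm : AdicCompletion.evalₐ (Ideal.span {algebraMap R A π}) m x =
      Ideal.Quotient.factorPow _ hle
        (AdicCompletion.evalₐ (Ideal.span {algebraMap R A π}) n x) := by
    obtain ⟨y, rfl⟩ := AdicCompletion.mk_surjective _ _ x
    rw [AdicCompletion.evalₐ_mk, AdicCompletion.evalₐ_mk]
    exact (AdicCompletion.Ideal.mk_eq_mk _ hle y).symm
  simp [complEndAux, hm, ← ha]

/-- The endomorphism of the completion of `A` induced by `σ`. -/
def complEnd (π : R) {A : Type u} [CommRing A] [Algebra R A] (σ : A →ₐ[R] A) :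
    Compl π A →+* Compl π A :=
  AdicCompletion.liftRingHom (Ideal.span {algebraMap R A π}) (complEndAux π σ)
    (complEndAux_compat π σ)

theorem evalₐ_complEnd (π : R) {A : Type u} [CommRing A] [Algebra R A] (σ : A →ₐ[R] A)
    (n : ℕ) (x : Compl π A) :
    AdicCompletion.evalₐ (Ideal.span {algebraMap R A π}) n (complEnd π σ x) =
      Ideal.quotientMap (Ideal.span {algebraMap R A π} ^ n) (σ : A →+* A)
        (span_pow_le_comap π σ n) (AdicCompletion.evalₐ (Ideal.span {algebraMap R A π}) n x) :=
  AdicCompletion.evalₐ_liftRingHom _ _ (complEndAux_compat π σ) _ _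

theorem complEnd_algebraMap (π : R) {A : Type u} [CommRing A] [Algebra R A] (σ : A →ₐ[R] A)
    (a : A) : complEnd π σ (algebraMap A _ a) = algebraMap A _ (σ a) := by
  apply AdicCompletion.ext_evalₐ
  intro n
  rw [evalₐ_complEnd]
  simp

end Overconvergent

/-! ### Nuclear matrices and the Grothendieck group -/

section Matrices

variable {R : Type u} [CommRing R]

/-- A matrix with entries in an `R`-module `E` is nuclear if for every `N` all but finitely many
of its columns have all their entries in `π ^ N E`. -/
def IsNuclear (π : R) {E : Type*} [AddCommGroup E] [Module R E] {ι : Type*} (a : Matrix ι ι E) :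
    Prop :=
  ∀ N : ℕ, {j | ¬ ∀ i, ∃ y : E, a i j = π ^ N • y}.Finite

/-- Nuclear matrices over `S`, indexed by arbitrary countable sets. -/
structure NuclearMatrix (π : R) (S : Type v) [CommRing S] [Algebra R S] where
  /-- the index set -/
  idx : Type
  countable : Countable idx
  /-- the matrix -/
  mat : Matrix idx idx S
  nuclear : IsNuclear π mat

variable {S : Type v} [CommRing S] [Algebra R S]

/-- Every row of `a` tends to zero `π`-adically, i.e. `∑_k a_{ik} d_k` converges for all
families `(d_k)` in `S`, so that `a` acts on formal columns `∏ S`. -/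
def RowNull (π : R) {ι κ : Type*} (a : Matrix ι κ S) : Prop :=
  ∀ (N : ℕ) (i : ι), {k | ¬ ∃ y : S, a i k = π ^ N • y}.Finite

/-- The product of `a` and `b` converges coefficient-wise in the `π`-adic topology, and is `c`. -/
def IsProd (π : R) {ι κ l : Type*} (a : Matrix ι κ S) (b : Matrix κ l S) (c : Matrix ι l S) :
    Prop :=
  letI : TopologicalSpace S := (Ideal.span {algebraMap R S π}).adicTopology
  ∀ i j, HasSum (fun k => a i k * b k j) (c i j)

open Classical in
/-- `M₁` is `σ`-similar to `M₂`: there are topologically invertible matrices `P`, `Q`, inverse to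
each other, with `Q M₁ P^σ = M₂`. -/
def IsSigmaSimilar (π : R) (σ : S →+* S) (M₁ M₂ : NuclearMatrix π S) : Prop :=
  ∃ (P : Matrix M₁.idx M₂.idx S) (Q : Matrix M₂.idx M₁.idx S) (T : Matrix M₁.idx M₂.idx S),
    RowNull π P ∧ RowNull π Q ∧ IsProd π P Q 1 ∧ IsProd π Q P 1 ∧
    IsProd π M₁.mat (P.map σ) T ∧ IsProd π Q T M₂.mat

/-- The submatrix on a subset of the index set. -/
def NuclearMatrix.restrict {π : R} (M : NuclearMatrix π S) (s : Set M.idx) :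
    NuclearMatrix π S where
  idx := s
  countable := haveI := M.countable; inferInstance
  mat := M.mat.submatrix (↑) (↑)
  nuclear N := ((M.nuclear N).preimage Subtype.val_injective.injOn).subset
    fun _ hj h => hj fun i => h i

/-- The free abelian group on `σ`-similarity classes of nuclear matrices. -/
abbrev FreeNuc (π : R) (σ : S →+* S) := FreeAbelianGroup (Quot (IsSigmaSimilar π σ))

/-- The generator of `FreeNuc π σ` given by a nuclear matrix. -/
def freeClass {π : R} (σ : S →+* S) (M : NuclearMatrix π S) : FreeNuc π σ :=
  FreeAbelianGroup.of (Quot.mk _ M)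

/-- The subgroup generated by `[M] - [M'] - [M'']` for all block triangular `M` with diagonal
blocks `M'`, `M''`. -/
def blockRelations (π : R) (σ : S →+* S) : AddSubgroup (FreeNuc π σ) :=
  AddSubgroup.closure {x | ∃ (M : NuclearMatrix π S) (s : Set M.idx),
    (∀ i ∈ s, ∀ j ∉ s, M.mat i j = 0) ∧
    x = freeClass σ M - freeClass σ (M.restrict s) - freeClass σ (M.restrict sᶜ)}

/-- The Grothendieck group `Δ(S)` of nuclear `σ`-modules. -/
abbrev Delta (π : R) (σ : S →+* S) := FreeNuc π σ ⧸ blockRelations π σ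

/-- The class of a nuclear matrix in `Δ(S)`. -/
def cls {π : R} (σ : S →+* S) (M : NuclearMatrix π S) : Delta π σ :=
  QuotientAddGroup.mk (freeClass σ M)

/-- The orders of the matrices `C k` tend to infinity. -/
def OrdTendsto {π : R} {κ : Type*} (C : κ → NuclearMatrix π S) : Prop :=
  ∀ N : ℕ, {k | ¬ ∀ i j, ∃ y : S, (C k).mat i j = π ^ N • y}.Finite

theorem OrdTendsto.comp {π : R} {κ l : Type*} {C : κ → NuclearMatrix π S} (hC : OrdTendsto C)
    {f : l → κ} (hf : Function.Injective f) : OrdTendsto fun k => C (f k) :=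
  fun N => (hC N).preimage hf.injOn

open Classical in
/-- The block diagonal matrix `diag(C_k)_k`. -/
def NuclearMatrix.blockSum {π : R} {κ : Type} [Countable κ] (C : κ → NuclearMatrix π S)
    (hC : OrdTendsto C) : NuclearMatrix π S where
  idx := Σ k, (C k).idx
  countable := haveI := fun k => (C k).countable; inferInstance
  mat := Matrix.blockDiagonal' fun k => (C k).mat
  nuclear N := by
    refine Set.Finite.subset (Set.Finite.biUnion (hC N)
      fun k _ => ((C k).nuclear N).image (Sigma.mk k)) ?_
    rintro ⟨k, j⟩ hj
    have hj' : ¬ ∀ i, ∃ y : S, (C k).mat i j = π ^ N • y := by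
      intro h
      apply hj
      rintro ⟨k', i⟩
      by_cases hk : k' = k
      · subst hk
        simpa [Matrix.blockDiagonal'_apply_eq] using h i
      · exact ⟨0, by simp [Matrix.blockDiagonal'_apply_ne _ _ _ hk]⟩
    exact Set.mem_biUnion (x := k) (fun h => hj' fun i => h i j) ⟨j, hj', rfl⟩

/-- The element of `Δ(S)` represented by the convergent series `∑ ε_r [C_r]`, `ε_r = ± 1`: the
class of the block diagonal matrix formed by the `C_r` with `ε_r = 1`, minus the class of the one
formed by the `C_r` with `ε_r = -1`. -/
def signedSum {π : R} (σ : S →+* S) (C : ℕ → NuclearMatrix π S) (ε : ℕ → ℤˣ)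
    (hC : OrdTendsto C) : Delta π σ :=
  cls σ (NuclearMatrix.blockSum (fun r : {r // ε r = 1} => C r)
      (hC.comp Subtype.val_injective)) -
    cls σ (NuclearMatrix.blockSum (fun r : {r // ε r = -1} => C r)
      (hC.comp Subtype.val_injective))

/-- A finite square matrix, as a nuclear matrix. -/
def NuclearMatrix.ofFinite (π : R) {ι : Type} [Finite ι] (M : Matrix ι ι S) :
    NuclearMatrix π S where
  idx := ι
  countable := inferInstance
  mat := M
  nuclear _ := Set.toFinite _

/-- A matrix over the completion of `A = R[X]† / (g)` is nuclear overconvergent if it is the image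
of a nuclear matrix with entries in some `[m, c]`. -/
def IsOverconvergentMatrix {π : R} {n r : ℕ} (g : Fin r → MvPolynomial (Fin n) R)
    (C : NuclearMatrix π (Compl π (DaggerAlg π g))) : Prop :=
  ∃ (m c : ℕ) (hm : 0 < m) (hc : 0 < c) (a : Matrix C.idx C.idx (growth π n m c)),
    IsNuclear π a ∧ ∀ i j, C.mat i j =
      algebraMap (DaggerAlg π g) (Compl π (DaggerAlg π g))
        (DaggerAlg.mk π g ⟨a i j, mem_dagger_of_mem_growth hm hc (a i j).2⟩)

end Matrices

/-! ### Finite rank `σ`-modules -/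

section Modules

variable {S : Type u} [CommRing S]

/-- `S`, regarded as an `S`-module through `σ`. -/
def Twist (_σ : S →+* S) : Type u := S

instance (σ : S →+* S) : AddCommGroup (Twist σ) := inferInstanceAs (AddCommGroup S)

instance (σ : S →+* S) : Module S (Twist σ) := Module.compHom S σ

/-- The linearization `S_σ ⊗ M → M`, `a ⊗ u ↦ a φ(u)`, of a `σ`-linear endomorphism `φ`. -/
def linearization {σ : S →+* S} {M : Type*} [AddCommGroup M] [Module S M] (φ : M →ₛₗ[σ] M) :
    Twist σ ⊗[S] M →+ M :=
  TensorProduct.liftAddHom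
    (AddMonoidHom.mk' (fun a : S => AddMonoidHom.mk' (fun u => a • φ u)
        fun u v => by rw [map_add, smul_add])
      fun a b => by ext u; exact add_smul a b (φ u) : S →+ M →+ M)
    (fun s a u => by
      change (σ s * (show S from a)) • φ u = (show S from a) • φ (s • u)
      rw [φ.map_smulₛₗ, smul_smul, mul_comm])

/-- The `σ`-module is unit root: its linearization is bijective. -/
def IsUnitRoot {σ : S →+* S} {M : Type*} [AddCommGroup M] [Module S M] (φ : M →ₛₗ[σ] M) : Prop :=
  Function.Bijective (linearization φ)

/-- The matrix of a `σ`-linear endomorphism in a basis: `φ(b_j) = ∑_i M_{ij} b_i`. -/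
def sigmaMatrix {σ : S →+* S} {M : Type*} [AddCommGroup M] [Module S M] {ι : Type*}
    (b : Module.Basis ι S M) (φ : M →ₛₗ[σ] M) : Matrix ι ι S :=
  fun i j => b.repr (φ (b j)) i

/-- A filtration exhibiting a `σ`-module `(M, φ)` as ordinary: a `φ`-stable exhausting filtration
`0 = M_0 ⊆ M_1 ⊆ …` by free submodules with free quotients `U_i = M_{i+1} / M_i`, such that `φ`
acts on `U_i` as `ϖ ^ i φ_i` with `(U_i, φ_i)` a unit root `σ`-module. -/
structure OrdinaryFiltration (ϖ : S) {σ : S →+* S} {M : Type v} [AddCommGroup M] [Module S M]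
    (φ : M →ₛₗ[σ] M) where
  /-- the submodules `M_i` -/
  fil : ℕ → Submodule S M
  mono : Monotone fil
  fil_zero : fil 0 = ⊥
  iSup_fil : ⨆ i, fil i = ⊤
  stable : ∀ i, ∀ x ∈ fil i, φ x ∈ fil i
  free : ∀ i, Module.Free S (fil i)
  gr_free : ∀ i, Module.Free S (fil (i + 1) ⧸ (fil i).submoduleOf (fil (i + 1)))
  /-- the unit root endomorphisms `φ_i` -/
  grEnd : ∀ i, (fil (i + 1) ⧸ (fil i).submoduleOf (fil (i + 1))) →ₛₗ[σ]
    (fil (i + 1) ⧸ (fil i).submoduleOf (fil (i + 1)))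
  unitRoot : ∀ i, IsUnitRoot (grEnd i)
  map_mk : ∀ (i : ℕ) (x : fil (i + 1)),
    ((fil i).submoduleOf (fil (i + 1))).mkQ ⟨φ x, stable (i + 1) x x.2⟩ =
      ϖ ^ i • grEnd i (((fil i).submoduleOf (fil (i + 1))).mkQ x)

/-- The underlying module `U_i` of the `i`-th graded piece. -/
abbrev OrdinaryFiltration.Gr {ϖ : S} {σ : S →+* S} {M : Type v} [AddCommGroup M] [Module S M]
    {φ : M →ₛₗ[σ] M} (F : OrdinaryFiltration ϖ φ) (i : ℕ) : Type v :=
  F.fil (i + 1) ⧸ (F.fil i).submoduleOf (F.fil (i + 1))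

/-- `(M, φ)` over `Â` is overconvergent: it arises by base change `A → Â` from a finite rank
`σ`-module `(M₀, φ₀)` over `A`. -/
def IsOverconvergent {R : Type u} [CommRing R] (π : R) {A : Type u} [CommRing A] [Algebra R A]
    (σ : A →ₐ[R] A) {M : Type v} [AddCommGroup M] [Module (Compl π A) M]
    (φ : M →ₛₗ[complEnd π σ] M) : Prop :=
  ∃ (M₀ : Type u) (_ : AddCommGroup M₀) (_ : Module A M₀) (_ : Module.Free A M₀)
    (_ : Module.Finite A M₀) (φ₀ : M₀ →ₛₗ[(σ : A →+* A)] M₀)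
    (e : (Compl π A ⊗[A] M₀) ≃ₗ[Compl π A] M), ∀ m : M₀, φ (e (1 ⊗ₜ m)) = e (1 ⊗ₜ φ₀ m)

end Modules

end HodgeNewton

end

/-!
Throughout, `Â` denotes the completion of `A`. The class of the matrix of a graded piece is shown
to be a difference of the classes of only two overconvergent matrices.

**A fixed point.** The algebra `A` is weakly complete, so `π` lies in its Jacobson radical
(`isUnit_one_add`), and a matrix over `A` is invertible as soon as it is invertible over `Â`. Hence
a basis of the `σ`-module defined over `A` can be chosen close to a basis adapted to the slope
filtration. After a rescaling by powers of `π`, the matrix of `φ` is `Λ Φ (1 + π Z)` with `Φ`, `Z`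
over `A`, where `Λ = diag(π ^ bl)` and `Φ` is block diagonal and invertible, and a change of basis
`1 + π V` over `Â` makes it block triangular (`exists_approximation`, `exists_scaling`). Let `Y` be
the strictly lower triangular matrix such that `(1 - π Y) (1 + π V)` is block triangular. The `LU`
decomposition of `(1 + π Z) (1 - π x)⁻¹`, for a matrix `x` of independent variables, gives
expressions `F` and `W` in `x` with overconvergent coefficients such that `Y = F(σ(Y))` and such
that the graded piece has a matrix `σ`-similar to `W(σ(Y))` (`fixedPoint_unique`, `cls_block_eq`).
The solution `Y` is usually not overconvergent, but its equation is.

**Linearization.** The variables `x_a` are taken not to commute. Let `M(F, W)` be the matrix indexed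
by the pairs `(w, i)` of a word `w` and an index `i` of `W`, with entry at `(w, i)`, `(v, j)` the
coefficient of `v` in `F_w W_{ij}`, where `F_w` is the product of the `F_a` over the letters of `w`
(`wordMatrix`). It is nuclear and overconvergent, since the coefficients of long words in an
overconvergent series are highly divisible by `π` (`isOverconvergent_wordMatrix`). Over `Â` the
substitution `x ↦ x + Y` is a `σ`-similarity which moves the fixed point to the origin
(`cls_wordMatrix_translate`). Thereafter the matrix is block triangular for the length of words,
with diagonal blocks `L^{⊗ m} ⊗ W(σ(Y))`, `m ≥ 0`, where `L` is the Jacobian matrix of `F` at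
`σ(Y)`. The class of a matrix which is block triangular with respect to an infinite filtration is
that of its block diagonal part, by an Eilenberg swindle (`cls_graded`). If `J` is the matrix of
noncommutative partial derivatives of `F`, then `J(σ(Y)) = L`, and `M(F, J ⊗ W)` has the diagonal
blocks `L^{⊗ m} ⊗ W(σ(Y))`, `m ≥ 1`. Therefore `[W(σ(Y))] = [M(F, W)] - [M(F, J ⊗ W)]`
(`cls_fixedPoint`). In commuting variables the diagonal blocks would be symmetric powers, and an
alternating sum over exterior powers would be needed instead of the single relation
`T(L) = 1 + L ⊗ T(L)` for the tensor algebra.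
-/

open scoped TensorProduct

noncomputable section

namespace HodgeNewton

universe u v

/-! ### Equalities of classes of nuclear matrices -/

section Classes

variable {R : Type u} [CommRing R] {S : Type v} [CommRing S] [Algebra R S]

/-- A product of matrices, the rows of the first of which are finitely supported. -/
theorem isProd_of_finite_rows {π : R} {ι κ l : Type*} {a : Matrix ι κ S} {b : Matrix κ l S}
    {c : Matrix ι l S} (s : ι → Finset κ) (hs : ∀ i, ∀ k ∉ s i, a i k = 0)
    (hc : ∀ i j, c i j = ∑ k ∈ s i, a i k * b k j) : IsProd π a b c := by
  intro i j
  rw [hc]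
  let : TopologicalSpace S := (Ideal.span {algebraMap R S π}).adicTopology
  exact hasSum_sum_of_ne_finset_zero fun k hk => by rw [hs i k hk, zero_mul]

theorem rowNull_of_finite_rows {π : R} {ι κ : Type*} {a : Matrix ι κ S}
    (s : ι → Finset κ) (hs : ∀ i, ∀ k ∉ s i, a i k = 0) : RowNull π a := by
  intro N i
  refine (s i).finite_toSet.subset fun k hk => ?_
  by_contra h
  exact hk ⟨0, by rw [hs i k h, smul_zero]⟩

/-- Convergence in the adic topology of a principal ideal, in terms of congruences. -/
theorem hasSum_adic_iff {κ : Type*} (ϖ : S) (f : κ → S) (c : S) :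
    @HasSum S κ _ (Ideal.span {ϖ}).adicTopology f c (SummationFilter.unconditional κ) ↔
      ∀ N : ℕ, ∃ s₀ : Finset κ, ∀ s, s₀ ⊆ s → ϖ ^ N ∣ ∑ k ∈ s, f k - c := by
  let : TopologicalSpace S := (Ideal.span {ϖ}).adicTopology
  have hb := (Ideal.span {ϖ}).hasBasis_nhds_adic c
  simp only [HasSum, SummationFilter.unconditional_filter]
  rw [hb.tendsto_right_iff]
  simp only [forall_const, Filter.eventually_atTop]
  refine forall_congr' fun N => exists_congr fun s₀ => forall_congr' fun s => ?_
  refine imp_congr Iff.rfl ?_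
  simp only [Set.mem_image, SetLike.mem_coe, Ideal.span_singleton_pow, Ideal.mem_span_singleton]
  constructor
  · rintro ⟨y, hy, h⟩
    rwa [← h, add_sub_cancel_left]
  · intro h
    exact ⟨_, h, by ring⟩

theorem cls_eq_of_similar {π : R} {σ : S →+* S} {M₁ M₂ : NuclearMatrix π S}
    (h : IsSigmaSimilar π σ M₁ M₂) : cls σ M₁ = cls σ M₂ := by
  unfold cls freeClass
  rw [Quot.sound h]

/-- Matrices which agree up to a bijection of the index sets have the same class. -/
theorem cls_reindex {π : R} (σ : S →+* S) {M₁ M₂ : NuclearMatrix π S} (e : M₁.idx ≃ M₂.idx)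
    (h : ∀ i j, M₁.mat i j = M₂.mat (e i) (e j)) : cls σ M₁ = cls σ M₂ := by
  classical
  apply cls_eq_of_similar
  refine ⟨fun i j => if e i = j then 1 else 0, fun j i => if e.symm j = i then 1 else 0,
    fun i j => M₁.mat i (e.symm j), ?_, ?_, ?_, ?_, ?_, ?_⟩
  · exact rowNull_of_finite_rows (fun i => {e i}) fun i k hk => by
      rw [if_neg]; rintro rfl; simp at hk
  · exact rowNull_of_finite_rows (fun i => {e.symm i}) fun i k hk => by
      rw [if_neg]; rintro rfl; simp at hk
  · refine isProd_of_finite_rows (fun i => {e i}) (fun i k hk => ?_) (fun i j => ?_)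
    · rw [if_neg]; rintro rfl; simp at hk
    · simp [Matrix.one_apply]
  · refine isProd_of_finite_rows (fun i => {e.symm i}) (fun i k hk => ?_) (fun i j => ?_)
    · rw [if_neg]; rintro rfl; simp at hk
    · simp [Matrix.one_apply]
  · intro i j
    let : TopologicalSpace S := (Ideal.span {algebraMap R S π}).adicTopology
    have := hasSum_single (f := fun k => M₁.mat i k * σ (if e k = j then 1 else 0)) (e.symm j)
      fun k hk => by
        have : e k ≠ j := by rintro rfl; simp at hk
        simp [this]
    refine Eq.mpr ?_ this
    simp only [Equiv.apply_symm_apply, if_true, map_one, mul_one]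
    rfl
  · refine isProd_of_finite_rows (fun i => {e.symm i}) (fun i k hk => ?_) (fun i j => ?_)
    · rw [if_neg]; rintro rfl; simp at hk
    · simp [h]

/-- Finite matrices which are conjugate in the `σ`-twisted sense have the same class. -/
theorem cls_ofFinite_eq {π : R} (σ : S →+* S) {ι κ : Type} [Fintype ι] [Fintype κ]
    [dι : DecidableEq ι] [dκ : DecidableEq κ] {M₁ : Matrix ι ι S} {M₂ : Matrix κ κ S}
    (P : Matrix ι κ S) (Q : Matrix κ ι S) (hPQ : P * Q = 1) (hQP : Q * P = 1) (h : Q * M₁ * P.map σ = M₂) :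
    cls σ (NuclearMatrix.ofFinite π M₁) = cls σ (NuclearMatrix.ofFinite π M₂) := by
  obtain rfl : dι = fun a b => Classical.propDecidable (a = b) := Subsingleton.elim _ _
  obtain rfl : dκ = fun a b => Classical.propDecidable (a = b) := Subsingleton.elim _ _
  apply cls_eq_of_similar
  have key : ∀ {α β γ : Type} [Fintype β] (a : Matrix α β S) (b : Matrix β γ S),
      IsProd π a b (a * b) := fun a b =>
    isProd_of_finite_rows (fun _ => Finset.univ) (fun i k hk => absurd (Finset.mem_univ k) hk)
      (fun i j => rfl)
  refine ⟨P, Q, M₁ * P.map σ, fun _ _ => Set.toFinite (α := κ) _, fun _ _ => Set.toFinite (α := ι) _,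
    ?_, ?_, ?_, ?_⟩
  · exact hPQ ▸ key P Q
  · exact hQP ▸ key Q P
  · exact key (M₁ : Matrix ι ι S) (P.map σ)
  · rw [Matrix.mul_assoc] at h
    exact h ▸ key Q (M₁ * P.map σ)

theorem cls_split {π : R} (σ : S →+* S) (M : NuclearMatrix π S) (s : Set M.idx)
    (h : ∀ i ∈ s, ∀ j ∉ s, M.mat i j = 0) :
    cls σ M = cls σ (M.restrict s) + cls σ (M.restrict sᶜ) := by
  have : freeClass σ M - freeClass σ (M.restrict s) - freeClass σ (M.restrict sᶜ) ∈
      blockRelations π σ := AddSubgroup.subset_closure ⟨M, s, h, rfl⟩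
  have h2 := (QuotientAddGroup.eq_zero_iff _).mpr this
  rw [QuotientAddGroup.mk_sub, QuotientAddGroup.mk_sub, sub_sub, sub_eq_zero] at h2
  exact h2

/-- The block diagonal part of a matrix, for the partition of the index set into the fibres of a
function `ℓ`. -/
def NuclearMatrix.graded {π : R} (M : NuclearMatrix π S) (ℓ : M.idx → ℕ) : NuclearMatrix π S where
  idx := M.idx
  countable := M.countable
  mat i j := if ℓ i = ℓ j then M.mat i j else 0
  nuclear N := (M.nuclear N).subset fun j hj h => hj fun i => by
    dsimp only
    split_ifs
    · exact h i
    · exact ⟨0, by simp⟩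

theorem blockSum_mat_eq {π : R} {κ : Type} [Countable κ] (C : κ → NuclearMatrix π S)
    (hC : OrdTendsto C) (k : κ) (i j : (C k).idx) :
    (NuclearMatrix.blockSum C hC).mat ⟨k, i⟩ ⟨k, j⟩ = (C k).mat i j := by
  classical
  refine Eq.trans ?_ (Matrix.blockDiagonal'_apply_eq (fun k => (C k).mat) k i j)
  simp only [NuclearMatrix.blockSum]

theorem blockSum_mat_ne {π : R} {κ : Type} [Countable κ] (C : κ → NuclearMatrix π S)
    (hC : OrdTendsto C) {k l : κ} (hkl : k ≠ l) (i : (C k).idx) (j : (C l).idx) :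
    (NuclearMatrix.blockSum C hC).mat ⟨k, i⟩ ⟨l, j⟩ = 0 := by
  classical
  refine Eq.trans ?_ (Matrix.blockDiagonal'_apply_ne (fun k => (C k).mat) i j hkl)
  simp only [NuclearMatrix.blockSum]

/-- A nuclear matrix which is block triangular for a filtration indexed by `ℕ` has the same class
as its block diagonal part. The block diagonal matrix formed by all the tails `M_{≥ k}` of `M` is
an extension of `M` by the same matrix without its term `k = 0`, and also an extension of the
block diagonal part of `M` by the matrix formed by the `M_{≥ k + 1}`. -/
theorem cls_graded {π : R} (σ : S →+* S) (M : NuclearMatrix π S) (ℓ : M.idx → ℕ)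
    (h : ∀ i j, ℓ j < ℓ i → M.mat i j = 0) : cls σ M = cls σ (M.graded ℓ) := by
  classical
  let C : ℕ → NuclearMatrix π S := fun k => M.restrict {i | k ≤ ℓ i}
  -- for a given `N` the finitely many columns of `M` not divisible by `π ^ N` meet finitely many tails
  have hC : OrdTendsto C := by
    intro N
    obtain ⟨b, hb⟩ := ((M.nuclear N).image ℓ).bddAbove
    refine (Set.finite_Iic b).subset fun k hk => ?_
    by_contra hkb
    apply hk
    rintro ⟨i, hi⟩ ⟨j, hj⟩
    by_contra hij
    have hj' : j ∈ {j | ¬ ∀ i, ∃ y : S, M.mat i j = π ^ N • y} := fun hall => hij (hall i)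
    have := hb ⟨j, hj', rfl⟩
    exact hkb (le_trans hj this)
  let T := NuclearMatrix.blockSum C hC
  have hmat : ∀ x y : T.idx, T.mat x y = if x.1 = y.1 then M.mat x.2.1 y.2.1 else 0 := by
    rintro ⟨k, i⟩ ⟨l, j⟩
    by_cases hkl : k = l
    · subst hkl
      exact (blockSum_mat_eq C hC k i j).trans (if_pos rfl).symm
    · exact (blockSum_mat_ne C hC hkl i j).trans (if_neg hkl).symm
  -- `s₁` omits the summand `M_{≥ 0} = M`, and `s₂` omits from each `M_{≥ k}` its first diagonal block;
  -- the remaining matrices on `s₁` and on `s₂` are both the direct sum of all `M_{≥ k + 1}`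
  let s₁ : Set T.idx := {x | 1 ≤ x.1}
  let s₂ : Set T.idx := {x | x.1 < ℓ x.2.1}
  have e₁ := cls_split σ T s₁ (by
    intro x hx y hy
    exact (hmat x y).trans (if_neg fun h => hy (le_of_le_of_eq hx h)))
  have e₂ := cls_split σ T s₂ (by
    intro x hx y hy
    refine (hmat x y).trans (ite_eq_right_iff.mpr fun hxy => h _ _ ?_)
    exact lt_of_le_of_lt (not_lt.mp hy) (lt_of_eq_of_lt hxy.symm hx))
  have f₁ : cls σ (T.restrict s₁ᶜ) = cls σ M := by
    refine cls_reindex σ (M₁ := T.restrict s₁ᶜ) (M₂ := M)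
      { toFun := fun x => x.1.2.1
        invFun := fun i => ⟨⟨0, ⟨i, Nat.zero_le _⟩⟩, fun h => Nat.not_succ_le_zero 0 h⟩
        left_inv := ?_
        right_inv := fun i => rfl } ?_
    · rintro ⟨⟨k, i⟩, hk⟩
      obtain rfl : k = 0 := Nat.lt_one_iff.mp (not_le.mp hk)
      rfl
    · intro x y
      have hx : x.1.1 = 0 := Nat.lt_one_iff.mp (not_le.mp x.2)
      have hy : y.1.1 = 0 := Nat.lt_one_iff.mp (not_le.mp y.2)
      exact (hmat x.1 y.1).trans (if_pos (hx.trans hy.symm))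
  have f₂ : cls σ (T.restrict s₂ᶜ) = cls σ (M.graded ℓ) := by
    refine cls_reindex σ (M₁ := T.restrict s₂ᶜ) (M₂ := M.graded ℓ)
      { toFun := fun x => x.1.2.1
        invFun := fun i => ⟨⟨ℓ i, ⟨i, le_refl (ℓ i)⟩⟩, fun h => lt_irrefl (ℓ i) h⟩
        left_inv := ?_
        right_inv := fun i => rfl } ?_
    · rintro ⟨⟨k, ⟨i, hi⟩⟩, hk⟩
      obtain rfl : k = ℓ i := le_antisymm hi (not_lt.mp hk)
      rfl
    · intro x y
      have hx : x.1.1 = ℓ x.1.2.1 := le_antisymm x.1.2.2 (not_lt.mp x.2)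
      have hy : y.1.1 = ℓ y.1.2.1 := le_antisymm y.1.2.2 (not_lt.mp y.2)
      refine (hmat x.1 y.1).trans ?_
      refine if_congr ?_ rfl rfl
      exact hx ▸ hy ▸ Iff.rfl
  have f₃ : cls σ (T.restrict s₁) = cls σ (T.restrict s₂) := by
    refine cls_reindex σ (M₁ := T.restrict s₁) (M₂ := T.restrict s₂)
      { toFun := fun x => ⟨⟨x.1.1 - 1, ⟨x.1.2.1, le_trans (Nat.sub_le _ _) x.1.2.2⟩⟩, by
          have h1 : 1 ≤ x.1.1 := x.2
          have h2 : x.1.1 ≤ ℓ x.1.2.1 := x.1.2.2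
          change x.1.1 - 1 < ℓ x.1.2.1
          omega⟩
        invFun := fun x => ⟨⟨x.1.1 + 1, ⟨x.1.2.1, x.2⟩⟩, Nat.le_add_left _ _⟩
        left_inv := ?_
        right_inv := ?_ } ?_
    · rintro ⟨⟨k, ⟨i, hi⟩⟩, hk⟩
      obtain ⟨k, rfl⟩ : ∃ k', k = k' + 1 := ⟨k - 1, (Nat.sub_add_cancel hk).symm⟩
      rfl
    · rintro ⟨⟨k, ⟨i, hi⟩⟩, hk⟩
      rfl
    · intro x y
      have hx : 1 ≤ x.1.1 := x.2
      have hy : 1 ≤ y.1.1 := y.2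
      refine (hmat x.1 y.1).trans (Eq.trans ?_ (hmat ⟨x.1.1 - 1, ⟨x.1.2.1, _⟩⟩
        ⟨y.1.1 - 1, ⟨y.1.2.1, _⟩⟩).symm)
      refine if_congr ?_ rfl rfl
      change x.1.1 = y.1.1 ↔ x.1.1 - 1 = y.1.1 - 1
      omega
  rw [f₁] at e₁
  rw [f₂, ← f₃, e₁] at e₂
  exact add_left_cancel e₂

/-- The `0 × 0` matrix. -/
def NuclearMatrix.empty (π : R) (S : Type v) [CommRing S] [Algebra R S] : NuclearMatrix π S where
  idx := Empty
  countable := inferInstance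
  mat := 0
  nuclear _ := Set.toFinite (α := Empty) _

/-- A difference of two classes, as a convergent series whose other terms vanish. -/
theorem exists_signedSum_eq_sub {π : R} (σ : S →+* S) (M₁ M₂ : NuclearMatrix π S) :
    ∃ (C : ℕ → NuclearMatrix π S) (ε : ℕ → ℤˣ) (hC : OrdTendsto C),
      (∀ k, C k = M₁ ∨ C k = M₂ ∨ C k = NuclearMatrix.empty π S) ∧
        cls σ M₁ - cls σ M₂ = signedSum σ C ε hC := by
  classical
  let C : ℕ → NuclearMatrix π S := fun k =>
    if k = 0 then M₁ else if k = 1 then M₂ else NuclearMatrix.empty π S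
  let ε : ℕ → ℤˣ := fun k => if k = 1 then -1 else 1
  have hC0 : C 0 = M₁ := rfl
  have hC1 : C 1 = M₂ := rfl
  have hC2 : ∀ k, k ≠ 0 → k ≠ 1 → C k = NuclearMatrix.empty π S := fun k h0 h1 => by
    simp [C, h0, h1]
  have hC : OrdTendsto C := by
    intro N
    refine (Set.toFinite {0, 1}).subset fun k hk => ?_
    by_contra h
    simp only [Set.mem_insert_iff, Set.mem_singleton_iff, not_or] at h
    apply hk
    rw [hC2 k h.1 h.2]
    exact fun i => i.elim
  have hempty : ∀ k, k ≠ 0 → k ≠ 1 → (C k).idx → False := by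
    intro k h0 h1 i
    rw [hC2 k h0 h1] at i
    exact Empty.elim i
  have key : ∀ (η : ℤˣ) (r₀ : ℕ) (h₀ : ε r₀ = η) (_ : ∀ r, ε r = η → r ≠ r₀ → r ≠ 0 ∧ r ≠ 1),
      cls σ (C r₀) = cls σ (NuclearMatrix.blockSum (fun r : {r // ε r = η} => C r)
        (hC.comp Subtype.val_injective)) := by
    intro η r₀ h₀ h
    refine cls_reindex σ (M₂ := NuclearMatrix.blockSum (fun r : {r // ε r = η} => C r)
        (hC.comp Subtype.val_injective)) (Equiv.ofBijective
        (fun i : (C r₀).idx => (⟨⟨r₀, h₀⟩, i⟩ : Σ r : {r // ε r = η}, (C r).idx)) ⟨?_, ?_⟩) ?_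
    · intro i j hij
      exact eq_of_heq (Sigma.mk.inj hij).2
    · rintro ⟨⟨r, hr⟩, i⟩
      by_cases hrr : r = r₀
      · subst hrr; exact ⟨i, rfl⟩
      · exact (hempty r (h r hr hrr).1 (h r hr hrr).2 i).elim
    · intro i j
      exact (blockSum_mat_eq (fun r : {r // ε r = η} => C r) _ ⟨r₀, h₀⟩ i j).symm
  refine ⟨C, ε, hC, fun k => ?_, ?_⟩
  · by_cases h0 : k = 0
    · exact Or.inl (h0 ▸ hC0)
    · by_cases h1 : k = 1
      · exact Or.inr (Or.inl (h1 ▸ hC1))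
      · exact Or.inr (Or.inr (hC2 k h0 h1))
  · rw [signedSum, ← hC0, ← hC1, key 1 0 (by simp [ε]) ?_, key (-1) 1 (by simp [ε]) ?_]
    · intro r hr hr1
      exfalso
      simp [ε, hr1] at hr
    · intro r hr hr0
      refine ⟨hr0, ?_⟩
      rintro rfl
      simp [ε] at hr

end Classes

/-! ### Power series with coefficients of linearly bounded degree -/

section Filtration

open PowerSeries

/-- An increasing, multiplicative, not necessarily exhaustive filtration of a ring by additive
subgroups. -/
structure RingFiltration (k : Type*) [Ring k] where
  /-- the `n`-th step -/
  fil : ℕ → AddSubgroup k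
  mono : Monotone fil
  one_mem : 1 ∈ fil 0
  mul_mem : ∀ {a b : ℕ} {x y : k}, x ∈ fil a → y ∈ fil b → x * y ∈ fil (a + b)

variable {k : Type*} [Ring k] (D : RingFiltration k)

/-- The power series whose `j`-th coefficient has degree at most `m + c j`. -/
def RingFiltration.series (m c : ℕ) : AddSubgroup k⟦X⟧ where
  carrier := {f | ∀ j, coeff j f ∈ D.fil (m + c * j)}
  add_mem' hf hg j := by rw [map_add]; exact add_mem (hf j) (hg j)
  zero_mem' j := by rw [map_zero]; exact zero_mem _
  neg_mem' hf j := by rw [map_neg]; exact neg_mem (hf j)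

variable {D}

theorem RingFiltration.series_mono {m m' c c' : ℕ} (hm : m ≤ m') (hc : c ≤ c') :
    D.series m c ≤ D.series m' c' := fun _ hf j =>
  D.mono (add_le_add hm (Nat.mul_le_mul_right j hc)) (hf j)

theorem RingFiltration.series_mul {m m' c : ℕ} {f g : k⟦X⟧} (hf : f ∈ D.series m c)
    (hg : g ∈ D.series m' c) : f * g ∈ D.series (m + m') c := by
  intro j
  rw [coeff_mul]
  refine sum_mem fun x hx => ?_
  have : m + m' + c * j = (m + c * x.1) + (m' + c * x.2) := by
    rw [← Finset.HasAntidiagonal.mem_antidiagonal.mp hx]; ring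
  rw [this]
  exact D.mul_mem (hf _) (hg _)

theorem RingFiltration.series_mul_of_zero {m c : ℕ} {f g : k⟦X⟧} (hf : f ∈ D.series 0 c)
    (hg : g ∈ D.series m c) : f * g ∈ D.series m c := by
  simpa using D.series_mul hf hg

theorem RingFiltration.series_one {m c : ℕ} : (1 : k⟦X⟧) ∈ D.series m c := by
  intro j
  rw [coeff_one]
  split_ifs
  · exact D.mono (Nat.zero_le _) D.one_mem
  · exact zero_mem _

theorem RingFiltration.series_of_coeff_zero {m c : ℕ} {f : k⟦X⟧} (hf : f ∈ D.series m c)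
    (h0 : coeff 0 f = 0) : f ∈ D.series 0 (m + c) := by
  intro j
  rcases j with _ | j
  · rw [h0]; exact zero_mem _
  · refine D.mono ?_ (hf (j + 1))
    nlinarith

theorem RingFiltration.series_X_mul {m c : ℕ} {f : k⟦X⟧} (hf : f ∈ D.series m c) :
    X * f ∈ D.series 0 (m + c) := by
  intro j
  rcases j with _ | j
  · rw [coeff_zero_X_mul]; exact zero_mem _
  · rw [coeff_succ_X_mul]
    refine D.mono ?_ (hf j)
    nlinarith

theorem RingFiltration.series_C {m c : ℕ} {x : k} (hx : x ∈ D.fil m) :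
    C x ∈ D.series m c := by
  intro j
  rw [coeff_C]
  split_ifs
  · exact D.mono (Nat.le_add_right _ _) hx
  · exact zero_mem _

theorem coeff_matrix_mul {ι : Type*} [Fintype ι] (A B : Matrix ι ι k⟦X⟧) (d : ℕ) (i j : ι)
    (hB : ∀ l, coeff 0 (B l j) = 0) :
    coeff d ((A * B) i j) =
      ∑ a : Fin d, ∑ l, coeff a (A i l) * coeff (d - a) (B l j) := by
  rw [Matrix.mul_apply, map_sum, Finset.sum_comm]
  refine Finset.sum_congr rfl fun l _ => ?_
  rw [coeff_mul, Finset.Nat.sum_antidiagonal_eq_sum_range_succ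
    (fun a b => coeff a (A i l) * coeff b (B l j)), Finset.sum_range_succ, Nat.sub_self, hB,
    mul_zero, add_zero, Finset.sum_range]

open Classical in
/-- The coefficients of the solution `N` of `N = ((1 - N) E)_s`, where the index `s` denotes the
matrix obtained by keeping the entries with indices in `s`. -/
def maskedCoeff {ι : Type*} [Fintype ι] (s : ι → ι → Prop) (E : Matrix ι ι k⟦X⟧) :
    ℕ → Matrix ι ι k
  | d => fun i j => if s i j then coeff d (E i j) -
      ∑ a : Fin d, ∑ l, maskedCoeff s E a i l * coeff (d - a) (E l j) else 0

open Classical in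
/-- For a matrix `E` without constant term there is a matrix `N` without constant term, supported
on a given set `s` of indices, such that `(1 - N) (1 + E)` agrees with the unit matrix plus a
matrix vanishing on `s`. If `s` consists of all indices then `1 - N` is a left inverse of `1 + E`,
and if `s` consists of the indices below the diagonal this is an `LU` decomposition. -/
theorem exists_masked (D : RingFiltration k) {ι : Type*} [Fintype ι] (s : ι → ι → Prop) {c : ℕ}
    (E : Matrix ι ι k⟦X⟧) (hE : ∀ i j, E i j ∈ D.series 0 c) (h0 : ∀ i j, coeff 0 (E i j) = 0) :
    ∃ N : Matrix ι ι k⟦X⟧, (∀ i j, N i j ∈ D.series 0 c) ∧ (∀ i j, coeff 0 (N i j) = 0) ∧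
      ∀ i j, N i j = if s i j then (E - N * E) i j else 0 := by
  let N : Matrix ι ι k⟦X⟧ := fun i j => PowerSeries.mk fun d => maskedCoeff s E d i j
  have hN : ∀ d i j, coeff d (N i j) = if s i j then coeff d (E i j) -
      ∑ a : Fin d, ∑ l, coeff (a : ℕ) (N i l) * coeff (d - a) (E l j) else 0 := by
    intro d i j
    simp only [N, coeff_mk]
    rw [maskedCoeff]
  refine ⟨N, fun i j d => ?_, fun i j => ?_, fun i j => ?_⟩
  · induction d using Nat.strong_induction_on generalizing i j with
    | _ d ih =>
      rw [hN]
      split_ifs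
      · refine sub_mem (hE i j d) (sum_mem fun a _ => sum_mem fun l _ => ?_)
        have h1 := D.mul_mem (ih a a.2 i l) (hE l j (d - a))
        have : 0 + c * d = 0 + c * a + (0 + c * (d - a)) := by
          rw [zero_add, zero_add, zero_add, ← mul_add, Nat.add_sub_cancel' a.2.le]
        rwa [this]
      · exact zero_mem _
  · rw [hN]
    simp [h0]
  · ext d
    rw [hN]
    split_ifs
    · rw [Matrix.sub_apply, map_sub, coeff_matrix_mul _ _ _ _ _ fun l => h0 l j]
    · rw [map_zero]

end Filtration

/-! ### Complete rings -/

section Complete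

open PowerSeries

variable {S : Type*} [CommRing S] (ϖ : S)

theorem eq_zero_of_forall_pow_dvd [IsHausdorff (Ideal.span {ϖ}) S] {x : S}
    (h : ∀ n : ℕ, ϖ ^ n ∣ x) : x = 0 := by
  apply IsHausdorff.haus ‹IsHausdorff (Ideal.span {ϖ}) S› x
  intro n
  rw [SModEq.zero, Ideal.span_singleton_pow, smul_eq_mul, Ideal.mul_top,
    Ideal.mem_span_singleton]
  exact h n

theorem exists_series_limit [IsPrecomplete (Ideal.span {ϖ}) S] (f : ℕ → S) :
    ∃ s : S, ∀ n : ℕ, ϖ ^ n ∣ s - ∑ j ∈ Finset.range n, ϖ ^ j * f j := by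
  obtain ⟨s, hs⟩ := IsPrecomplete.prec ‹IsPrecomplete (Ideal.span {ϖ}) S›
    (f := fun n => ∑ j ∈ Finset.range n, ϖ ^ j * f j) (by
      intro m n hmn
      rw [SModEq.sub_mem, Ideal.span_singleton_pow, smul_eq_mul, Ideal.mul_top,
        Ideal.mem_span_singleton, ← neg_sub, dvd_neg, ← Finset.sum_Ico_eq_sub _ hmn]
      exact Finset.dvd_sum fun j hj => Dvd.dvd.mul_right
        (pow_dvd_pow _ (Finset.mem_Ico.mp hj).1) _)
  refine ⟨s, fun n => ?_⟩
  have := hs n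
  rwa [SModEq.sub_mem, Ideal.span_singleton_pow, smul_eq_mul, Ideal.mul_top,
    Ideal.mem_span_singleton, ← neg_sub, dvd_neg] at this

theorem sum_pow_mul_coeff (f : S⟦X⟧) (n : ℕ) :
    ∑ j ∈ Finset.range n, ϖ ^ j * coeff j f = (trunc n f).eval ϖ := by
  have := eval₂_trunc_eq_sum_range ϖ (RingHom.id S) n f
  simp only [RingHom.id_apply] at this
  rw [Polynomial.eval, this]
  exact Finset.sum_congr rfl fun j _ => mul_comm _ _

variable [hS : IsAdicComplete (Ideal.span {ϖ}) S]

/-- The value at `ϖ` of a power series. -/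
def evalFun (f : S⟦X⟧) : S := (exists_series_limit ϖ fun j => coeff j f).choose

theorem evalFun_spec (f : S⟦X⟧) (n : ℕ) :
    ϖ ^ n ∣ evalFun ϖ f - ∑ j ∈ Finset.range n, ϖ ^ j * coeff j f :=
  (exists_series_limit ϖ fun j => coeff j f).choose_spec n

theorem eq_evalFun {f : S⟦X⟧} {s : S}
    (h : ∀ n : ℕ, ϖ ^ n ∣ s - ∑ j ∈ Finset.range n, ϖ ^ j * coeff j f) : s = evalFun ϖ f := by
  rw [← sub_eq_zero]
  refine eq_zero_of_forall_pow_dvd ϖ fun n => ?_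
  have := dvd_sub (h n) (evalFun_spec ϖ f n)
  rwa [sub_sub_sub_cancel_right] at this

/-- Evaluation of power series at the topologically nilpotent element `ϖ`. -/
def evalAt : S⟦X⟧ →+* S where
  toFun := evalFun ϖ
  map_one' := by
    refine (eq_evalFun ϖ fun n => ?_).symm
    rcases n with _ | n
    · simp
    · rw [Finset.sum_range_succ']
      simp [coeff_one]
  map_zero' := (eq_evalFun ϖ fun n => by simp).symm
  map_add' f g := by
    refine (eq_evalFun ϖ fun n => ?_).symm
    have := dvd_add (evalFun_spec ϖ f n) (evalFun_spec ϖ g n)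
    simp only [map_add, mul_add, Finset.sum_add_distrib]
    convert this using 1
    ring
  map_mul' f g := by
    refine (eq_evalFun ϖ fun n => ?_).symm
    have h1 : ϖ ^ n ∣ evalFun ϖ f * evalFun ϖ g -
        (trunc n f).eval ϖ * (trunc n g).eval ϖ := by
      have hf := evalFun_spec ϖ f n
      have hg := evalFun_spec ϖ g n
      rw [sum_pow_mul_coeff] at hf hg
      have : evalFun ϖ f * evalFun ϖ g - (trunc n f).eval ϖ * (trunc n g).eval ϖ =
        (evalFun ϖ f - (trunc n f).eval ϖ) * evalFun ϖ g +
          (trunc n f).eval ϖ * (evalFun ϖ g - (trunc n g).eval ϖ) := by ring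
      rw [this]
      exact dvd_add (hf.mul_right _) (hg.mul_left _)
    have h2 : ϖ ^ n ∣ (trunc n f).eval ϖ * (trunc n g).eval ϖ - (trunc n (f * g)).eval ϖ := by
      rw [← Polynomial.eval_mul, ← Polynomial.eval_sub]
      obtain ⟨q, hq⟩ : (Polynomial.X : Polynomial S) ^ n ∣
          trunc n f * trunc n g - trunc n (f * g) := by
        rw [Polynomial.X_pow_dvd_iff]
        intro d hd
        rw [Polynomial.coeff_sub, coeff_trunc, if_pos hd, sub_eq_zero,
          coeff_mul_eq_coeff_trunc_mul_trunc f g hd, ← Polynomial.coe_mul,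
          Polynomial.coeff_coe]
      rw [hq]
      simp
    rw [sum_pow_mul_coeff]
    have := dvd_add h1 h2
    rwa [sub_add_sub_cancel] at this

theorem evalAt_spec (f : S⟦X⟧) (n : ℕ) :
    ϖ ^ n ∣ evalAt ϖ f - ∑ j ∈ Finset.range n, ϖ ^ j * coeff j f := evalFun_spec ϖ f n

theorem eq_evalAt {f : S⟦X⟧} {s : S}
    (h : ∀ n : ℕ, ϖ ^ n ∣ s - ∑ j ∈ Finset.range n, ϖ ^ j * coeff j f) : s = evalAt ϖ f :=
  eq_evalFun ϖ h

theorem evalAt_C (s : S) : evalAt ϖ (C s) = s := by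
  refine (eq_evalAt ϖ fun n => ?_).symm
  rcases n with _ | n
  · simp
  · rw [Finset.sum_range_succ']
    simp [coeff_C]

theorem evalAt_X : evalAt ϖ X = ϖ := by
  refine (eq_evalAt ϖ fun n => ?_).symm
  rcases n with _ | _ | n
  · simp
  · simp
  · rw [Finset.sum_range_succ', Finset.sum_range_succ']
    simp [coeff_X]

theorem dvd_evalAt {f : S⟦X⟧} {n : ℕ} (h : ∀ j < n, coeff j f = 0) : ϖ ^ n ∣ evalAt ϖ f := by
  have := evalAt_spec ϖ f n
  rwa [Finset.sum_eq_zero fun j hj => by rw [h j (Finset.mem_range.mp hj), mul_zero],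
    sub_zero] at this

/-- Uniqueness in the `LU` decomposition: a matrix `N` supported on `s` vanishes if the product
`N (1 + ϖ E)` vanishes on `s`. -/
theorem eq_zero_of_masked {ι : Type*} [Fintype ι] [DecidableEq ι] (s : ι → ι → Prop)
    (N E : Matrix ι ι S) (h0 : ∀ i j, ¬ s i j → N i j = 0)
    (h : ∀ i j, s i j → (N * (1 + ϖ • E)) i j = 0) : N = 0 := by
  have key : ∀ n : ℕ, ∀ i j, ϖ ^ n ∣ N i j := by
    intro n
    induction n with
    | zero => simp
    | succ n ih =>
      intro i j
      by_cases hs : s i j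
      · have h1 := h i j hs
        rw [mul_add, mul_one, Matrix.add_apply, Matrix.mul_smul, Matrix.smul_apply, smul_eq_mul] at h1
        rw [eq_neg_of_add_eq_zero_left h1, dvd_neg, pow_succ']
        refine mul_dvd_mul_left _ ?_
        rw [Matrix.mul_apply]
        exact Finset.dvd_sum fun l _ => (ih i l).mul_right _
      · rw [h0 i j hs]; exact dvd_zero _
  ext i j
  exact eq_zero_of_forall_pow_dvd ϖ fun n => key n i j

end Complete

/-! ### Noncommutative polynomials -/

section Words

open PowerSeries

/-- The ring of noncommutative polynomials over `k` in the variables `x_a`, `a ∈ κ`, whose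
monomials are the words in the alphabet `κ`. -/
abbrev WordAlg (κ k : Type*) [Semiring k] := MonoidAlgebra k (FreeMonoid κ)

instance {κ : Type*} [Countable κ] : Countable (FreeMonoid κ) :=
  inferInstanceAs (Countable (List κ))

theorem finite_length_le {κ : Type*} [Finite κ] (d : ℕ) :
    {v : FreeMonoid κ | v.length ≤ d}.Finite := List.finite_length_le κ d

theorem words_cases {κ : Type*} (v : FreeMonoid κ) :
    v = 1 ∨ ∃ a w, v = FreeMonoid.of a * w := by
  induction v using FreeMonoid.casesOn with
  | one => exact Or.inl rfl
  | of_mul a w => exact Or.inr ⟨a, w, rfl⟩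

/-- Equality of the lengths of the left factors of a word determines both factors. -/
theorem words_mul_inj {κ : Type*} {u u' v v' : FreeMonoid κ} (h : u * u' = v * v')
    (hl : u.length = v.length) : u = v ∧ u' = v' :=
  List.append_inj h hl

theorem finite_splits {κ : Type*} (v : FreeMonoid κ) :
    {p : FreeMonoid κ × FreeMonoid κ | p.1 * p.2 = v}.Finite := by
  refine Set.Finite.of_finite_image (f := fun p => p.1.length)
    ((Set.finite_Iic v.length).subset ?_) ?_
  · rintro _ ⟨p, rfl, rfl⟩
    simp
  · rintro ⟨p, p'⟩ hp ⟨q, q'⟩ hq h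
    obtain ⟨rfl, rfl⟩ := words_mul_inj (hp.trans hq.symm) h
    rfl

/-- The factorizations of a word. -/
def splits {κ : Type*} (v : FreeMonoid κ) : Finset (FreeMonoid κ × FreeMonoid κ) :=
  (finite_splits v).toFinset

theorem mem_splits {κ : Type*} {v : FreeMonoid κ} {p : FreeMonoid κ × FreeMonoid κ} :
    p ∈ splits v ↔ p.1 * p.2 = v := (finite_splits v).mem_toFinset

variable {κ : Type*}

/-- The filtration of the ring of noncommutative polynomials over a filtered ring by the total
degree, in which the variables have degree one: in step `d` the coefficient of a word `v` lies in
step `d - |v|`, and vanishes if `|v| > d`. -/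
def RingFiltration.words {k : Type*} [Ring k] (D : RingFiltration k) (κ : Type*) :
    RingFiltration (WordAlg κ k) where
  fil d :=
    { carrier := {p | ∀ v : FreeMonoid κ, (v.length ≤ d → p.coeff v ∈ D.fil (d - v.length)) ∧
        (d < v.length → p.coeff v = 0)}
      zero_mem' := fun v => ⟨fun _ => zero_mem _, fun _ => rfl⟩
      add_mem' := fun hp hq v => ⟨fun h => add_mem ((hp v).1 h) ((hq v).1 h), fun h => by
        rw [MonoidAlgebra.coeff_add, Finsupp.add_apply, (hp v).2 h, (hq v).2 h, add_zero]⟩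
      neg_mem' := fun {p} hp v => ⟨fun h => neg_mem ((hp v).1 h), fun h => by
        change -(p.coeff v) = 0
        rw [(hp v).2 h, neg_zero]⟩ }
  mono := fun a b hab p hp v => by
    refine ⟨fun h => ?_, fun h => (hp v).2 (lt_of_le_of_lt hab h)⟩
    by_cases h' : v.length ≤ a
    · exact D.mono (Nat.sub_le_sub_right hab _) ((hp v).1 h')
    · rw [(hp v).2 (not_le.mp h')]
      exact zero_mem _
  one_mem v := by
    classical
    rw [MonoidAlgebra.one_def, MonoidAlgebra.coeff_single, Finsupp.single_apply]
    refine ⟨fun _ => ?_, fun h => ?_⟩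
    · split_ifs
      · exact D.mono (Nat.zero_le _) D.one_mem
      · exact zero_mem _
    · rw [if_neg]
      rintro rfl
      simp at h
  mul_mem := fun {a b p q} hp hq v => by
    have h0 : ∀ x ∈ splits v, x.1.length + x.2.length = v.length := fun x hx => by
      rw [← FreeMonoid.length_mul, mem_splits.mp hx]
    rw [MonoidAlgebra.coeff_mul_antidiag p q v (splits v) mem_splits]
    refine ⟨fun h => sum_mem fun x hx => ?_, fun h => Finset.sum_eq_zero fun x hx => ?_⟩
    · have := h0 x hx
      by_cases h1 : x.1.length ≤ a
      · by_cases h2 : x.2.length ≤ b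
        · have e : a + b - v.length = (a - x.1.length) + (b - x.2.length) := by omega
          rw [e]
          exact D.mul_mem ((hp _).1 h1) ((hq _).1 h2)
        · rw [(hq _).2 (not_le.mp h2), mul_zero]; exact zero_mem _
      · rw [(hp _).2 (not_le.mp h1), zero_mul]; exact zero_mem _
    · have := h0 x hx
      by_cases h1 : x.1.length ≤ a
      · rw [(hq x.2).2 (by omega), mul_zero]
      · rw [(hp x.1).2 (not_le.mp h1), zero_mul]

theorem RingFiltration.single_mem_words {k : Type*} [Ring k] {D : RingFiltration k} {d : ℕ}
    {v : FreeMonoid κ} {x : k} (hx : x ∈ D.fil d) :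
    MonoidAlgebra.single v x ∈ (D.words κ).fil (d + v.length) := by
  classical
  intro w
  rw [MonoidAlgebra.coeff_single, Finsupp.single_apply]
  split_ifs with h
  · subst h
    refine ⟨fun _ => by simpa using hx, fun h => ?_⟩
    omega
  · exact ⟨fun _ => zero_mem _, fun _ => rfl⟩

/-- The filtration all of whose steps are the whole ring. -/
def trivialFil (k : Type*) [Ring k] : RingFiltration k where
  fil _ := ⊤
  mono _ _ _ := le_rfl
  one_mem := AddSubgroup.mem_top _
  mul_mem _ _ := AddSubgroup.mem_top _

variable {S : Type*} [CommRing S]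

theorem wordAlg_algebraMap (s : S) :
    algebraMap S (WordAlg κ S) s = MonoidAlgebra.single 1 s := by
  rw [MonoidAlgebra.coe_algebraMap]
  rfl

/-- The automorphism `x_a ↦ x_a + Y_a` of the ring of noncommutative polynomials. -/
def translate (Y : κ → S) : WordAlg κ S →ₐ[S] WordAlg κ S :=
  MonoidAlgebra.lift S (WordAlg κ S) (FreeMonoid κ) (FreeMonoid.lift fun a =>
    MonoidAlgebra.single (FreeMonoid.of a) 1 + MonoidAlgebra.single 1 (Y a))

theorem translate_single (Y : κ → S) (v : FreeMonoid κ) (s : S) :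
    translate Y (MonoidAlgebra.single v s) = s • translate Y (MonoidAlgebra.single v 1) := by
  rw [← map_smul, MonoidAlgebra.smul_single, smul_eq_mul, mul_one]

theorem translate_of (Y : κ → S) (a : κ) :
    translate Y (MonoidAlgebra.single (FreeMonoid.of a) 1) =
      MonoidAlgebra.single (FreeMonoid.of a) 1 + algebraMap S _ (Y a) := by
  simp [translate, wordAlg_algebraMap]

theorem wordAlg_hom_ext {B : Type*} [Semiring B] [Algebra S B] {f g : WordAlg κ S →ₐ[S] B}
    (h : ∀ a, f (MonoidAlgebra.single (FreeMonoid.of a) 1) =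
      g (MonoidAlgebra.single (FreeMonoid.of a) 1)) : f = g := by
  refine MonoidAlgebra.algHom_ext' ?_ (by ext)
  exact FreeMonoid.hom_eq fun a => h a

theorem translate_neg_translate (Y : κ → S) (p : WordAlg κ S) :
    translate (-Y) (translate Y p) = p := by
  have : (translate (-Y)).comp (translate Y) = AlgHom.id S _ := by
    refine wordAlg_hom_ext fun a => ?_
    rw [AlgHom.comp_apply, translate_of, map_add, translate_of, AlgHom.commutes]
    simp
  exact congr($this p)

theorem translate_mem_fil (Y : κ → S) {d : ℕ} {p : WordAlg κ S}
    (hp : p ∈ ((trivialFil S).words κ).fil d) :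
    translate Y p ∈ ((trivialFil S).words κ).fil d := by
  have h1 : ∀ v : FreeMonoid κ, translate Y (MonoidAlgebra.single v 1) ∈
      ((trivialFil S).words κ).fil v.length := by
    intro v
    induction v using FreeMonoid.inductionOn' with
    | one => rw [← MonoidAlgebra.one_def, map_one]; exact RingFiltration.one_mem _
    | of_mul a w ih =>
      have : MonoidAlgebra.single (FreeMonoid.of a * w) (1 : S) =
        MonoidAlgebra.single (FreeMonoid.of a) 1 * MonoidAlgebra.single w 1 := by simp
      rw [this, map_mul, FreeMonoid.length_mul]
      refine RingFiltration.mul_mem _ ?_ ih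
      rw [translate_of, wordAlg_algebraMap]
      have e1 := RingFiltration.single_mem_words (D := trivialFil S) (d := 0)
        (v := FreeMonoid.of a) (x := (1 : S)) (AddSubgroup.mem_top _)
      have e2 := RingFiltration.single_mem_words (D := trivialFil S) (d := 0)
        (v := (1 : FreeMonoid κ)) (x := Y a) (AddSubgroup.mem_top _)
      simp only [FreeMonoid.length_of, FreeMonoid.length_one, zero_add, add_zero] at e1 e2 ⊢
      exact add_mem e1 (RingFiltration.mono _ zero_le_one e2)
  rw [← MonoidAlgebra.sum_coeff_single p, Finsupp.sum, map_sum]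
  refine sum_mem fun v hv => ?_
  rw [translate_single]
  have hvd : v.length ≤ d := by
    by_contra h
    exact Finsupp.mem_support_iff.mp hv ((hp v).2 (not_le.mp h))
  have e := RingFiltration.mul_mem _ (RingFiltration.single_mem_words (D := trivialFil S) (d := 0)
        (v := (1 : FreeMonoid κ)) (x := p.coeff v) (AddSubgroup.mem_top _)) (h1 v)
  refine RingFiltration.mono _ ?_ (a := v.length) ?_
  · exact hvd
  · simp only [FreeMonoid.length_one, zero_add] at e
    convert e using 1
    rw [Algebra.smul_def, wordAlg_algebraMap]

theorem coeff_algHom_eq_sum (f : WordAlg κ S →ₐ[S] WordAlg κ S) (p : WordAlg κ S)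
    (v : FreeMonoid κ) : (f p).coeff v =
      ∑ u ∈ p.coeff.support, p.coeff u * (f (MonoidAlgebra.single u 1)).coeff v := by
  conv_lhs => rw [← MonoidAlgebra.sum_coeff_single p, Finsupp.sum, map_sum]
  rw [MonoidAlgebra.coeff_sum, Finsupp.finsetSum_apply]
  refine Finset.sum_congr rfl fun u _ => ?_
  have : MonoidAlgebra.single u (p.coeff u) = p.coeff u • MonoidAlgebra.single u (1 : S) := by
    rw [MonoidAlgebra.smul_single, smul_eq_mul, mul_one]
  rw [this, map_smul]
  rfl

/-- The endomorphism `translate` is compatible with a change of the coefficients. -/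
theorem map_translate (σ : S →+* S) (Y : κ → S) (p : WordAlg κ S) :
    MonoidAlgebra.mapRingHom _ σ (translate Y p) =
      translate (fun a => σ (Y a)) (MonoidAlgebra.mapRingHom _ σ p) := by
  have : (MonoidAlgebra.mapRingHom (FreeMonoid κ) σ).comp (translate Y).toRingHom =
      (translate fun a => σ (Y a)).toRingHom.comp (MonoidAlgebra.mapRingHom (FreeMonoid κ) σ) := by
    refine MonoidAlgebra.ringHom_ext' ?_ ?_
    · ext s
      simp [translate, MonoidAlgebra.one_def, MonoidAlgebra.coeff_single]
    · refine FreeMonoid.hom_eq fun a => ?_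
      simp [translate]
  exact congr($this p)

/-- The coefficient of a word in a power series of noncommutative polynomials. -/
def wordCoeff (v : FreeMonoid κ) : (WordAlg κ S)⟦X⟧ →ₗ[S] S⟦X⟧ where
  toFun Z := PowerSeries.mk fun j => (coeff j Z).coeff v
  map_add' Z Z' := by ext; simp
  map_smul' s Z := by
    ext j
    simp

theorem coeff_wordCoeff (v : FreeMonoid κ) (Z : (WordAlg κ S)⟦X⟧) (j : ℕ) :
    coeff j (wordCoeff v Z) = (coeff j Z).coeff v := by
  simp [wordCoeff]

theorem wordCoeff_mul (v : FreeMonoid κ) (Z Z' : (WordAlg κ S)⟦X⟧) :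
    wordCoeff v (Z * Z') = ∑ p ∈ splits v, wordCoeff p.1 Z * wordCoeff p.2 Z' := by
  ext j
  rw [coeff_wordCoeff, coeff_mul, MonoidAlgebra.coeff_sum, Finsupp.finsetSum_apply, map_sum]
  simp only [coeff_mul, coeff_wordCoeff]
  rw [Finset.sum_comm]
  exact Finset.sum_congr rfl fun x _ => MonoidAlgebra.coeff_mul_antidiag _ _ v _ mem_splits

variable (ϖ : S) [IsAdicComplete (Ideal.span {ϖ}) S]

/-- The coefficient of a word in the value at `ϖ` of a power series of noncommutative
polynomials. -/
def coeffAt (v : FreeMonoid κ) (Z : (WordAlg κ S)⟦X⟧) : S := evalAt ϖ (wordCoeff v Z)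

theorem coeffAt_add (v : FreeMonoid κ) (Z Z' : (WordAlg κ S)⟦X⟧) :
    coeffAt ϖ v (Z + Z') = coeffAt ϖ v Z + coeffAt ϖ v Z' := by
  simp [coeffAt]

theorem coeffAt_sub (v : FreeMonoid κ) (Z Z' : (WordAlg κ S)⟦X⟧) :
    coeffAt ϖ v (Z - Z') = coeffAt ϖ v Z - coeffAt ϖ v Z' := by
  simp [coeffAt]

theorem coeffAt_sum {α : Type*} (v : FreeMonoid κ) (s : Finset α) (Z : α → (WordAlg κ S)⟦X⟧) :
    coeffAt ϖ v (∑ x ∈ s, Z x) = ∑ x ∈ s, coeffAt ϖ v (Z x) := by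
  simp [coeffAt]

theorem coeffAt_smul (v : FreeMonoid κ) (s : S) (Z : (WordAlg κ S)⟦X⟧) :
    coeffAt ϖ v (s • Z) = s * coeffAt ϖ v Z := by
  rw [coeffAt, map_smul, PowerSeries.smul_eq_C_mul, map_mul, evalAt_C, coeffAt]

theorem coeffAt_mul (v : FreeMonoid κ) (Z Z' : (WordAlg κ S)⟦X⟧) :
    coeffAt ϖ v (Z * Z') = ∑ p ∈ splits v, coeffAt ϖ p.1 Z * coeffAt ϖ p.2 Z' := by
  simp [coeffAt, wordCoeff_mul]

theorem coeffAt_one_mul (Z Z' : (WordAlg κ S)⟦X⟧) :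
    coeffAt ϖ 1 (Z * Z') = coeffAt ϖ 1 Z * coeffAt ϖ 1 Z' := by
  rw [coeffAt_mul]
  have : splits (1 : FreeMonoid κ) = {(1, 1)} := by
    ext ⟨p, q⟩
    rw [mem_splits, Finset.mem_singleton, Prod.mk.injEq]
    refine ⟨fun h => ?_, fun h => by rw [h.1, h.2, one_mul]⟩
    have := congrArg FreeMonoid.length h
    simp only [FreeMonoid.length_mul, FreeMonoid.length_one, Nat.add_eq_zero_iff,
      FreeMonoid.length_eq_zero] at this
    exact this
  rw [this, Finset.sum_singleton]

theorem coeffAt_algebraMap (v : FreeMonoid κ) (hv : v ≠ 1) (s : S) :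
    coeffAt ϖ v (algebraMap S (WordAlg κ S)⟦X⟧ s) = 0 := by
  classical
  have : wordCoeff v (algebraMap S (WordAlg κ S)⟦X⟧ s) = 0 := by
    ext j
    rw [coeff_wordCoeff, PowerSeries.algebraMap_apply, coeff_C]
    split_ifs
    · rw [wordAlg_algebraMap, MonoidAlgebra.coeff_single, Finsupp.single_apply,
        if_neg (Ne.symm hv)]
      rfl
    · rfl
  rw [coeffAt, this, map_zero]

theorem coeffAt_one_algebraMap (s : S) :
    coeffAt ϖ (1 : FreeMonoid κ) (algebraMap S (WordAlg κ S)⟦X⟧ s) = s := by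
  have : wordCoeff (1 : FreeMonoid κ) (algebraMap S (WordAlg κ S)⟦X⟧ s) = C s := by
    ext j
    rw [coeff_wordCoeff, PowerSeries.algebraMap_apply, coeff_C, coeff_C]
    split_ifs
    · rw [wordAlg_algebraMap, MonoidAlgebra.coeff_single]
      simp
    · rfl
  rw [coeffAt, this, evalAt_C]

/-- The leading terms of a product of two series of orders at least `a` and `b`. -/
theorem coeffAt_mul_of_order {Z Z' : (WordAlg κ S)⟦X⟧} {a b : ℕ}
    (hZ : ∀ u : FreeMonoid κ, u.length < a → coeffAt ϖ u Z = 0)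
    (hZ' : ∀ u : FreeMonoid κ, u.length < b → coeffAt ϖ u Z' = 0) :
    (∀ v : FreeMonoid κ, v.length < a + b → coeffAt ϖ v (Z * Z') = 0) ∧
    ∀ v v' : FreeMonoid κ, v.length = a → v'.length = b →
      coeffAt ϖ (v * v') (Z * Z') = coeffAt ϖ v Z * coeffAt ϖ v' Z' := by
  constructor
  · intro v hv
    rw [coeffAt_mul]
    refine Finset.sum_eq_zero fun p hp => ?_
    rw [← mem_splits.mp hp, FreeMonoid.length_mul] at hv
    by_cases h : p.1.length < a
    · rw [hZ _ h, zero_mul]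
    · rw [hZ' p.2 (by omega), mul_zero]
  · intro v v' hv hv'
    rw [coeffAt_mul, Finset.sum_eq_single_of_mem (v, v') (mem_splits.mpr rfl)]
    · rintro ⟨u, u'⟩ hp hne
      have huv := mem_splits.mp hp
      have hl := congrArg FreeMonoid.length huv
      simp only [FreeMonoid.length_mul] at hl
      rcases lt_trichotomy u.length a with h | h | h
      · rw [hZ _ h, zero_mul]
      · obtain ⟨rfl, rfl⟩ := words_mul_inj huv (h.trans hv.symm)
        exact absurd rfl hne
      · rw [hZ' u' (by omega), mul_zero]

theorem dvd_coeffAt {m c N : ℕ} {Z : (WordAlg κ S)⟦X⟧}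
    (hZ : Z ∈ ((trivialFil S).words κ).series m c) {v : FreeMonoid κ} (hv : m + c * N < v.length) :
    ϖ ^ N ∣ coeffAt ϖ v Z := by
  refine dvd_evalAt ϖ fun j hj => ?_
  rw [coeff_wordCoeff]
  exact (hZ j v).2 (lt_of_le_of_lt (by gcongr) hv)

end Words

/-! ### The action of a noncommutative substitution on words -/

section Substitution

open PowerSeries

variable {R : Type u} [CommRing R] {S : Type v} [CommRing S] [Algebra R S] (π : R) {κ I : Type}

/-- The matrices of the substitutions `x_a ↦ x_a ± Y_a` on words are inverse to each other. -/
theorem isProd_translate [DecidableEq I] (Y : κ → S)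
    (_ : DecidableEq (FreeMonoid κ × I)) :
    IsProd π
      (fun x y : FreeMonoid κ × I => if x.2 = y.2 then
        (translate Y (MonoidAlgebra.single x.1 (1 : S))).coeff y.1 else 0)
      (fun x y : FreeMonoid κ × I => if x.2 = y.2 then
        (translate (-Y) (MonoidAlgebra.single x.1 (1 : S))).coeff y.1 else 0) 1 := by
  classical
  refine isProd_of_finite_rows
    (fun x => (translate Y (MonoidAlgebra.single x.1 (1 : S))).coeff.support ×ˢ {x.2}) ?_ ?_
  · rintro ⟨w, i⟩ ⟨u, l⟩ h
    dsimp only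
    split_ifs with hil
    · by_contra h0
      refine h (Finset.mem_product.mpr ⟨Finsupp.mem_support_iff.mpr h0, ?_⟩)
      exact Finset.mem_singleton.mpr hil.symm
    · rfl
  · rintro ⟨w, i⟩ ⟨v, j⟩
    rw [Finset.sum_product]
    simp only [Finset.sum_singleton, if_true, Matrix.one_apply, Prod.mk.injEq]
    by_cases hij : i = j
    · have := coeff_algHom_eq_sum (translate (-Y)) (translate Y (MonoidAlgebra.single w 1)) v
      rw [translate_neg_translate, MonoidAlgebra.coeff_single, Finsupp.single_apply] at this
      simp only [hij, if_true, and_true]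
      exact this
    · simp [hij]

variable [IsAdicComplete (Ideal.span {algebraMap R S π}) S]

theorem lift_mem_series {D : RingFiltration (WordAlg κ S)} {c : ℕ} {F : κ → (WordAlg κ S)⟦X⟧}
    (hF : ∀ a, F a ∈ D.series 0 c) (w : FreeMonoid κ) :
    FreeMonoid.lift F w ∈ D.series 0 c := by
  induction w using FreeMonoid.inductionOn' with
  | one => rw [map_one]; exact RingFiltration.series_one
  | of_mul a w ih =>
    rw [map_mul, FreeMonoid.lift_eval_of]
    exact RingFiltration.series_mul_of_zero (hF a) ih

/-- Translation of the variables in a noncommutative power series. -/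
def translateSeries (Y : κ → S) : (WordAlg κ S)⟦X⟧ →+* (WordAlg κ S)⟦X⟧ :=
  PowerSeries.map (translate Y : WordAlg κ S →+* WordAlg κ S)

theorem translateSeries_mem {Y : κ → S} {m c : ℕ} {Z : (WordAlg κ S)⟦X⟧}
    (hZ : Z ∈ ((trivialFil S).words κ).series m c) :
    translateSeries Y Z ∈ ((trivialFil S).words κ).series m c := by
  intro j
  rw [translateSeries, coeff_map]
  exact translate_mem_fil Y (hZ j)

/-- The substitution of `F(x + Y')` in the translate of a noncommutative polynomial by `-Y` is the
substitution of `F(x + Y') - Y` in the polynomial. -/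
theorem translateSeries_eq_lift (F : κ → (WordAlg κ S)⟦X⟧) (Y Y' : κ → S) (p : WordAlg κ S) :
    MonoidAlgebra.lift S (WordAlg κ S)⟦X⟧ (FreeMonoid κ)
        (FreeMonoid.lift fun a => translateSeries Y' (F a)) (translate (-Y) p) =
      MonoidAlgebra.lift S (WordAlg κ S)⟦X⟧ (FreeMonoid κ)
        (FreeMonoid.lift fun a => translateSeries Y' (F a) - algebraMap S _ (Y a)) p := by
  refine congr($(wordAlg_hom_ext (f := (MonoidAlgebra.lift S (WordAlg κ S)⟦X⟧ (FreeMonoid κ)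
    (FreeMonoid.lift fun a => translateSeries Y' (F a))).comp (translate (-Y)))
    (g := MonoidAlgebra.lift S (WordAlg κ S)⟦X⟧ (FreeMonoid κ)
        (FreeMonoid.lift fun a => translateSeries Y' (F a) - algebraMap S _ (Y a)))
    fun a => ?_) p)
  rw [AlgHom.comp_apply, translate_of, map_add, AlgHom.commutes]
  simp [sub_eq_add_neg]

theorem sub_algebraMap_mem_series {m c : ℕ} {Z : (WordAlg κ S)⟦X⟧} (s : S)
    (hZ : Z ∈ ((trivialFil S).words κ).series m c) :
    Z - algebraMap S _ s ∈ ((trivialFil S).words κ).series m c := by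
  refine sub_mem hZ ?_
  rw [PowerSeries.algebraMap_apply, wordAlg_algebraMap]
  refine RingFiltration.series_mono (Nat.zero_le m) le_rfl (RingFiltration.series_C ?_)
  exact RingFiltration.single_mem_words (D := trivialFil S) (d := 0) (v := (1 : FreeMonoid κ))
    (AddSubgroup.mem_top _)

variable [Finite κ] [Finite I]

/-- For noncommutative power series `F_a` and a matrix `W = (W_{ij})` of noncommutative power
series, the matrix whose entry at `(w, i)`, `(v, j)`, where `w`, `v` are words, is the coefficient
of `v` in `F_w W_{ij}`; here `F_w` is the product of the `F_a`, `a` running through the letters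
of `w`. -/
def wordMatrix {m c : ℕ} (F : κ → (WordAlg κ S)⟦X⟧) (W : Matrix I I (WordAlg κ S)⟦X⟧)
    (hF : ∀ a, F a ∈ ((trivialFil S).words κ).series 0 c)
    (hW : ∀ i j, W i j ∈ ((trivialFil S).words κ).series m c) : NuclearMatrix π S where
  idx := FreeMonoid κ × I
  countable := inferInstance
  mat := fun x y => coeffAt (algebraMap R S π) y.1 (FreeMonoid.lift F x.1 * W x.2 y.2)
  nuclear N := by
    refine ((finite_length_le (m + c * N)).prod (Set.finite_univ (α := I))).subset ?_
    rintro ⟨v, j⟩ hv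
    refine ⟨?_, Set.mem_univ _⟩
    by_contra h
    refine hv ?_
    rintro ⟨w, i⟩
    obtain ⟨y, hy⟩ := dvd_coeffAt (algebraMap R S π)
      (RingFiltration.series_mul_of_zero (lift_mem_series hF w) (hW i j)) (not_le.mp h)
    exact ⟨y, by rw [Algebra.smul_def, map_pow]; exact hy⟩

/-- The coefficients of a translated series are convergent sums in the coefficients of the series. -/
theorem hasSum_coeffAt_translate (ϖ : S) [IsAdicComplete (Ideal.span {ϖ}) S] (Y : κ → S) {m c : ℕ}
    {Z : (WordAlg κ S)⟦X⟧} (hZ : Z ∈ ((trivialFil S).words κ).series m c) (v : FreeMonoid κ) :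
    @HasSum S (FreeMonoid κ) _ (Ideal.span {ϖ}).adicTopology
      (fun u => coeffAt ϖ u Z * (translate Y (MonoidAlgebra.single u 1)).coeff v)
      (coeffAt ϖ v (translateSeries Y Z)) (SummationFilter.unconditional _) := by
  rw [hasSum_adic_iff]
  intro N
  refine ⟨(finite_length_le (m + c * N)).toFinset, fun s hs => ?_⟩
  have h1 : ϖ ^ N ∣ ∑ u ∈ s, coeffAt ϖ u Z * (translate Y (MonoidAlgebra.single u 1)).coeff v -
      ∑ u ∈ s, (∑ j ∈ Finset.range N, ϖ ^ j * (coeff j Z).coeff u) *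
        (translate Y (MonoidAlgebra.single u 1)).coeff v := by
    rw [← Finset.sum_sub_distrib]
    refine Finset.dvd_sum fun u _ => ?_
    rw [← sub_mul]
    have := evalAt_spec ϖ (wordCoeff u Z) N
    simp only [coeff_wordCoeff] at this
    exact this.mul_right _
  have h2 := evalAt_spec ϖ (wordCoeff v (translateSeries Y Z)) N
  have h3 : ∑ u ∈ s, (∑ j ∈ Finset.range N, ϖ ^ j * (coeff j Z).coeff u) *
        (translate Y (MonoidAlgebra.single u 1)).coeff v =
      ∑ j ∈ Finset.range N, ϖ ^ j * coeff j (wordCoeff v (translateSeries Y Z)) := by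
    simp only [Finset.sum_mul]
    rw [Finset.sum_comm]
    refine Finset.sum_congr rfl fun j hj => ?_
    rw [coeff_wordCoeff, translateSeries, coeff_map]
    have := coeff_algHom_eq_sum (translate Y) (coeff j Z) v
    refine Eq.trans ?_ (congrArg (fun x => ϖ ^ j * x) this.symm)
    rw [Finset.mul_sum]
    simp only [mul_assoc]
    refine (Finset.sum_subset (fun u hu => hs ?_) fun u _ hu => ?_).symm
    · rw [Set.Finite.mem_toFinset, Set.mem_ofPred_eq]
      by_contra h
      refine Finsupp.mem_support_iff.mp hu ((hZ j u).2 (lt_of_le_of_lt ?_ (not_le.mp h)))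
      have := (Finset.mem_range.mp hj).le
      gcongr
    · rw [Finsupp.notMem_support_iff.mp hu]
      simp
  rw [h3] at h1
  have := dvd_sub h1 h2
  rwa [sub_sub_sub_cancel_right] at this

/-- The change of coordinates `x_a ↦ x_a + Y_a` transforms the matrix given by `F` and `W` to the
matrix given by `F(x + σ(Y)) - Y` and `W(x + σ(Y))`. -/
theorem cls_wordMatrix_translate (σ : S →+* S) {m c : ℕ} (F : κ → (WordAlg κ S)⟦X⟧)
    (W : Matrix I I (WordAlg κ S)⟦X⟧)
    (hF : ∀ a, F a ∈ ((trivialFil S).words κ).series 0 c)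
    (hW : ∀ i j, W i j ∈ ((trivialFil S).words κ).series m c) (Y : κ → S) :
    cls σ (wordMatrix π F W hF hW) =
      cls σ (wordMatrix π
        (fun a => translateSeries (fun b => σ (Y b)) (F a) - algebraMap S _ (Y a))
        (fun i j => translateSeries (fun b => σ (Y b)) (W i j))
        (fun a => sub_algebraMap_mem_series _ (translateSeries_mem (hF a)))
        (fun i j => translateSeries_mem (hW i j))) := by
  classical
  apply cls_eq_of_similar
  have hrow : ∀ (Y : κ → S) (x : FreeMonoid κ × I), ∀ y ∉
      (translate Y (MonoidAlgebra.single x.1 (1 : S))).coeff.support ×ˢ ({x.2} : Finset I),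
      (if x.2 = y.2 then
        (translate Y (MonoidAlgebra.single x.1 (1 : S))).coeff y.1 else 0) = 0 := by
    rintro Y ⟨w, i⟩ ⟨u, l⟩ h
    dsimp only
    split_ifs with hil
    · by_contra h0
      refine h (Finset.mem_product.mpr ⟨Finsupp.mem_support_iff.mpr h0, ?_⟩)
      exact Finset.mem_singleton.mpr hil.symm
    · rfl
  -- the rows of the new matrix are finite combinations of translated rows of the old one
  have key : ∀ (w : FreeMonoid κ) (i : I) (v : FreeMonoid κ) (j : I),
      coeffAt (algebraMap R S π) v (FreeMonoid.lift
        (fun a => translateSeries (fun b => σ (Y b)) (F a) - algebraMap S _ (Y a)) w *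
          translateSeries (fun b => σ (Y b)) (W i j)) =
      ∑ u ∈ (translate (-Y) (MonoidAlgebra.single w (1 : S))).coeff.support,
        (translate (-Y) (MonoidAlgebra.single w (1 : S))).coeff u *
          coeffAt (algebraMap R S π) v
            (translateSeries (fun b => σ (Y b)) (FreeMonoid.lift F u * W i j)) := by
    intro w i v j
    have h1 := translateSeries_eq_lift F Y (fun b => σ (Y b)) (MonoidAlgebra.single w 1)
    rw [MonoidAlgebra.lift_single, one_smul] at h1
    rw [← h1, MonoidAlgebra.lift_apply, Finsupp.sum, Finset.sum_mul, coeffAt_sum]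
    refine Finset.sum_congr rfl fun u _ => ?_
    rw [smul_mul_assoc, coeffAt_smul, map_mul]
    congr 3
    exact (FreeMonoid.hom_map_lift (translateSeries fun b => σ (Y b)).toMonoidHom F u).symm
  refine ⟨fun (x y : FreeMonoid κ × I) => if x.2 = y.2 then
        (translate Y (MonoidAlgebra.single x.1 (1 : S))).coeff y.1 else 0,
      fun (x y : FreeMonoid κ × I) => if x.2 = y.2 then
        (translate (-Y) (MonoidAlgebra.single x.1 (1 : S))).coeff y.1 else 0,
      fun (x y : FreeMonoid κ × I) => coeffAt (algebraMap R S π) y.1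
        (translateSeries (fun b => σ (Y b)) (FreeMonoid.lift F x.1 * W x.2 y.2)), ?_, ?_, ?_, ?_,
      ?_, ?_⟩
  · exact rowNull_of_finite_rows _ (hrow Y)
  · exact rowNull_of_finite_rows _ (hrow (-Y))
  · exact isProd_translate π Y _
  · have := isProd_translate (I := I) π (-Y) fun a b => Classical.propDecidable (a = b)
    rw [neg_neg] at this
    exact this
  · rintro ⟨w, i⟩ ⟨v, j⟩
    let : TopologicalSpace S := (Ideal.span {algebraMap R S π}).adicTopology
    have h1 := hasSum_coeffAt_translate (algebraMap R S π) (fun b => σ (Y b))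
      (RingFiltration.series_mul_of_zero (lift_mem_series hF w) (hW i j)) v
    refine ((Function.Injective.hasSum_iff (g := fun u : FreeMonoid κ => (u, j))
      (f := fun k : FreeMonoid κ × I => coeffAt (algebraMap R S π) k.1
        (FreeMonoid.lift F w * W i k.2) * σ (if k.2 = j then
        (translate Y (MonoidAlgebra.single k.1 (1 : S))).coeff v else 0))
      (fun u u' h => (Prod.ext_iff.mp h).1) ?_).mp ?_)
    · rintro ⟨u, l⟩ hx
      have : l ≠ j := by
        rintro rfl
        exact hx ⟨u, rfl⟩
      simp [this]
    · refine Eq.mpr (congrArg (fun f => HasSum f _) (funext fun u => ?_)) h1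
      simp only [Function.comp_apply, if_true]
      congr 1
      have := congrArg (fun p => p.coeff v) (map_translate σ Y (MonoidAlgebra.single u 1))
      simpa using this
  · refine isProd_of_finite_rows _ (hrow (-Y)) ?_
    rintro ⟨w, i⟩ ⟨v, j⟩
    refine (key w i v j).trans (Eq.symm ((Finset.sum_product _ _ _).trans ?_))
    simp only [Finset.sum_singleton, if_true]

end Substitution

/-! ### Fixed points of noncommutative substitutions -/

section FixedPoint

open PowerSeries

variable {R : Type u} [CommRing R] {S : Type v} [CommRing S] [Algebra R S] {κ I : Type}

section Order

variable (ϖ : S) [IsAdicComplete (Ideal.span {ϖ}) S] {F : κ → (WordAlg κ S)⟦X⟧}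

/-- If the series `F_a` have no constant term then `F_w` has order at least the length of `w`. -/
theorem coeffAt_lift_of_length_lt (hF : ∀ a, coeffAt ϖ 1 (F a) = 0) (w : FreeMonoid κ) :
    ∀ v : FreeMonoid κ, v.length < w.length → coeffAt ϖ v (FreeMonoid.lift F w) = 0 := by
  induction w using FreeMonoid.inductionOn' with
  | one => intro v hv; simp at hv
  | of_mul a w ih =>
    intro v hv
    rw [map_mul, FreeMonoid.lift_eval_of]
    refine (coeffAt_mul_of_order ϖ (a := 1) (b := w.length) (fun u hu => ?_) ih).1 v ?_
    · rw [FreeMonoid.length_eq_zero.mp (Nat.lt_one_iff.mp hu)]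
      exact hF a
    · rwa [FreeMonoid.length_mul, FreeMonoid.length_of] at hv

theorem coeffAt_lift_mul_of_length_lt (hF : ∀ a, coeffAt ϖ 1 (F a) = 0) (w v : FreeMonoid κ)
    (Z : (WordAlg κ S)⟦X⟧) (h : v.length < w.length) :
    coeffAt ϖ v (FreeMonoid.lift F w * Z) = 0 :=
  (coeffAt_mul_of_order ϖ (b := 0) (coeffAt_lift_of_length_lt ϖ hF w)
    fun _ hu => absurd hu (Nat.not_lt_zero _)).1 v h

theorem coeffAt_lift_mul_of_length_eq (hF : ∀ a, coeffAt ϖ 1 (F a) = 0) (w v : FreeMonoid κ)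
    (Z : (WordAlg κ S)⟦X⟧) (h : v.length = w.length) :
    coeffAt ϖ v (FreeMonoid.lift F w * Z) =
      coeffAt ϖ v (FreeMonoid.lift F w) * coeffAt ϖ 1 Z := by
  have := (coeffAt_mul_of_order ϖ (b := 0) (Z' := Z) (coeffAt_lift_of_length_lt ϖ hF w)
    fun _ hu => absurd hu (Nat.not_lt_zero _)).2 v 1 h FreeMonoid.length_one
  rwa [mul_one] at this

theorem coeffAt_lift_of_mul (hF : ∀ a, coeffAt ϖ 1 (F a) = 0) (a b : κ) (w v : FreeMonoid κ)
    (h : v.length = w.length) :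
    coeffAt ϖ (FreeMonoid.of b * v) (FreeMonoid.lift F (FreeMonoid.of a * w)) =
      coeffAt ϖ (FreeMonoid.of b) (F a) * coeffAt ϖ v (FreeMonoid.lift F w) := by
  rw [map_mul, FreeMonoid.lift_eval_of]
  refine (coeffAt_mul_of_order ϖ (a := 1) (b := w.length) (fun u hu => ?_)
    (coeffAt_lift_of_length_lt ϖ hF w)).2 _ _ (FreeMonoid.length_of b) h
  rw [FreeMonoid.length_eq_zero.mp (Nat.lt_one_iff.mp hu)]
  exact hF a

end Order

variable (π : R) [IsAdicComplete (Ideal.span {algebraMap R S π}) S] [Finite κ] [Finite I]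

/-- The case of a substitution fixing the origin: the diagonal blocks of the matrix given by `F`
and `W`, for the filtration by the length of words, are `L^{⊗ m} ⊗ W(0)`, where `L` is the linear
part of `F`. Apart from the block `m = 0`, these are the diagonal blocks of the matrix given by
`F` and `J ⊗ W`, if `J(0) = L`. -/
theorem cls_wordMatrix_of_fixed_zero (σ : S →+* S) {m m' c : ℕ} (F : κ → (WordAlg κ S)⟦X⟧)
    (W : Matrix I I (WordAlg κ S)⟦X⟧) (J : Matrix κ κ (WordAlg κ S)⟦X⟧)
    (hF : ∀ a, F a ∈ ((trivialFil S).words κ).series 0 c)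
    (hW : ∀ i j, W i j ∈ ((trivialFil S).words κ).series m c)
    (hJW : ∀ x y : κ × I, J x.1 y.1 * W x.2 y.2 ∈ ((trivialFil S).words κ).series m' c)
    (hF0 : ∀ a, coeffAt (algebraMap R S π) 1 (F a) = 0)
    (hJ : ∀ a b, coeffAt (algebraMap R S π) 1 (J a b) =
      coeffAt (algebraMap R S π) (FreeMonoid.of b) (F a)) :
    cls σ (wordMatrix π F W hF hW) =
      cls σ (NuclearMatrix.ofFinite π fun i j => coeffAt (algebraMap R S π) 1 (W i j)) +
        cls σ (wordMatrix π F (fun x y : κ × I => J x.1 y.1 * W x.2 y.2) hF hJW) := by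
  let M₁ := wordMatrix π F W hF hW
  let M₂ := wordMatrix π F (fun x y : κ × I => J x.1 y.1 * W x.2 y.2) hF hJW
  let ℓ₁ : M₁.idx → ℕ := fun x => x.1.length
  let ℓ₂ : M₂.idx → ℕ := fun x => x.1.length
  have e₁ := cls_graded σ M₁ ℓ₁ fun x y h => coeffAt_lift_mul_of_length_lt _ hF0 x.1 y.1 _ h
  have e₂ := cls_graded σ M₂ ℓ₂ fun x y h => coeffAt_lift_mul_of_length_lt _ hF0 x.1 y.1 _ h
  let s : Set (M₁.graded ℓ₁).idx := {x | 1 ≤ ℓ₁ x}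
  have e₃ := cls_split σ (M₁.graded ℓ₁) s fun x hx y hy => by
    refine if_neg fun h => hy ?_
    exact le_of_le_of_eq hx h
  -- the empty word gives the block `W(0)`
  have e₄ : cls σ (NuclearMatrix.ofFinite π fun i j => coeffAt (algebraMap R S π) 1 (W i j)) =
      cls σ ((M₁.graded ℓ₁).restrict sᶜ) := by
    refine cls_reindex σ
      (M₁ := NuclearMatrix.ofFinite π fun i j => coeffAt (algebraMap R S π) 1 (W i j))
      (M₂ := (M₁.graded ℓ₁).restrict sᶜ) (Equiv.ofBijective
      (fun i : I => ⟨((1 : FreeMonoid κ), i), fun h => absurd h (Nat.not_succ_le_zero 0)⟩)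
      ⟨?_, ?_⟩) ?_
    · intro i j h
      exact (Prod.ext_iff.mp (Subtype.ext_iff.mp h)).2
    · rintro ⟨⟨w, i⟩, hw⟩
      have : w = 1 := FreeMonoid.length_eq_zero.mp (Nat.lt_one_iff.mp (not_le.mp hw))
      subst this
      exact ⟨i, rfl⟩
    · intro i j
      change coeffAt (algebraMap R S π) 1 (W i j) =
        if (1 : FreeMonoid κ).length = (1 : FreeMonoid κ).length then
          coeffAt (algebraMap R S π) 1 (FreeMonoid.lift F 1 * W i j) else 0
      rw [if_pos rfl, map_one, one_mul]
  -- splitting off the first letter identifies `L^{⊗ (m + 1)} ⊗ W(0)` with `L^{⊗ m} ⊗ (L ⊗ W(0))`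
  have e₅ : cls σ (M₂.graded ℓ₂) = cls σ ((M₁.graded ℓ₁).restrict s) := by
    refine cls_reindex σ (M₁ := M₂.graded ℓ₂) (M₂ := (M₁.graded ℓ₁).restrict s)
      (Equiv.ofBijective (fun x : FreeMonoid κ × (κ × I) =>
        ⟨(FreeMonoid.of x.2.1 * x.1, x.2.2), ?_⟩) ⟨?_, ?_⟩) ?_
    · change 1 ≤ (FreeMonoid.of x.2.1 * x.1).length
      rw [FreeMonoid.length_mul, FreeMonoid.length_of]
      exact Nat.le_add_right _ _
    · rintro ⟨w, a, i⟩ ⟨v, b, j⟩ h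
      obtain ⟨h1, h1'⟩ := Prod.ext_iff.mp (Subtype.ext_iff.mp h)
      obtain ⟨h2, h3⟩ := words_mul_inj h1 rfl
      exact Prod.ext h3 (Prod.ext (FreeMonoid.of_injective h2) h1')
    · rintro ⟨⟨w, i⟩, hw⟩
      rcases words_cases w with rfl | ⟨a, w, rfl⟩
      · exact absurd hw (Nat.not_succ_le_zero 0)
      · exact ⟨(w, a, i), rfl⟩
    · rintro ⟨w, a, i⟩ ⟨v, b, j⟩
      change (if w.length = v.length then coeffAt (algebraMap R S π) v
        (FreeMonoid.lift F w * (J a b * W i j)) else 0) =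
        if (FreeMonoid.of a * w).length = (FreeMonoid.of b * v).length then
          coeffAt (algebraMap R S π) (FreeMonoid.of b * v)
            (FreeMonoid.lift F (FreeMonoid.of a * w) * W i j) else 0
      have hlen : ∀ (a : κ) (w : FreeMonoid κ), (FreeMonoid.of a * w).length = 1 + w.length :=
        fun a w => by rw [FreeMonoid.length_mul, FreeMonoid.length_of]
      simp only [hlen, add_right_inj]
      split_ifs with h
      · rw [coeffAt_lift_mul_of_length_eq _ hF0 _ _ _ h.symm,
          coeffAt_lift_mul_of_length_eq _ hF0 _ _ _ (by rw [hlen, hlen, h]),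
          coeffAt_lift_of_mul _ hF0 _ _ _ _ h.symm, coeffAt_one_mul, hJ]
        ring
      · rfl
  change cls σ M₁ = _ + cls σ M₂
  rw [e₁, e₃, e₂, e₅, ← e₄, add_comm]

/-- If `Y = F(σ(Y))`, then the class of the finite matrix `W(σ(Y))` is the difference of the
classes of the matrices given by `F` and `W` and by `F` and `J ⊗ W`, where `J` is a matrix whose
value at `σ(Y)` is the Jacobian matrix of `F`. -/
theorem cls_fixedPoint (σ : S →+* S) {m m' c : ℕ} (F : κ → (WordAlg κ S)⟦X⟧)
    (W : Matrix I I (WordAlg κ S)⟦X⟧) (J : Matrix κ κ (WordAlg κ S)⟦X⟧)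
    (hF : ∀ a, F a ∈ ((trivialFil S).words κ).series 0 c)
    (hW : ∀ i j, W i j ∈ ((trivialFil S).words κ).series m c)
    (hJW : ∀ x y : κ × I, J x.1 y.1 * W x.2 y.2 ∈ ((trivialFil S).words κ).series m' c)
    (Y : κ → S)
    (hY : ∀ a, coeffAt (algebraMap R S π) 1 (translateSeries (fun b => σ (Y b)) (F a)) = Y a)
    (hJ : ∀ a b, coeffAt (algebraMap R S π) 1 (translateSeries (fun b => σ (Y b)) (J a b)) =
      coeffAt (algebraMap R S π) (FreeMonoid.of b) (translateSeries (fun b => σ (Y b)) (F a))) :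
    cls σ (NuclearMatrix.ofFinite π fun i j =>
        coeffAt (algebraMap R S π) 1 (translateSeries (fun b => σ (Y b)) (W i j))) =
      cls σ (wordMatrix π F W hF hW) -
        cls σ (wordMatrix π F (fun x y : κ × I => J x.1 y.1 * W x.2 y.2) hF hJW) := by
  have h := cls_wordMatrix_of_fixed_zero π σ
    (fun a => translateSeries (fun b => σ (Y b)) (F a) - algebraMap S _ (Y a))
    (fun i j => translateSeries (fun b => σ (Y b)) (W i j))
    (fun a b => translateSeries (fun b => σ (Y b)) (J a b))
    (fun a => sub_algebraMap_mem_series _ (translateSeries_mem (hF a)))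
    (fun i j => translateSeries_mem (hW i j))
    (fun x y => by
      rw [← map_mul]
      exact translateSeries_mem (hJW x y))
    (fun a => by rw [coeffAt_sub, hY, coeffAt_one_algebraMap, sub_self])
    (fun a b => by
      rw [coeffAt_sub, hJ, coeffAt_algebraMap _ _ (FreeMonoid.of_ne_one b), sub_zero])
  rw [cls_wordMatrix_translate π σ F W hF hW Y,
    cls_wordMatrix_translate π σ F _ hF hJW Y, h, eq_sub_iff_add_eq]
  simp only [map_mul]

end FixedPoint

/-! ### Completeness of the ring of coefficients -/

section BaseRing

/-- A finite `ℤ_p`-algebra is precomplete for an element `π` with a power associated to `p`: Cauchy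
sequences are summed coordinatewise with respect to a finite set of generators. -/
theorem isPrecomplete_of_finite {p : ℕ} [Fact p.Prime] {R : Type*} [CommRing R] [Algebra ℤ_[p] R]
    [Module.Finite ℤ_[p] R] {π : R} (e : ℕ) (hp : Associated (p : R) (π ^ e)) (he : 0 < e) :
    IsPrecomplete (Ideal.span {π}) R := by
  have hpre : IsPrecomplete (Ideal.span {(p : ℤ_[p])}) ℤ_[p] := by
    rw [← PadicInt.maximalIdeal_eq_span_p]; infer_instance
  obtain ⟨d, b, hb⟩ := Module.Finite.exists_fin (R := ℤ_[p]) (M := R)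
  have hrep : ∀ x : R, ∃ y : Fin d → ℤ_[p], ∑ i, y i • b i = x := fun x =>
    (Submodule.mem_span_range_iff_exists_fun _).mp (hb ▸ Submodule.mem_top)
  refine ⟨fun f hf => ?_⟩
  simp only [SModEq.sub_mem, Ideal.span_singleton_pow, smul_eq_mul, Ideal.mul_top,
    Ideal.mem_span_singleton] at hf ⊢
  -- the differences along the subsequence of the multiples of `e` are divisible by powers of `p`
  have hstep : ∀ n, ∃ y : Fin d → ℤ_[p],
      f (e * (n + 1)) - f (e * n) = (p : R) ^ n * ∑ i, y i • b i := by
    intro n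
    have h1 : π ^ (e * n) ∣ f (e * n) - f (e * (n + 1)) :=
      hf (Nat.mul_le_mul_left e (Nat.le_succ n))
    have h2 : (p : R) ^ n ∣ f (e * (n + 1)) - f (e * n) := by
      rw [← neg_sub, dvd_neg]
      refine dvd_trans ?_ h1
      rw [pow_mul]
      exact pow_dvd_pow_of_dvd hp.dvd n
    obtain ⟨r, hr⟩ := h2
    obtain ⟨y, hy⟩ := hrep r
    exact ⟨y, by rw [hr, hy]⟩
  choose y hy using hstep
  have hlim := fun i => exists_series_limit (p : ℤ_[p]) fun n => y n i
  choose s hs using hlim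
  refine ⟨f 0 + ∑ i, s i • b i, fun n => ?_⟩
  have key : ∀ n, f (e * n) = f 0 + ∑ i, (∑ j ∈ Finset.range n, (p : ℤ_[p]) ^ j * y j i) • b i := by
    intro n
    induction n with
    | zero => simp
    | succ n ih =>
      rw [← sub_add_cancel (f (e * (n + 1))) (f (e * n)), hy, ih]
      have h1 : ∀ i, (∑ j ∈ Finset.range (n + 1), (p : ℤ_[p]) ^ j * y j i) • b i =
          (p : R) ^ n * y n i • b i + (∑ j ∈ Finset.range n, (p : ℤ_[p]) ^ j * y j i) • b i := by
        intro i
        rw [Finset.sum_range_succ, add_smul, mul_smul, Algebra.smul_def ((p : ℤ_[p]) ^ n), map_pow,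
          map_natCast, add_comm]
      rw [Finset.sum_congr rfl fun i _ => h1 i, Finset.sum_add_distrib, Finset.mul_sum]
      ring
  have h1 : π ^ n ∣ f n - f (e * n) := hf (Nat.le_mul_of_pos_left n he)
  have h2 : π ^ n ∣ f (e * n) - (f 0 + ∑ i, s i • b i) := by
    rw [key, add_sub_add_left_eq_sub, ← Finset.sum_sub_distrib]
    refine Finset.dvd_sum fun i _ => ?_
    rw [← sub_smul]
    obtain ⟨t, ht⟩ := hs i n
    rw [← neg_sub, ht, neg_smul, dvd_neg, mul_smul, Algebra.smul_def, map_pow, map_natCast]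
    refine Dvd.dvd.mul_right ?_ _
    refine dvd_trans ?_ (pow_dvd_pow_of_dvd hp.symm.dvd n)
    rw [← pow_mul]
    exact pow_dvd_pow _ (Nat.le_mul_of_pos_left n he)
  have := dvd_add h1 h2
  rwa [sub_add_sub_cancel] at this

/-- The ring of integers of a finite extension of `ℚ_p` is complete. -/
theorem isAdicComplete_span {p : ℕ} [Fact p.Prime]
    {R : Type*} [CommRing R] [IsDomain R] [IsDiscreteValuationRing R] [CharZero R]
    [Algebra ℤ_[p] R] [Module.Finite ℤ_[p] R] {π : R} (hπ : Irreducible π) :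
    IsAdicComplete (Ideal.span {π}) R := by
  have hmax := hπ.maximalIdeal_eq
  have hinj : Function.Injective (algebraMap ℤ_[p] R) := by
    rw [injective_iff_map_eq_zero]
    intro a ha
    by_contra h0
    have := PadicInt.unitCoeff_spec h0
    rw [this, map_mul, map_pow, map_natCast] at ha
    have h1 : IsUnit (algebraMap ℤ_[p] R (PadicInt.unitCoeff h0 : ℤ_[p])) :=
      (PadicInt.unitCoeff h0).isUnit.map _
    rcases mul_eq_zero.mp ha with h | h
    · rw [h] at h1; exact not_isUnit_zero h1
    · exact (Fact.out : p.Prime).ne_zero (Nat.cast_eq_zero.mp (eq_zero_of_pow_eq_zero h))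
  have hp0 : (p : R) ≠ 0 := Nat.cast_ne_zero.mpr (Fact.out : p.Prime).ne_zero
  obtain ⟨e, he⟩ := IsDiscreteValuationRing.associated_pow_irreducible hp0 hπ
  have he0 : 0 < e := by
    rcases Nat.eq_zero_or_pos e with rfl | h
    · exfalso
      have hu : IsUnit (algebraMap ℤ_[p] R (p : ℤ_[p])) := by
        rw [map_natCast]
        exact he.symm.isUnit (by rw [pow_zero]; exact isUnit_one)
      have hloc : IsLocalHom (algebraMap ℤ_[p] R) :=
        (algebraMap_isIntegral_iff.mpr (inferInstance : Algebra.IsIntegral ℤ_[p] R)).isLocalHom hinj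
      exact PadicInt.prime_p.not_isUnit (hloc.map_nonunit _ hu)
    · exact h
  have h1 := isPrecomplete_of_finite e he he0
  have h2 : IsHausdorff (Ideal.span {π}) R := by
    rw [← hmax]; infer_instance
  exact { }

end BaseRing

/-! ### Noncommutative power series over polynomial rings -/

section Derivation

open PowerSeries

variable {κ : Type} {k S : Type*} [CommRing k] [CommRing S]

open Classical in
/-- The sum of the words obtained from a word by deleting one letter `c`. -/
def deleteLetter (k : Type*) [CommRing k] (c : κ) : FreeMonoid κ → WordAlg κ k
  | [] => 0
  | a :: w => (if a = c then MonoidAlgebra.single (FreeMonoid.ofList w) 1 else 0) +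
      MonoidAlgebra.single (FreeMonoid.of a) 1 * deleteLetter k c w

theorem deleteLetter_one (c : κ) : deleteLetter k c 1 = 0 := rfl

open Classical in
theorem deleteLetter_of_mul (c a : κ) (w : FreeMonoid κ) :
    deleteLetter k c (FreeMonoid.of a * w) =
      (if a = c then MonoidAlgebra.single w 1 else 0) +
        MonoidAlgebra.single (FreeMonoid.of a) 1 * deleteLetter k c w := rfl

theorem deleteLetter_mem (D : RingFiltration k) (c : κ) (w : FreeMonoid κ) :
    deleteLetter k c w ∈ (D.words κ).fil w.length := by
  classical
  induction w using FreeMonoid.inductionOn' with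
  | one => exact zero_mem _
  | of_mul a w ih =>
    rw [deleteLetter_of_mul, FreeMonoid.length_mul]
    have e1 := RingFiltration.single_mem_words (D := D) (v := w) D.one_mem
    have e2 := RingFiltration.single_mem_words (D := D) (v := FreeMonoid.of a) D.one_mem
    rw [zero_add] at e1 e2
    refine add_mem ?_ (RingFiltration.mul_mem _ e2 ih)
    split_ifs
    · exact RingFiltration.mono _ (Nat.le_add_left _ _) e1
    · exact zero_mem _

theorem map_deleteLetter (f : k →+* S) (c : κ) (w : FreeMonoid κ) :
    MonoidAlgebra.mapRingHom _ f (deleteLetter k c w) = deleteLetter S c w := by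
  classical
  induction w using FreeMonoid.inductionOn' with
  | one => exact map_zero _
  | of_mul a w ih =>
    rw [deleteLetter_of_mul, deleteLetter_of_mul, map_add, map_mul, ih]
    split_ifs <;> simp

theorem coeff_one_single_of_mul (a : κ) (q : WordAlg κ S) :
    (MonoidAlgebra.single (FreeMonoid.of a) 1 * q).coeff 1 = 0 := by
  classical
  induction q using MonoidAlgebra.induction_linear with
  | zero => simp
  | add p q hp hq => rw [mul_add, MonoidAlgebra.coeff_add, Finsupp.add_apply, hp, hq, add_zero]
  | single w s =>
    rw [MonoidAlgebra.single_mul_single, MonoidAlgebra.coeff_single, Finsupp.single_apply, if_neg]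
    intro h
    have := congrArg FreeMonoid.length h
    simp at this

open Classical in
theorem coeff_of_single_of_mul (a c : κ) (q : WordAlg κ S) :
    (MonoidAlgebra.single (FreeMonoid.of a) 1 * q).coeff (FreeMonoid.of c) =
      if a = c then q.coeff 1 else 0 := by
  induction q using MonoidAlgebra.induction_linear with
  | zero => simp
  | add p q hp hq =>
    rw [mul_add, MonoidAlgebra.coeff_add, Finsupp.add_apply, hp, hq, MonoidAlgebra.coeff_add,
      Finsupp.add_apply]
    split_ifs <;> simp
  | single w s =>
    rw [MonoidAlgebra.single_mul_single, MonoidAlgebra.coeff_single, Finsupp.single_apply, one_mul,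
      MonoidAlgebra.coeff_single, Finsupp.single_apply, ← ite_and]
    refine if_congr ⟨fun h => ?_, fun h => ?_⟩ rfl rfl
    · obtain ⟨h1, h2⟩ := words_mul_inj (h.trans (mul_one _).symm) rfl
      exact ⟨FreeMonoid.of_injective h1, h2⟩
    · rw [h.1, h.2, mul_one]

theorem translate_deleteLetter (Y : κ → S) (c : κ) (w : FreeMonoid κ) :
    (translate Y (deleteLetter S c w)).coeff 1 =
      (translate Y (MonoidAlgebra.single w 1)).coeff (FreeMonoid.of c) := by
  classical
  induction w using FreeMonoid.inductionOn' with
  | one =>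
    rw [deleteLetter_one, map_zero, ← MonoidAlgebra.one_def, map_one (translate Y),
      MonoidAlgebra.one_def, MonoidAlgebra.coeff_single, Finsupp.single_apply, if_neg (Ne.symm (FreeMonoid.of_ne_one c))]
    rfl
  | of_mul a w ih =>
    have : MonoidAlgebra.single (FreeMonoid.of a * w) (1 : S) =
        MonoidAlgebra.single (FreeMonoid.of a) 1 * MonoidAlgebra.single w 1 := by simp
    rw [deleteLetter_of_mul, this, map_add, map_mul, map_mul, translate_of, add_mul, add_mul,
      ← Algebra.smul_def, ← Algebra.smul_def]
    simp only [MonoidAlgebra.coeff_add, Finsupp.add_apply, MonoidAlgebra.coeff_smul,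
      Finsupp.smul_apply, coeff_one_single_of_mul, coeff_of_single_of_mul, ih, zero_add]
    split_ifs <;> simp

/-- The partial derivative of a noncommutative polynomial with respect to the variable `x_c`: the
`k`-linear map deleting one occurrence of `x_c` in all possible ways. -/
def wordDeriv (c : κ) : WordAlg κ k →ₗ[k] WordAlg κ k :=
  (Finsupp.linearCombination k (deleteLetter k c)).comp
    (MonoidAlgebra.coeffLinearEquiv k).toLinearMap

theorem wordDeriv_single (c : κ) (w : FreeMonoid κ) (s : k) :
    wordDeriv c (MonoidAlgebra.single w s) = s • deleteLetter k c w := by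
  change Finsupp.linearCombination k (deleteLetter k c) (Finsupp.single w s) = _
  rw [Finsupp.linearCombination_single]

theorem wordDeriv_mem {D : RingFiltration k} {d : ℕ} (c : κ) {p : WordAlg κ k}
    (hp : p ∈ (D.words κ).fil d) : wordDeriv c p ∈ (D.words κ).fil d := by
  rw [← MonoidAlgebra.sum_coeff_single p, Finsupp.sum, map_sum]
  refine sum_mem fun v hv => ?_
  have hvd : v.length ≤ d := by
    by_contra h
    exact Finsupp.mem_support_iff.mp hv ((hp v).2 (not_le.mp h))
  have e := RingFiltration.mul_mem _ (RingFiltration.single_mem_words (v := (1 : FreeMonoid κ))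
    ((hp v).1 hvd)) (deleteLetter_mem D c v)
  rw [FreeMonoid.length_one, add_zero, Nat.sub_add_cancel hvd] at e
  rwa [wordDeriv_single, Algebra.smul_def, wordAlg_algebraMap]

theorem map_wordDeriv (f : k →+* S) (c : κ) (p : WordAlg κ k) :
    MonoidAlgebra.mapRingHom _ f (wordDeriv c p) =
      wordDeriv c (MonoidAlgebra.mapRingHom _ f p) := by
  induction p using MonoidAlgebra.induction_linear with
  | zero => simp
  | add p q hp hq => rw [map_add, map_add, hp, hq, map_add, map_add]
  | single w s =>
    rw [wordDeriv_single, Algebra.smul_def, map_mul, map_deleteLetter, wordAlg_algebraMap]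
    simp only [MonoidAlgebra.mapRingHom_single]
    rw [wordDeriv_single, Algebra.smul_def, wordAlg_algebraMap]

/-- The value at `Y` of a partial derivative is a coefficient of the linear part of `p(x + Y)`. -/
theorem coeff_one_translate_wordDeriv (Y : κ → S) (c : κ) (p : WordAlg κ S) :
    (translate Y (wordDeriv c p)).coeff 1 = (translate Y p).coeff (FreeMonoid.of c) := by
  induction p using MonoidAlgebra.induction_linear with
  | zero => simp
  | add p q hp hq =>
    rw [map_add, map_add, map_add, MonoidAlgebra.coeff_add, Finsupp.add_apply, hp, hq,
      MonoidAlgebra.coeff_add, Finsupp.add_apply]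
  | single w s =>
    rw [wordDeriv_single, map_smul, translate_single, MonoidAlgebra.coeff_smul, Finsupp.smul_apply,
      translate_deleteLetter, MonoidAlgebra.coeff_smul, Finsupp.smul_apply]

/-- Change of coefficients in noncommutative power series. -/
def baseChange (f : k →+* S) : (WordAlg κ k)⟦X⟧ →+* (WordAlg κ S)⟦X⟧ :=
  PowerSeries.map (MonoidAlgebra.mapRingHom _ f)

theorem baseChange_mem {D : RingFiltration k} (f : k →+* S) {m c : ℕ} {Z : (WordAlg κ k)⟦X⟧}
    (hZ : Z ∈ (D.words κ).series m c) :
    baseChange f Z ∈ ((trivialFil S).words κ).series m c := by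
  intro j v
  refine ⟨fun _ => AddSubgroup.mem_top _, fun h => ?_⟩
  rw [baseChange, coeff_map, MonoidAlgebra.coeff_mapRingHom, (hZ j v).2 h, map_zero]

theorem wordCoeff_baseChange (f : k →+* S) (v : FreeMonoid κ) (Z : (WordAlg κ k)⟦X⟧) :
    wordCoeff v (baseChange f Z) = PowerSeries.map f (wordCoeff v Z) := by
  ext j
  rw [coeff_wordCoeff, baseChange, coeff_map, coeff_map, MonoidAlgebra.coeff_mapRingHom,
    coeff_wordCoeff]

/-- The partial derivative of a noncommutative power series. -/
def derivSeries (c : κ) (Z : (WordAlg κ k)⟦X⟧) : (WordAlg κ k)⟦X⟧ :=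
  PowerSeries.mk fun j => wordDeriv c (coeff j Z)

theorem derivSeries_mem {D : RingFiltration k} {m d : ℕ} (c : κ) {Z : (WordAlg κ k)⟦X⟧}
    (hZ : Z ∈ (D.words κ).series m d) : derivSeries c Z ∈ (D.words κ).series m d := by
  intro j
  rw [derivSeries, coeff_mk]
  exact wordDeriv_mem c (hZ j)

/-- The value of the partial derivative `∂Z/∂x_c` at `Y` is the coefficient of `x_c` in
`Z(x + Y)`. -/
theorem coeffAt_one_derivSeries (ϖ : S) [IsAdicComplete (Ideal.span {ϖ}) S] (f : k →+* S)
    (Y : κ → S) (c : κ) (Z : (WordAlg κ k)⟦X⟧) :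
    coeffAt ϖ 1 (translateSeries Y (baseChange f (derivSeries c Z))) =
      coeffAt ϖ (FreeMonoid.of c) (translateSeries Y (baseChange f Z)) := by
  rw [coeffAt, coeffAt]
  congr 1
  ext j
  rw [coeff_wordCoeff, coeff_wordCoeff, translateSeries, coeff_map, coeff_map, baseChange,
    coeff_map, coeff_map, derivSeries, coeff_mk, map_wordDeriv]
  exact coeff_one_translate_wordDeriv _ _ _

end Derivation

/-! ### Overconvergence of the matrices indexed by words -/

section Shift

open PowerSeries

variable {S : Type*} [CommRing S]

/-- Removal of the first `N` coefficients of a power series. -/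
def shift (N : ℕ) (f : S⟦X⟧) : S⟦X⟧ := PowerSeries.mk fun j => coeff (j + N) f

theorem evalAt_eq_shift (ϖ : S) [IsAdicComplete (Ideal.span {ϖ}) S] (N : ℕ) (f : S⟦X⟧) :
    evalAt ϖ f = ∑ j ∈ Finset.range N, ϖ ^ j * coeff j f + ϖ ^ N * evalAt ϖ (shift N f) := by
  have h : ∀ g : S⟦X⟧, evalAt ϖ g = coeff 0 g + ϖ * evalAt ϖ (shift 1 g) := fun g => by
    conv_lhs => rw [eq_X_mul_shift_add_const g, map_add, map_mul, evalAt_X, evalAt_C]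
    rw [add_comm, coeff_zero_eq_constantCoeff_apply]
    rfl
  induction N with
  | zero =>
    have : shift 0 f = f := by ext j; simp [shift]
    simp [this]
  | succ N ih =>
    have : shift 1 (shift N f) = shift (N + 1) f := by
      ext j
      simp only [shift, coeff_mk]
      rw [add_right_comm, add_assoc]
    rw [ih, h, this, Finset.sum_range_succ, shift, coeff_mk, zero_add]
    ring

end Shift

section Growth

open PowerSeries

variable {R : Type u} [CommRing R]

/-- The filtration of the polynomial ring by the total degree. -/
def degreeFil (R : Type*) [CommRing R] (n : ℕ) : RingFiltration (MvPolynomial (Fin n) R) where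
  fil d :=
    { carrier := {p | p.totalDegree ≤ d}
      zero_mem' := by simp
      add_mem' := fun ha hb => (MvPolynomial.totalDegree_add _ _).trans (max_le ha hb)
      neg_mem' := fun {p} hp => by
        simpa using hp }
  mono := fun _ _ hab _ hp => le_trans hp hab
  one_mem := by
    change MvPolynomial.totalDegree 1 ≤ 0
    simp
  mul_mem := fun ha hb => (MvPolynomial.totalDegree_mul _ _).trans (add_le_add ha hb)

variable (π : R) [IsAdicComplete (Ideal.span {π}) R] {n : ℕ}

/-- The sum `∑_j π ^ j p_j` of a series of polynomials. -/
def polySum (f : (MvPolynomial (Fin n) R)⟦X⟧) : MvPowerSeries (Fin n) R :=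
  fun α => evalAt π (PowerSeries.mk fun j => (coeff j f).coeff α)

theorem polySum_eq_shift (N : ℕ) (f : (MvPolynomial (Fin n) R)⟦X⟧) :
    polySum π f = ((∑ j ∈ Finset.range N, π ^ j • coeff j f : MvPolynomial (Fin n) R) :
      MvPowerSeries (Fin n) R) + π ^ N • polySum π (shift N f) := by
  ext α
  rw [map_add, MvPolynomial.coeff_coe, MvPolynomial.coeff_sum, map_smul]
  refine (evalAt_eq_shift π N _).trans ?_
  congr 1
  · exact Finset.sum_congr rfl fun j _ => by rw [coeff_mk, MvPolynomial.coeff_smul, smul_eq_mul]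
  · rw [smul_eq_mul]
    refine congrArg (fun h => π ^ N * evalAt π h) (PowerSeries.ext fun j => ?_)
    simp only [shift, coeff_mk]

theorem polySum_mem_growth {m c : ℕ} {f : (MvPolynomial (Fin n) R)⟦X⟧}
    (hf : f ∈ (degreeFil R n).series m c) : polySum π f ∈ growth π n m c :=
  ⟨fun j => coeff j f, hf, fun N => ⟨_, polySum_eq_shift π N f⟩⟩

theorem shift_mem {D : RingFiltration (MvPolynomial (Fin n) R)} {m c : ℕ}
    {f : (MvPolynomial (Fin n) R)⟦X⟧} (hf : f ∈ D.series m c) (N : ℕ) :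
    shift N f ∈ D.series (m + c * N) c := by
  intro j
  rw [shift, coeff_mk]
  have := hf (j + N)
  rwa [mul_add, add_comm (c * j), ← add_assoc] at this

/-- Every element of `[m, c]` is the sum of a series. -/
theorem exists_polySum_eq {m c : ℕ} {z : MvPowerSeries (Fin n) R} (hz : z ∈ growth π n m c) :
    ∃ f ∈ (degreeFil R n).series m c, polySum π f = z := by
  obtain ⟨p, hp, h⟩ := hz
  refine ⟨PowerSeries.mk p, fun j => by rw [coeff_mk]; exact hp j, ?_⟩
  ext α
  refine (eq_evalAt π fun N => ?_).symm
  obtain ⟨w, hw⟩ := h N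
  refine ⟨MvPowerSeries.coeff α w, ?_⟩
  rw [hw, map_add, MvPolynomial.coeff_coe, MvPolynomial.coeff_sum, map_smul]
  simp

variable {r : ℕ} (g : Fin r → MvPolynomial (Fin n) R)

/-- The canonical map from the polynomial ring to the completion of `A`. -/
def polyMap (π : R) {n r : ℕ} (g : Fin r → MvPolynomial (Fin n) R) :
    MvPolynomial (Fin n) R →+* Compl π (DaggerAlg π g) :=
  (algebraMap (DaggerAlg π g) (Compl π (DaggerAlg π g))).comp
    ((DaggerAlg.mk π g : Dagger π n →+* DaggerAlg π g).comp
      { toFun := Dagger.ofPoly π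
        map_one' := Subtype.ext (by simp [Dagger.ofPoly])
        map_zero' := Subtype.ext (by simp [Dagger.ofPoly])
        map_add' := fun _ _ => Subtype.ext (by simp [Dagger.ofPoly])
        map_mul' := fun _ _ => Subtype.ext (by simp [Dagger.ofPoly]) })

variable [IsAdicComplete (Ideal.span {algebraMap R (Compl π (DaggerAlg π g)) π})
  (Compl π (DaggerAlg π g))]

/-- The image in the completion of `A` of the sum of a series of polynomials. -/
theorem algebraMap_polySum {m c : ℕ} (hm : 0 < m) (hc : 0 < c)
    {f : (MvPolynomial (Fin n) R)⟦X⟧} (hf : f ∈ (degreeFil R n).series m c) :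
    algebraMap (DaggerAlg π g) (Compl π (DaggerAlg π g)) (DaggerAlg.mk π g ⟨polySum π f,
        mem_dagger_of_mem_growth hm hc (polySum_mem_growth π hf)⟩) =
      evalAt (algebraMap R (Compl π (DaggerAlg π g)) π) (PowerSeries.map (polyMap π g) f) := by
  refine eq_evalAt _ fun N => ?_
  have e : (⟨polySum π f, mem_dagger_of_mem_growth hm hc (polySum_mem_growth π hf)⟩ : Dagger π n) =
      ∑ j ∈ Finset.range N, algebraMap R _ (π ^ j) * Dagger.ofPoly π (coeff j f) +
        algebraMap R _ (π ^ N) * ⟨polySum π (shift N f), mem_dagger_of_mem_growth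
          (Nat.add_pos_left hm _) hc (polySum_mem_growth π (shift_mem hf N))⟩ := by
    apply Subtype.ext
    simp only [← Algebra.smul_def]
    refine (polySum_eq_shift π N f).trans ?_
    push_cast
    congr 1
    refine (map_sum MvPolynomial.coeToMvPowerSeries.ringHom _ _).trans
      (Finset.sum_congr rfl fun j _ => ?_)
    exact MvPolynomial.coe_smul _ _
  rw [e, map_add, map_add, map_sum, map_sum]
  simp only [map_mul, AlgHom.commutes, coeff_map]
  simp only [← IsScalarTower.algebraMap_apply, map_pow]
  exact Dvd.intro _ (Eq.symm (add_sub_cancel_left _ _))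

theorem wordCoeff_mem {k : Type*} [CommRing k] {D : RingFiltration k} {κ : Type*} {m c : ℕ}
    {Z : (WordAlg κ k)⟦X⟧} (hZ : Z ∈ (D.words κ).series m c) (v : FreeMonoid κ) :
    wordCoeff v Z ∈ D.series m c := by
  intro j
  rw [coeff_wordCoeff]
  by_cases h : v.length ≤ m + c * j
  · exact D.mono (Nat.sub_le _ _) ((hZ j v).1 h)
  · rw [(hZ j v).2 (not_le.mp h)]
    exact zero_mem _

/-- Long words have coefficients which are highly divisible, with a quotient of the same growth. -/
theorem polySum_wordCoeff_eq_smul {κ : Type*} {m c N : ℕ}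
    {Z : (WordAlg κ (MvPolynomial (Fin n) R))⟦X⟧} (hZ : Z ∈ ((degreeFil R n).words κ).series m c)
    {v : FreeMonoid κ} (hv : m + c * N < v.length) :
    ∃ y : growth π n m c, polySum π (wordCoeff v Z) = π ^ N • (y : MvPowerSeries (Fin n) R) := by
  refine ⟨⟨polySum π (shift N (wordCoeff v Z)), polySum_mem_growth π fun j => ?_⟩, ?_⟩
  · rw [shift, coeff_mk, coeff_wordCoeff]
    by_cases h : v.length ≤ m + c * (j + N)
    · refine RingFiltration.mono _ ?_ ((hZ (j + N) v).1 h)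
      rw [mul_add]
      omega
    · rw [(hZ (j + N) v).2 (not_le.mp h)]
      exact zero_mem _
  · rw [polySum_eq_shift π N, Finset.sum_eq_zero, MvPolynomial.coe_zero, zero_add]
    intro j hj
    rw [coeff_wordCoeff, (hZ j v).2, smul_zero]
    have := (Finset.mem_range.mp hj).le
    exact lt_of_le_of_lt (by gcongr) hv

/-- The matrices indexed by words which are given by overconvergent series are overconvergent. -/
theorem isOverconvergent_wordMatrix {κ I : Type} [Finite κ] [Finite I] {m c : ℕ}
    (F : κ → (WordAlg κ (MvPolynomial (Fin n) R))⟦X⟧)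
    (W : Matrix I I (WordAlg κ (MvPolynomial (Fin n) R))⟦X⟧)
    (hF : ∀ a, F a ∈ ((degreeFil R n).words κ).series 0 c)
    (hW : ∀ i j, W i j ∈ ((degreeFil R n).words κ).series m c) :
    IsOverconvergentMatrix g (wordMatrix π (fun a => baseChange (polyMap π g) (F a))
      (fun i j => baseChange (polyMap π g) (W i j)) (fun a => baseChange_mem _ (hF a))
      (fun i j => baseChange_mem _ (hW i j))) := by
  have hZ : ∀ w i j, FreeMonoid.lift F w * W i j ∈
      ((degreeFil R n).words κ).series (m + 1) (c + 1) := fun w i j =>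
    RingFiltration.series_mono (Nat.le_succ m) (Nat.le_succ c)
      (RingFiltration.series_mul_of_zero (lift_mem_series hF w) (hW i j))
  refine ⟨m + 1, c + 1, Nat.succ_pos _, Nat.succ_pos _,
    fun (x y : FreeMonoid κ × I) => ⟨polySum π (wordCoeff y.1 (FreeMonoid.lift F x.1 * W x.2 y.2)),
      polySum_mem_growth π (wordCoeff_mem (hZ _ _ _) _)⟩, fun N => ?_, ?_⟩
  · refine ((finite_length_le (m + 1 + (c + 1) * N)).prod (Set.finite_univ (α := I))).subset ?_
    rintro ⟨v, j⟩ hv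
    refine ⟨?_, Set.mem_univ _⟩
    by_contra h
    refine hv ?_
    rintro ⟨w, i⟩
    obtain ⟨y, hy⟩ := polySum_wordCoeff_eq_smul π (hZ w i j) (not_le.mp h)
    exact ⟨y, Subtype.ext hy⟩
  · rintro ⟨w, i⟩ ⟨v, j⟩
    refine Eq.trans ?_ (algebraMap_polySum π g (Nat.succ_pos m)
      (Nat.succ_pos c) (wordCoeff_mem (hZ w i j) v)).symm
    rw [← wordCoeff_baseChange, map_mul]
    change coeffAt _ v (FreeMonoid.lift (fun a => baseChange (polyMap π g) (F a)) w *
      baseChange (polyMap π g) (W i j)) = coeffAt _ v _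
    congr 2
    exact (FreeMonoid.hom_map_lift (baseChange (polyMap π g)).toMonoidHom F w).symm

theorem isOverconvergent_empty (π : R) {n r : ℕ} (g : Fin r → MvPolynomial (Fin n) R) :
    IsOverconvergentMatrix g (NuclearMatrix.empty π (Compl π (DaggerAlg π g))) :=
  ⟨1, 1, one_pos, one_pos, fun (x : Empty) => x.elim, fun _ => Set.toFinite (α := Empty) _,
    fun (x : Empty) => x.elim⟩

end Growth

/-! ### The `LU` decomposition in noncommuting variables -/

section Eval

open PowerSeries

variable {κ : Type} {k S : Type*} [CommRing k] [CommRing S] (ϖ : S)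
  [IsAdicComplete (Ideal.span {ϖ}) S]

/-- Evaluation of noncommutative power series: the coefficients are mapped by `Θ`, the variables
are replaced by commuting elements `y`, and the variable of the power series is replaced by `ϖ`. -/
def evalHom (Θ : k →+* S) (y : κ → S) : (WordAlg κ k)⟦X⟧ →+* S where
  toFun Z := coeffAt ϖ 1 (translateSeries y (baseChange Θ Z))
  map_one' := by
    have := coeffAt_one_algebraMap ϖ (κ := κ) (1 : S)
    rwa [map_one, ← map_one (translateSeries y), ← map_one (baseChange Θ)] at this
  map_zero' := by
    have := coeffAt_one_algebraMap ϖ (κ := κ) (0 : S)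
    rwa [map_zero, ← map_zero (translateSeries y), ← map_zero (baseChange Θ)] at this
  map_add' Z Z' := by rw [map_add, map_add, coeffAt_add]
  map_mul' Z Z' := by rw [map_mul, map_mul, coeffAt_one_mul]

theorem evalHom_X (Θ : k →+* S) (y : κ → S) : evalHom ϖ Θ y X = ϖ := by
  change coeffAt ϖ 1 (PowerSeries.map _ (PowerSeries.map _ X)) = ϖ
  rw [PowerSeries.map_X, PowerSeries.map_X, coeffAt]
  have : wordCoeff (κ := κ) (S := S) 1 X = X := by
    ext j
    rw [coeff_wordCoeff, coeff_X, coeff_X]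
    split_ifs
    · rw [MonoidAlgebra.one_def, MonoidAlgebra.coeff_single, Finsupp.single_eq_same]
    · rfl
  rw [this, evalAt_X]

theorem evalHom_var (Θ : k →+* S) (y : κ → S) (a : κ) :
    evalHom ϖ Θ y (C (MonoidAlgebra.single (FreeMonoid.of a) 1)) = y a := by
  change coeffAt ϖ 1 (PowerSeries.map _ (PowerSeries.map _ (C _))) = y a
  rw [PowerSeries.map_C, PowerSeries.map_C, coeffAt]
  have : wordCoeff 1 (C (translate y (MonoidAlgebra.mapRingHom _ Θ
      (MonoidAlgebra.single (FreeMonoid.of a) 1)))) = C (y a) := by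
    ext j
    rw [coeff_wordCoeff, coeff_C, coeff_C]
    split_ifs
    · rw [MonoidAlgebra.mapRingHom_single, map_one Θ, translate_of, wordAlg_algebraMap,
        MonoidAlgebra.coeff_add, Finsupp.add_apply, MonoidAlgebra.coeff_single,
        MonoidAlgebra.coeff_single, Finsupp.single_eq_same,
        Finsupp.single_eq_of_ne (Ne.symm (FreeMonoid.of_ne_one a)), zero_add]
    · rfl
  exact (congrArg (evalAt ϖ) this).trans (evalAt_C ϖ _)

/-- The embedding of commutative power series as constants with respect to the noncommuting
variables. -/
def constSeries (κ : Type) (k : Type*) [CommRing k] : k⟦X⟧ →+* (WordAlg κ k)⟦X⟧ :=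
  PowerSeries.map (algebraMap k (WordAlg κ k))

theorem evalHom_const (Θ : k →+* S) (y : κ → S) (f : k⟦X⟧) :
    evalHom ϖ Θ y (constSeries κ k f) = evalAt ϖ (PowerSeries.map Θ f) := by
  change coeffAt ϖ 1 (PowerSeries.map _ (PowerSeries.map _ (PowerSeries.map _ f))) = _
  rw [coeffAt]
  congr 1
  ext j
  rw [coeff_wordCoeff, coeff_map, coeff_map, coeff_map, coeff_map, wordAlg_algebraMap,
    MonoidAlgebra.mapRingHom_single, ← wordAlg_algebraMap]
  refine (congrArg (fun p : WordAlg κ S => p.coeff 1) ((translate y).commutes _)).trans ?_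
  rw [wordAlg_algebraMap, MonoidAlgebra.coeff_single, Finsupp.single_eq_same]

theorem constSeries_mem {D : RingFiltration k} {m c : ℕ} {f : k⟦X⟧} (hf : f ∈ D.series m c) :
    constSeries κ k f ∈ (D.words κ).series m c := by
  intro j
  rw [constSeries, coeff_map, wordAlg_algebraMap]
  exact RingFiltration.single_mem_words (v := (1 : FreeMonoid κ)) (hf j)

end Eval

section LU

open PowerSeries

variable {k : Type*} [Ring k] {D : RingFiltration k} {ι : Type*}

theorem exists_eq_X_smul {N : Matrix ι ι k⟦X⟧} (h : ∀ i j, coeff 0 (N i j) = 0) :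
    ∃ N' : Matrix ι ι k⟦X⟧, N = (X : k⟦X⟧) • N' ∧ ∀ i j, N i j = 0 → N' i j = 0 := by
  refine ⟨fun i j => PowerSeries.mk fun d => coeff (d + 1) (N i j), ?_, fun i j hij => ?_⟩
  · ext i j d
    change _ = coeff d (X * PowerSeries.mk fun d => coeff (d + 1) (N i j))
    rcases d with _ | d
    · rw [coeff_zero_X_mul, h]
    · rw [coeff_succ_X_mul, coeff_mk]
  · ext d
    rw [coeff_mk, hij, map_zero, map_zero]

variable [Fintype ι] [DecidableEq ι]

/-- The equation of `exists_masked`, as a statement on the product `(1 - N) (1 + E)`. -/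
theorem one_sub_mul_one_add_apply {A : Type*} [Ring A] {N E : Matrix ι ι A} {i j : ι}
    (h : N i j = (E - N * E) i j) : ((1 - N) * (1 + E)) i j = (1 : Matrix ι ι A) i j := by
  have : (1 - N) * (1 + E) = 1 + ((E - N * E) - N) := by noncomm_ring
  rw [this, Matrix.add_apply, Matrix.sub_apply, ← h, sub_self, add_zero]

/-- The `LU` decomposition of the universal matrix `(1 + X Z) (1 - X x)⁻¹`: the inverse is
`1 - X N₁`, and the factor `1 - N` removes the entries in `s`. -/
theorem exists_universal_LU {m c : ℕ} (s : ι → ι → Prop) (hs : ∀ i, ¬ s i i)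
    (x Z : Matrix ι ι k⟦X⟧) (hx : ∀ i j, x i j ∈ D.series m c)
    (hZ : ∀ i j, Z i j ∈ D.series m c) :
    ∃ N N₁ : Matrix ι ι k⟦X⟧, (∀ i j, N i j ∈ D.series 0 (m + c)) ∧
      (∀ i j, coeff 0 (N i j) = 0) ∧ (∀ i j, ¬ s i j → N i j = 0) ∧
      (1 - (X : k⟦X⟧) • N₁) * (1 - (X : k⟦X⟧) • x) = 1 ∧
      (∀ i j, ((1 - N) * ((1 + (X : k⟦X⟧) • Z) * (1 - (X : k⟦X⟧) • N₁))) i j ∈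
        D.series 0 (m + c)) ∧
      ∀ i j, s i j → ((1 - N) * ((1 + (X : k⟦X⟧) • Z) * (1 - (X : k⟦X⟧) • N₁))) i j = 0 := by
  have hone : ∀ i j, (1 : Matrix ι ι k⟦X⟧) i j ∈ D.series 0 (m + c) := fun i j => by
    rw [Matrix.one_apply]
    split_ifs
    · exact RingFiltration.series_one
    · exact zero_mem _
  have hmul : ∀ A B : Matrix ι ι k⟦X⟧, (∀ i j, A i j ∈ D.series 0 (m + c)) →
      (∀ i j, B i j ∈ D.series 0 (m + c)) → ∀ i j, (A * B) i j ∈ D.series 0 (m + c) :=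
    fun A B hA hB i j => by
      rw [Matrix.mul_apply]
      exact sum_mem fun l _ => RingFiltration.series_mul_of_zero (hA i l) (hB l j)
  obtain ⟨N₁, hN₁, hN₁0, hN₁s⟩ := exists_masked D (fun _ _ : ι => True) (-((X : k⟦X⟧) • x))
    (fun i j => neg_mem (RingFiltration.series_X_mul (hx i j)))
    (fun i j => by simp)
  obtain ⟨N₁', rfl, -⟩ := exists_eq_X_smul hN₁0
  have h1 : (1 - (X : k⟦X⟧) • N₁') * (1 - (X : k⟦X⟧) • x) = 1 := by
    ext1 i j
    rw [sub_eq_add_neg 1 ((X : k⟦X⟧) • x)]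
    exact one_sub_mul_one_add_apply ((hN₁s i j).trans (if_pos trivial))
  have hZX : ∀ i j, ((X : k⟦X⟧) • Z) i j ∈ D.series 0 (m + c) := fun i j =>
    RingFiltration.series_X_mul (hZ i j)
  have hH : ∀ i j, ((1 + (X : k⟦X⟧) • Z) * (1 - (X : k⟦X⟧) • N₁')) i j ∈ D.series 0 (m + c) :=
    hmul _ _ (fun i j => add_mem (hone i j) (hZX i j)) (fun i j => sub_mem (hone i j) (hN₁ i j))
  set H := (1 + (X : k⟦X⟧) • Z) * (1 - (X : k⟦X⟧) • N₁') with hHdef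
  have hH0 : ∀ i j, coeff 0 ((H - 1) i j) = 0 := by
    intro i j
    have : H - 1 = (X : k⟦X⟧) • (Z * (1 - (X : k⟦X⟧) • N₁') - N₁') := by
      rw [hHdef, add_mul, one_mul, smul_sub, Matrix.smul_mul]
      abel
    rw [this]
    simp
  obtain ⟨N, hN, hN0, hNs⟩ := exists_masked D s (H - 1) (fun i j => sub_mem (hH i j) (hone i j)) hH0
  refine ⟨N, N₁', hN, hN0, fun i j h => (hNs i j).trans (if_neg h), h1,
    hmul _ _ (fun i j => sub_mem (hone i j) (hN i j)) hH, fun i j h => ?_⟩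
  have h2 := one_sub_mul_one_add_apply ((hNs i j).trans (if_pos h))
  rwa [add_sub_cancel, Matrix.one_apply_ne (by rintro rfl; exact hs i h)] at h2

end LU

/-! ### Block triangular matrices and the fixed point equation -/

section Uniqueness

variable {S : Type*} [CommRing S] {ι : Type*}

theorem eq_zero_of_pow_mul_eq_zero {ϖ : S} (hϖ : ∀ x : S, ϖ * x = 0 → x = 0) (n : ℕ) :
    ∀ x : S, ϖ ^ n * x = 0 → x = 0 := by
  induction n with
  | zero => intro x hx; simpa using hx
  | succ n ih => intro x hx; exact hϖ x (ih _ (by rw [← mul_assoc, ← pow_succ]; exact hx))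

/-- A matrix `N` is strictly block lower triangular: its entries on and above the diagonal blocks
vanish. -/
def StrictLower (N : Matrix ι ι S) (bl : ι → ℕ) : Prop := ∀ i j, bl i ≤ bl j → N i j = 0

/-- A matrix is block diagonal, for the partition of the index set into the fibres of `bl`. -/
def BlockDiag (N : Matrix ι ι S) (bl : ι → ℕ) : Prop := ∀ i j, bl i ≠ bl j → N i j = 0

variable {bl : ι → ℕ}

theorem BlockDiag.blockTriangular {N : Matrix ι ι S} (h : BlockDiag N bl) :
    N.BlockTriangular bl := fun i j hij => h i j (ne_of_gt hij)

theorem blockDiag_diagonal [DecidableEq ι] (d : ι → S) : BlockDiag (Matrix.diagonal d) bl :=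
  fun _ _ hij => Matrix.diagonal_apply_ne _ fun h => hij (h ▸ rfl)

variable [Fintype ι]

theorem StrictLower.mul_blockDiag {N A : Matrix ι ι S} (hN : StrictLower N bl)
    (hA : BlockDiag A bl) : StrictLower (N * A) bl := fun i j hij => by
  rw [Matrix.mul_apply]
  refine Finset.sum_eq_zero fun l _ => ?_
  by_cases h : bl l = bl j
  · rw [hN i l (h ▸ hij), zero_mul]
  · rw [hA l j h, mul_zero]

theorem StrictLower.blockDiag_mul {N A : Matrix ι ι S} (hN : StrictLower N bl)
    (hA : BlockDiag A bl) : StrictLower (A * N) bl := fun i j hij => by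
  rw [Matrix.mul_apply]
  refine Finset.sum_eq_zero fun l _ => ?_
  by_cases h : bl i = bl l
  · rw [hN l j (h ▸ hij), mul_zero]
  · rw [hA i l h, zero_mul]

theorem BlockDiag.mul {A B : Matrix ι ι S} (hA : BlockDiag A bl) (hB : BlockDiag B bl) :
    BlockDiag (A * B) bl := fun i j hij => by
  rw [Matrix.mul_apply]
  refine Finset.sum_eq_zero fun l _ => ?_
  by_cases h : bl i = bl l
  · rw [hB l j fun h' => hij (h.trans h'), mul_zero]
  · rw [hA i l h, zero_mul]

/-- A diagonal block of a product of block triangular matrices. -/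
theorem toSquareBlock_mul_of_blockTriangular {A B : Matrix ι ι S} (hA : A.BlockTriangular bl)
    (hB : B.BlockTriangular bl) (i₀ : ℕ) :
    (A * B).toSquareBlock bl i₀ = A.toSquareBlock bl i₀ * B.toSquareBlock bl i₀ := by
  ext x y
  rw [Matrix.toSquareBlock_def, Matrix.of_apply]
  rw [Matrix.mul_apply, Matrix.mul_apply]
  refine (Fintype.sum_of_injective (fun z : {i // bl i = i₀} => z.1) Subtype.val_injective _ _
    (fun l hl => ?_) fun l => rfl).symm
  have hne : bl l ≠ i₀ := fun h => hl ⟨⟨l, h⟩, rfl⟩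
  rcases lt_or_gt_of_ne hne with h | h
  · rw [hA (by rw [x.2]; exact h), zero_mul]
  · rw [hB (by rw [y.2]; exact h), mul_zero]

variable [DecidableEq ι] (ϖ : S) [IsAdicComplete (Ideal.span {ϖ}) S]

/-- If `X (1 + ϖ E)` and `1 + ϖ E` are block triangular, then so is `X`. The blocks of `1 + ϖ E` need
not be inverted. -/
theorem blockTriangular_of_mul {X E : Matrix ι ι S}
    (hE : (1 + ϖ • E).BlockTriangular bl)
    (h : (X * (1 + ϖ • E)).BlockTriangular bl) : X.BlockTriangular bl := by
  let L : Matrix ι ι S := fun i j => if bl j < bl i then X i j else 0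
  have hU : (X - L).BlockTriangular bl := fun i j hij => by
    rw [Matrix.sub_apply, sub_eq_zero]
    exact (if_pos hij).symm
  have hL : L = 0 := by
    refine eq_zero_of_masked ϖ (fun i j => bl j < bl i) L E (fun i j hij => if_neg hij) ?_
    intro i j hij
    have h1 := h hij
    have h2 := hU.mul hE hij
    rw [sub_mul, Matrix.sub_apply, h1, zero_sub, neg_eq_zero] at h2
    exact h2
  rwa [hL, sub_zero] at hU

theorem strictLower_eq_zero {N E : Matrix ι ι S} (hN : StrictLower N bl)
    (h : (N * (1 + ϖ • E)).BlockTriangular bl) : N = 0 :=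
  eq_zero_of_masked ϖ (fun i j => bl j < bl i) N E (fun i j hij => hN i j (not_lt.mp hij))
    fun _ _ hij => h hij

/-- The matrix `Y` given by the `LU` decomposition of a base change `1 + ϖ V` to a slope filtration
is the value at `σ(Y)` of the universal expression given by the `LU` decomposition of
`(1 + ϖ Z) (1 - ϖ σ(Y))⁻¹`. -/
theorem fixedPoint_unique (hϖ : ∀ x : S, ϖ * x = 0 → x = 0) (σ : S →+* S) (hσ : σ ϖ = ϖ)
    {Φ Ψ Z V P' Y Y' N N₁ : Matrix ι ι S} (hΦ : BlockDiag Φ bl)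
    (hΦΨ : Φ * Ψ = 1) (hΨΦ : Ψ * Φ = 1) (hP' : P'.BlockTriangular bl)
    (heq : Matrix.diagonal (fun i => ϖ ^ bl i) * Φ * (1 + ϖ • Z) * (1 + ϖ • V.map σ) =
      (1 + ϖ • V) * P')
    (hY : StrictLower Y bl) (hT : ((1 - ϖ • Y) * (1 + ϖ • V)).BlockTriangular bl)
    (hN₁ : (1 - ϖ • N₁) * (1 - ϖ • Y.map σ) = 1)
    (hH : ((1 - N) * ((1 + ϖ • Z) * (1 - ϖ • N₁))).BlockTriangular bl)
    (hY' : StrictLower Y' bl)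
    (hY'N : ϖ • Y' * Matrix.diagonal (fun i => ϖ ^ bl i) =
      Matrix.diagonal (fun i => ϖ ^ bl i) * Φ * N * Ψ) :
    Y' = Y ∧ Matrix.diagonal (fun i => ϖ ^ bl i) * Φ * ((1 - N) * ((1 + ϖ • Z) * (1 - ϖ • N₁))) *
      ((1 - ϖ • Y) * (1 + ϖ • V)).map σ = ((1 - ϖ • Y) * (1 + ϖ • V)) * P' := by
  set Λ : Matrix ι ι S := Matrix.diagonal fun i => ϖ ^ bl i
  set H := (1 + ϖ • Z) * (1 - ϖ • N₁) with hHdef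
  set T := (1 - ϖ • Y) * (1 + ϖ • V) with hTdef
  have hmapσ : ∀ A : Matrix ι ι S, (ϖ • A).map σ = ϖ • A.map σ := fun A => by
    ext i j
    simp [hσ]
  have hT1 : T = 1 + ϖ • (V - Y - ϖ • (Y * V)) := by
    rw [hTdef, sub_mul, one_mul, mul_add, mul_one, Matrix.smul_mul, Matrix.mul_smul]
    simp only [smul_sub]
    abel
  have hTσ : T.map σ = (1 - ϖ • Y.map σ) * (1 + ϖ • V.map σ) := by
    have : ∀ A : Matrix ι ι S, A.map σ = σ.mapMatrix A := fun _ => rfl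
    rw [this, hTdef, map_mul, map_sub, map_add, map_one, ← this, ← this, hmapσ, hmapσ]
  have hTσ1 : T.map σ = 1 + ϖ • (V - Y - ϖ • (Y * V)).map σ := by
    have : ∀ A : Matrix ι ι S, A.map σ = σ.mapMatrix A := fun _ => rfl
    rw [hT1, this, map_add, map_one, ← this, hmapσ]
  have hTσt : (T.map σ).BlockTriangular bl := fun i j hij => by
    rw [Matrix.map_apply, hT hij, map_zero]
  have key : (1 - ϖ • Y) * (Λ * Φ * H) * T.map σ = T * P' := by
    rw [hTσ, hHdef, hTdef, Matrix.mul_assoc (1 - ϖ • Y) (1 + ϖ • V), ← heq]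
    calc (1 - ϖ • Y) * (Λ * Φ * ((1 + ϖ • Z) * (1 - ϖ • N₁))) *
          ((1 - ϖ • Y.map σ) * (1 + ϖ • V.map σ))
        = (1 - ϖ • Y) * (Λ * Φ * (1 + ϖ • Z)) * ((1 - ϖ • N₁) *
          (1 - ϖ • Y.map σ)) * (1 + ϖ • V.map σ) := by simp only [Matrix.mul_assoc]
      _ = _ := by rw [hN₁, mul_one]; simp only [Matrix.mul_assoc]
  -- the factor `1 - ϖ Y` triangularizes `Λ Φ H`, because it is a product of triangular matrices
  have hX : ((1 - ϖ • Y) * (Λ * Φ * H)).BlockTriangular bl := by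
    refine blockTriangular_of_mul ϖ (E := (V - Y - ϖ • (Y * V)).map σ) ?_ ?_
    · rw [← hTσ1]; exact hTσt
    · rw [← hTσ1, key]; exact hT.mul hP'
  have hΛΦ : BlockDiag (Λ * Φ) bl := (blockDiag_diagonal _).mul hΦ
  -- the factor `1 - ϖ Y'` triangularizes `Λ Φ H` as well, by the choice of `N`
  have hX' : (1 - ϖ • Y') * (Λ * Φ * H) = Λ * Φ * ((1 - N) * H) := by
    have : ϖ • Y' * (Λ * Φ * H) = Λ * Φ * N * H := by
      calc ϖ • Y' * (Λ * Φ * H) = (ϖ • Y' * Λ) * (Φ * H) := by simp only [Matrix.mul_assoc]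
        _ = Λ * Φ * N * (Ψ * Φ) * H := by rw [hY'N]; simp only [Matrix.mul_assoc]
        _ = _ := by rw [hΨΦ, mul_one]
    rw [sub_mul, one_mul, this, sub_mul, one_mul, mul_sub]
    simp only [Matrix.mul_assoc]
  have hD : ϖ • (Y' - Y) * (Λ * Φ) = 0 := by
    have hH1 : H = 1 + ϖ • (Z - N₁ - ϖ • (Z * N₁)) := by
      rw [hHdef, add_mul, one_mul, mul_sub, mul_one, Matrix.smul_mul, Matrix.mul_smul]
      simp only [smul_sub, smul_smul]
      abel
    refine strictLower_eq_zero ϖ (E := Z - N₁ - ϖ • (Z * N₁)) (bl := bl) ?_ ?_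
    · refine StrictLower.mul_blockDiag (fun i j hij => ?_) hΛΦ
      rw [Matrix.smul_apply, Matrix.sub_apply, hY' i j hij, hY i j hij, sub_zero, smul_zero]
    · rw [← hH1]
      have : ϖ • (Y' - Y) * (Λ * Φ) * H = (1 - ϖ • Y) * (Λ * Φ * H) - Λ * Φ * ((1 - N) * H) := by
        rw [← hX', ← sub_mul, smul_sub, Matrix.mul_assoc]
        congr 1
        abel
      rw [this]
      exact hX.sub (hΛΦ.blockTriangular.mul hH)
  have hYY : Y' = Y := by
    have h1 : ϖ • (Y' - Y) * Λ = 0 := by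
      calc ϖ • (Y' - Y) * Λ = ϖ • (Y' - Y) * (Λ * Φ) * Ψ := by
            rw [Matrix.mul_assoc, Matrix.mul_assoc Λ, hΦΨ, mul_one]
        _ = 0 := by rw [hD, zero_mul]
    ext i j
    have h2 := congrFun (congrFun h1 i) j
    rw [Matrix.mul_diagonal, Matrix.smul_apply, smul_eq_mul, mul_assoc, Matrix.sub_apply,
      mul_comm (Y' i j - Y i j)] at h2
    exact sub_eq_zero.mp (eq_zero_of_pow_mul_eq_zero hϖ _ _ (hϖ _ h2))
  refine ⟨hYY, ?_⟩
  rw [← hX', hYY]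
  exact key

end Uniqueness

/-! ### Graded pieces as differences of matrices indexed by words -/

section Core

open PowerSeries

/-- The `LU` decomposition of a matrix which is congruent to `1` modulo `ϖ`. -/
theorem exists_masked_mul {S : Type*} [CommRing S] (ϖ : S) [IsAdicComplete (Ideal.span {ϖ}) S]
    {ι : Type*} [Fintype ι] [DecidableEq ι] (s : ι → ι → Prop) (V : Matrix ι ι S) :
    ∃ Y : Matrix ι ι S, (∀ i j, ¬ s i j → Y i j = 0) ∧
      ∀ i j, s i j → ((1 - ϖ • Y) * (1 + ϖ • V)) i j = (1 : Matrix ι ι S) i j := by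
  obtain ⟨N, -, hN0, hN⟩ := exists_masked (c := 1) (trivialFil S) s ((X : S⟦X⟧) • V.map C)
    (fun _ _ _ => AddSubgroup.mem_top _) (fun i j => by simp)
  obtain ⟨N', rfl, hN'⟩ := exists_eq_X_smul hN0
  have hX : ∀ A : Matrix ι ι S⟦X⟧, (evalAt ϖ).mapMatrix ((X : S⟦X⟧) • A) =
      ϖ • (evalAt ϖ).mapMatrix A := fun A => by
    ext i j
    simp [evalAt_X]
  have hC : (evalAt ϖ).mapMatrix (V.map C) = V := by
    ext i j
    simp [evalAt_C]
  refine ⟨(evalAt ϖ).mapMatrix N', fun i j h => ?_, fun i j h => one_sub_mul_one_add_apply ?_⟩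
  · rw [RingHom.mapMatrix_apply, Matrix.map_apply, hN' i j ((hN i j).trans (if_neg h)), map_zero]
  · have h1 := congrArg (evalAt ϖ) ((hN i j).trans (if_pos h))
    have h2 : ∀ A : Matrix ι ι S⟦X⟧, evalAt ϖ (A i j) = (evalAt ϖ).mapMatrix A i j := fun _ => rfl
    rw [h2, h2, map_sub, map_mul, hX, hX, hC] at h1
    exact h1

theorem exists_mul_eq_one {S : Type*} [CommRing S] (ϖ : S) [IsAdicComplete (Ideal.span {ϖ}) S]
    {ι : Type*} [Fintype ι] [DecidableEq ι] (V : Matrix ι ι S) :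
    ∃ Q : Matrix ι ι S, Q * (1 + ϖ • V) = 1 ∧ (1 + ϖ • V) * Q = 1 := by
  obtain ⟨Y, -, hY⟩ := exists_masked_mul ϖ (fun _ _ => True) V
  have : (1 - ϖ • Y) * (1 + ϖ • V) = 1 := by
    ext i j
    exact hY i j trivial
  exact ⟨_, this, mul_eq_one_comm.mp this⟩

theorem series_X_pow_mul {k : Type*} [Ring k] {D : RingFiltration k} {m c : ℕ} (a : ℕ) {f : k⟦X⟧}
    (hf : f ∈ D.series m c) : X ^ a * f ∈ D.series m c := by
  refine RingFiltration.series_mul_of_zero (fun j => ?_) hf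
  rw [coeff_X_pow]
  split_ifs
  · exact D.mono (Nat.zero_le _) D.one_mem
  · exact zero_mem _

variable {R : Type u} [CommRing R] {S : Type v} [CommRing S] [Algebra R S] (π : R)
  [IsAdicComplete (Ideal.span {algebraMap R S π}) S] {k : Type*} [CommRing k] {D : RingFiltration k}
  {ι : Type} [Fintype ι] [DecidableEq ι]

/-- If a block triangular matrix `1 + ϖ E` transforms `diag(ϖ ^ bl) Φ G` to `P'`, then the diagonal
blocks of `Φ G` and of `diag(ϖ ^ bl)⁻¹ P'` are `σ`-similar. -/
theorem cls_block_eq (σ : S →+* S)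
    (hϖ : ∀ x : S, algebraMap R S π * x = 0 → x = 0) {bl : ι → ℕ} (i₀ : ℕ)
    {Φ G E P' : Matrix ι ι S} {B : Matrix {i // bl i = i₀} {i // bl i = i₀} S}
    (hE : (1 + algebraMap R S π • E).BlockTriangular bl) (hG : G.BlockTriangular bl)
    (hΦ : BlockDiag Φ bl) (hP' : P'.BlockTriangular bl)
    (hB : ∀ x y : {i // bl i = i₀}, P' x y = algebraMap R S π ^ i₀ * B x y)
    (h : Matrix.diagonal (fun i => algebraMap R S π ^ bl i) * Φ * G *
      (1 + algebraMap R S π • E).map σ = (1 + algebraMap R S π • E) * P') :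
    cls σ (NuclearMatrix.ofFinite π B) =
      cls σ (NuclearMatrix.ofFinite π ((Φ * G).toSquareBlock bl i₀)) := by
  set ϖ := algebraMap R S π
  obtain ⟨Q, hQ1, hQ2⟩ := exists_mul_eq_one ϖ (E.toSquareBlock bl i₀)
  have hT2 : (1 + ϖ • E).toSquareBlock bl i₀ = 1 + ϖ • E.toSquareBlock bl i₀ := by
    ext x y
    simp [Matrix.toSquareBlock_def, Matrix.one_apply, Subtype.ext_iff]
  rw [← hT2] at hQ1 hQ2
  set T := 1 + ϖ • E
  have hσT : (T.map σ).BlockTriangular bl := fun i j hij => by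
    rw [Matrix.map_apply, hE hij, map_zero]
  have h1 : (T * P').toSquareBlock bl i₀ = ϖ ^ i₀ • (T.toSquareBlock bl i₀ * B) := by
    rw [toSquareBlock_mul_of_blockTriangular hE hP', ← Matrix.mul_smul]
    congr 1
    ext x y
    exact hB x y
  have h2 : (Matrix.diagonal (fun i => ϖ ^ bl i) * Φ * G * T.map σ).toSquareBlock bl i₀ =
      ϖ ^ i₀ • ((Φ * G).toSquareBlock bl i₀ * (T.toSquareBlock bl i₀).map σ) := by
    rw [Matrix.mul_assoc, Matrix.mul_assoc, ← Matrix.mul_assoc Φ]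
    ext x y
    have h1 := congrFun (congrFun (toSquareBlock_mul_of_blockTriangular
      (hΦ.blockTriangular.mul hG) hσT i₀) x) y
    rw [Matrix.toSquareBlock_def, Matrix.of_apply] at h1
    rw [Matrix.toSquareBlock_def, Matrix.of_apply, Matrix.diagonal_mul, x.2, h1]
    rfl
  rw [h, h1] at h2
  have h3 : T.toSquareBlock bl i₀ * B =
      (Φ * G).toSquareBlock bl i₀ * (T.toSquareBlock bl i₀).map σ := by
    rw [← sub_eq_zero]
    rw [← sub_eq_zero, ← smul_sub] at h2
    ext x y
    exact eq_zero_of_pow_mul_eq_zero hϖ i₀ _ (congrFun (congrFun h2 x) y)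
  refine (cls_ofFinite_eq σ _ Q hQ2 hQ1 ?_).symm
  rw [Matrix.mul_assoc, ← h3, ← Matrix.mul_assoc, hQ1, Matrix.one_mul]

/-- The class of a diagonal block of `P'` is a difference of classes of matrices indexed by words,
given by series over `k`, if the matrix `diag(ϖ ^ bl) Φ (1 + ϖ Z)`, where `Φ` and `Z` are given by
series over `k`, is transformed to `P'` by a matrix which is congruent to `1` modulo `ϖ`. -/
theorem exists_cls_eq_sub (Θ : k →+* S) (σ : S →+* S)
    (hϖ : ∀ x : S, algebraMap R S π * x = 0 → x = 0)
    (hσ : σ (algebraMap R S π) = algebraMap R S π) (bl : ι → ℕ) (i₀ : ℕ) {m c : ℕ}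
    {Φ' Ψ' Z' : Matrix ι ι k⟦X⟧} (hΦ' : ∀ i j, Φ' i j ∈ D.series m c)
    (hΨ' : ∀ i j, Ψ' i j ∈ D.series m c) (hZ' : ∀ i j, Z' i j ∈ D.series m c)
    {Φ Ψ Z V P' : Matrix ι ι S} {B : Matrix {i // bl i = i₀} {i // bl i = i₀} S}
    (hΦe : ∀ i j, evalAt (algebraMap R S π) (PowerSeries.map Θ (Φ' i j)) = Φ i j)
    (hΨe : ∀ i j, evalAt (algebraMap R S π) (PowerSeries.map Θ (Ψ' i j)) = Ψ i j)
    (hZe : ∀ i j, evalAt (algebraMap R S π) (PowerSeries.map Θ (Z' i j)) = Z i j)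
    (hΦ : BlockDiag Φ bl) (hΨ : BlockDiag Ψ bl) (hΦΨ : Φ * Ψ = 1) (hΨΦ : Ψ * Φ = 1)
    (hP' : P'.BlockTriangular bl)
    (hB : ∀ x y : {i // bl i = i₀}, P' x y = algebraMap R S π ^ i₀ * B x y)
    (heq : Matrix.diagonal (fun i => algebraMap R S π ^ bl i) * Φ * (1 + algebraMap R S π • Z) *
      (1 + algebraMap R S π • V.map σ) = (1 + algebraMap R S π • V) * P') :
    ∃ (m' c' : ℕ) (F : ι × ι → (WordAlg (ι × ι) k)⟦X⟧)
      (W : Matrix {i // bl i = i₀} {i // bl i = i₀} (WordAlg (ι × ι) k)⟦X⟧)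
      (W' : Matrix ((ι × ι) × {i // bl i = i₀}) ((ι × ι) × {i // bl i = i₀})
        (WordAlg (ι × ι) k)⟦X⟧)
      (hF : ∀ a, F a ∈ (D.words (ι × ι)).series 0 c')
      (hW : ∀ i j, W i j ∈ (D.words (ι × ι)).series m' c')
      (hW' : ∀ i j, W' i j ∈ (D.words (ι × ι)).series m' c'),
      cls σ (NuclearMatrix.ofFinite π B) =
        cls σ (wordMatrix π (fun a => baseChange Θ (F a)) (fun i j => baseChange Θ (W i j))
          (fun a => baseChange_mem _ (hF a)) (fun i j => baseChange_mem _ (hW i j))) -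
        cls σ (wordMatrix π (fun a => baseChange Θ (F a)) (fun i j => baseChange Θ (W' i j))
          (fun a => baseChange_mem _ (hF a)) (fun i j => baseChange_mem _ (hW' i j))) := by
  set ϖ := algebraMap R S π with hϖdef
  obtain ⟨Y, hY, hT⟩ := exists_masked_mul ϖ (fun i j => bl j < bl i) V
  have hY' : StrictLower Y bl := fun i j hij => hY i j (not_lt.mpr hij)
  have hT' : ((1 - ϖ • Y) * (1 + ϖ • V)).BlockTriangular bl := fun i j hij => by
    rw [hT i j hij, Matrix.one_apply_ne (by rintro rfl; exact lt_irrefl _ hij)]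
  -- the matrix of the variables
  let x : Matrix ι ι (WordAlg (ι × ι) k)⟦X⟧ := fun i j =>
    C (MonoidAlgebra.single (FreeMonoid.of (i, j)) 1)
  let Φ₁ := (constSeries (ι × ι) k).mapMatrix Φ'
  let Ψ₁ := (constSeries (ι × ι) k).mapMatrix Ψ'
  let Z₁ := (constSeries (ι × ι) k).mapMatrix Z'
  have hx : ∀ i j, x i j ∈ (D.words (ι × ι)).series (m + 1) c := fun i j => by
    refine RingFiltration.series_C (RingFiltration.mono _ ?_ (RingFiltration.single_mem_words
      (d := 0) (v := FreeMonoid.of (i, j)) D.one_mem))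
    rw [FreeMonoid.length_of]
    omega
  obtain ⟨N, N₁, hN, hN0, hNs, hN₁, hTm, hTs⟩ := exists_universal_LU (D := D.words (ι × ι))
    (m := m + 1) (c := c) (fun i j => bl j < bl i) (fun i => lt_irrefl _) x Z₁ hx
    fun i j => RingFiltration.series_mono (Nat.le_succ m) le_rfl (constSeries_mem (hZ' i j))
  set T := (1 - N) * ((1 + (X : (WordAlg (ι × ι) k)⟦X⟧) • Z₁) *
    (1 - (X : (WordAlg (ι × ι) k)⟦X⟧) • N₁)) with hTdef
  set c₁ := m + 1 + c
  have hΦ₁ : ∀ i j, Φ₁ i j ∈ (D.words (ι × ι)).series m c₁ := fun i j =>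
    RingFiltration.series_mono le_rfl (Nat.le_add_left _ _) (constSeries_mem (hΦ' i j))
  have hΨ₁ : ∀ i j, Ψ₁ i j ∈ (D.words (ι × ι)).series m c₁ := fun i j =>
    RingFiltration.series_mono le_rfl (Nat.le_add_left _ _) (constSeries_mem (hΨ' i j))
  have hΦNΨ : ∀ i j, (Φ₁ * N * Ψ₁) i j ∈ (D.words (ι × ι)).series (m + m) c₁ := fun i j => by
    rw [Matrix.mul_apply]
    refine sum_mem fun l _ => RingFiltration.series_mul ?_ (hΨ₁ l j)
    rw [Matrix.mul_apply]
    exact sum_mem fun l' _ => RingFiltration.series_mul (m' := 0) (hΦ₁ i l') (hN l' l)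
  have hΦNΨ0 : ∀ i j, coeff 0 ((Φ₁ * N * Ψ₁) i j) = 0 := fun i j => by
    simp only [coeff_zero_eq_constantCoeff] at hN0 ⊢
    simp only [Matrix.mul_apply, map_sum, map_mul, hN0, mul_zero, zero_mul,
      Finset.sum_const_zero]
  -- `ϖ F` is `Λ Φ N (Λ Φ)⁻¹` with `Λ = diag(ϖ ^ bl)`: below the diagonal blocks the conjugation by
  -- `Λ` multiplies by positive powers of `ϖ`, of which one is cancelled
  let F : ι × ι → (WordAlg (ι × ι) k)⟦X⟧ := fun a =>
    if bl a.2 < bl a.1 then X ^ (bl a.1 - bl a.2 - 1) * (Φ₁ * N * Ψ₁) a.1 a.2 else 0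
  have hF : ∀ a, F a ∈ (D.words (ι × ι)).series 0 (m + m + c₁) := fun a => by
    dsimp only [F]
    split_ifs
    · refine RingFiltration.series_of_coeff_zero (series_X_pow_mul _ (hΦNΨ _ _)) ?_
      have := hΦNΨ0 a.1 a.2
      rw [coeff_zero_eq_constantCoeff] at this ⊢
      rw [map_mul, this, mul_zero]
    · exact zero_mem _
  let W : Matrix {i // bl i = i₀} {i // bl i = i₀} (WordAlg (ι × ι) k)⟦X⟧ :=
    (Φ₁ * T).toSquareBlock bl i₀
  have hW : ∀ i j, W i j ∈ (D.words (ι × ι)).series m (m + m + c₁) := fun i j => by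
    refine RingFiltration.series_mono le_rfl (Nat.le_add_left c₁ (m + m)) ?_
    change (Φ₁ * T) i j ∈ _
    rw [Matrix.mul_apply]
    exact sum_mem fun l _ => RingFiltration.series_mul (m' := 0) (hΦ₁ i l) (hTm l j)
  let J : Matrix (ι × ι) (ι × ι) (WordAlg (ι × ι) k)⟦X⟧ := fun a b => derivSeries b (F a)
  have hJW : ∀ i j : (ι × ι) × {i // bl i = i₀}, J i.1 j.1 * W i.2 j.2 ∈
      (D.words (ι × ι)).series m (m + m + c₁) := fun i j =>
    RingFiltration.series_mul_of_zero (derivSeries_mem _ (hF _)) (hW _ _)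
  -- the evaluation at `σ(Y)`
  let η := evalHom ϖ Θ fun a : ι × ι => σ (Y a.1 a.2)
  have hηx : η.mapMatrix x = Y.map σ := by
    ext i j
    exact evalHom_var ϖ Θ _ (i, j)
  have hηX : ∀ A : Matrix ι ι (WordAlg (ι × ι) k)⟦X⟧,
      η.mapMatrix ((X : (WordAlg (ι × ι) k)⟦X⟧) • A) = ϖ • η.mapMatrix A := fun A => by
    ext i j
    simp [η, evalHom_X]
  have hηΦ : η.mapMatrix Φ₁ = Φ := by
    ext i j
    exact (evalHom_const ϖ Θ _ _).trans (hΦe i j)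
  have hηΨ : η.mapMatrix Ψ₁ = Ψ := by
    ext i j
    exact (evalHom_const ϖ Θ _ _).trans (hΨe i j)
  have hηZ : η.mapMatrix Z₁ = Z := by
    ext i j
    exact (evalHom_const ϖ Θ _ _).trans (hZe i j)
  have hηT : η.mapMatrix T =
      (1 - η.mapMatrix N) * ((1 + ϖ • Z) * (1 - ϖ • η.mapMatrix N₁)) := by
    rw [hTdef]
    simp only [map_mul, map_sub, map_add, map_one, hηX, hηZ]
  have hηT' : (η.mapMatrix T).BlockTriangular bl := fun i j hij => by
    rw [RingHom.mapMatrix_apply, Matrix.map_apply, hTs i j hij, map_zero]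
  have hηN : StrictLower (η.mapMatrix N) bl := fun i j hij => by
    rw [RingHom.mapMatrix_apply, Matrix.map_apply, hNs i j (not_lt.mpr hij), map_zero]
  have hηF : ∀ i j, η (F (i, j)) = if bl j < bl i then ϖ ^ (bl i - bl j - 1) *
      (Φ * η.mapMatrix N * Ψ) i j else 0 := fun i j => by
    dsimp only [F]
    split_ifs
    · rw [← hηΦ, ← hηΨ, ← map_mul, ← map_mul, map_mul, map_pow, evalHom_X]
      rfl
    · exact map_zero _
  obtain ⟨hYY, hfin⟩ := fixedPoint_unique ϖ hϖ σ hσ (N := η.mapMatrix N) (N₁ := η.mapMatrix N₁)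
    (Y' := fun i j => η (F (i, j))) hΦ hΦΨ hΨΦ hP' heq hY' hT' (by
      have := congrArg η.mapMatrix hN₁
      simpa only [map_mul, map_sub, map_one, hηX, hηx] using this) (hηT ▸ hηT')
      (fun i j hij => (hηF i j).trans (if_neg (not_lt.mpr hij))) (by
      ext i j
      rw [Matrix.mul_diagonal, Matrix.mul_assoc, Matrix.mul_assoc, Matrix.diagonal_mul,
        ← Matrix.mul_assoc]
      change ϖ * η (F (i, j)) * ϖ ^ bl j = _
      rw [hηF]
      split_ifs with h
      · have : ϖ ^ bl i = ϖ * ϖ ^ (bl i - bl j - 1) * ϖ ^ bl j := by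
          rw [← pow_succ', ← pow_add]
          congr 1
          omega
        rw [this]
        ring
      · rw [(hηN.blockDiag_mul hΦ).mul_blockDiag hΨ i j (not_lt.mp h)]
        simp)
  have hfix := cls_fixedPoint π σ (fun a => baseChange Θ (F a)) (fun i j => baseChange Θ (W i j))
    (fun i j => baseChange Θ (J i j)) (fun a => baseChange_mem _ (hF a))
    (fun i j => baseChange_mem _ (hW i j))
    (fun i j => by rw [← map_mul]; exact baseChange_mem _ (hJW i j)) (fun a => Y a.1 a.2)
    (fun a => congrFun (congrFun hYY a.1) a.2)
    (fun a b => coeffAt_one_derivSeries _ _ _ _ _)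
  refine ⟨m, m + m + c₁, F, W, fun i j => J i.1 j.1 * W i.2 j.2, hF, hW, hJW, ?_⟩
  simp only [map_mul]
  refine Eq.trans ?_ hfix
  change cls σ (NuclearMatrix.ofFinite π B) =
    cls σ (NuclearMatrix.ofFinite π ((η.mapMatrix (Φ₁ * T)).toSquareBlock bl i₀))
  have hT1 : (1 - ϖ • Y) * (1 + ϖ • V) = 1 + ϖ • (V - Y - ϖ • (Y * V)) := by
    rw [sub_mul, one_mul, mul_add, mul_one, Matrix.smul_mul, Matrix.mul_smul]
    simp only [smul_sub]
    abel
  rw [← hηT, hT1] at hfin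
  rw [hT1] at hT'
  rw [map_mul η.mapMatrix Φ₁ T, hηΦ]
  exact cls_block_eq π σ hϖ i₀ hT' hηT' hΦ hP' hB hfin

end Core

/-! ### Completions -/

section Completion

variable {R : Type u} [CommRing R] (π : R) {A : Type u} [CommRing A] [Algebra R A]

/-- The completion is complete, as the ideal which is completed at is finitely generated. -/
theorem isAdicComplete_compl :
    IsAdicComplete (Ideal.span {algebraMap R (Compl π A) π}) (Compl π A) := by
  have h := AdicCompletion.isAdicComplete (I := Ideal.span {algebraMap R A π}) (M := A)
    ⟨{algebraMap R A π}, by simp⟩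
  have h1 : (Ideal.span {algebraMap R A π}).map (algebraMap A (Compl π A)) =
      Ideal.span {algebraMap R (Compl π A) π} := by
    rw [Ideal.map_span, Set.image_singleton, ← IsScalarTower.algebraMap_apply]
  have h2 := (IsHausdorff.map_algebraMap_iff (I := Ideal.span {algebraMap R A π}) (M := Compl π A)
    (S := Compl π A)).mpr h.toIsHausdorff
  have h3 := (IsPrecomplete.map_algebraMap_iff (I := Ideal.span {algebraMap R A π}) (M := Compl π A)
    (S := Compl π A)).mpr h.toIsPrecomplete
  rw [h1] at h2 h3
  exact { }

theorem dvd_iff_evalₐ_eq_zero (K : ℕ) (x : Compl π A) :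
    algebraMap R (Compl π A) π ^ K ∣ x ↔
      AdicCompletion.evalₐ (Ideal.span {algebraMap R A π}) K x = 0 := by
  have h1 : x ∈ (Ideal.span {algebraMap R A π} ^ K • ⊤ : Submodule A (Compl π A)) ↔
      AdicCompletion.eval (Ideal.span {algebraMap R A π}) A K x = 0 := by
    rw [AdicCompletion.pow_smul_top_eq_ker_eval ⟨{algebraMap R A π}, by simp⟩, LinearMap.mem_ker]
  have h2 : AdicCompletion.evalₐ (Ideal.span {algebraMap R A π}) K x = 0 ↔
      AdicCompletion.eval (Ideal.span {algebraMap R A π}) A K x = 0 := by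
    have e : Ideal.span {algebraMap R A π} ^ K • ⊤ = Ideal.span {algebraMap R A π} ^ K := by
      rw [smul_eq_mul, Ideal.mul_top]
    refine ⟨fun h => ?_, fun h => ?_⟩
    · rw [← AdicCompletion.factor_evalₐ_eq_eval _ x e.ge, h, map_zero]
    · rw [← AdicCompletion.factor_eval_eq_evalₐ _ x e.le, h, map_zero]
  rw [h2, ← h1, Ideal.span_singleton_pow, Submodule.ideal_span_singleton_smul,
    Submodule.mem_smul_pointwise_iff_exists]
  refine ⟨?_, ?_⟩
  · rintro ⟨y, rfl⟩
    refine ⟨y, trivial, ?_⟩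
    rw [Algebra.smul_def, map_pow, ← IsScalarTower.algebraMap_apply]
  · rintro ⟨y, -, rfl⟩
    refine ⟨y, ?_⟩
    rw [Algebra.smul_def, map_pow, ← IsScalarTower.algebraMap_apply]

theorem exists_eq_add_pow_mul (K : ℕ) (x : Compl π A) :
    ∃ (a : A) (y : Compl π A),
      x = algebraMap A (Compl π A) a + algebraMap R (Compl π A) π ^ K * y := by
  obtain ⟨a, ha⟩ := Ideal.Quotient.mk_surjective
    (AdicCompletion.evalₐ (Ideal.span {algebraMap R A π}) K x)
  have : algebraMap R (Compl π A) π ^ K ∣ x - algebraMap A (Compl π A) a := by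
    rw [dvd_iff_evalₐ_eq_zero, map_sub, ← ha, sub_eq_zero]
    rfl
  obtain ⟨y, hy⟩ := this
  exact ⟨a, y, by rw [← hy, add_sub_cancel]⟩

theorem exists_eq_pow_mul_of_dvd (K : ℕ) {a : A}
    (h : algebraMap R (Compl π A) π ^ K ∣ algebraMap A (Compl π A) a) :
    ∃ b : A, a = algebraMap R A π ^ K * b := by
  rw [dvd_iff_evalₐ_eq_zero] at h
  have h1 : Ideal.Quotient.mk (Ideal.span {algebraMap R A π} ^ K) a = 0 := h
  rwa [Ideal.Quotient.eq_zero_iff_mem, Ideal.span_singleton_pow, Ideal.mem_span_singleton] at h1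

/-- Regularity of `π` passes to the completion, since `A / π ^ K A` is unchanged by it. -/
theorem regular_compl (hreg : ∀ a : A, algebraMap R A π * a = 0 → a = 0) (x : Compl π A)
    (hx : algebraMap R (Compl π A) π * x = 0) : x = 0 := by
  have := isAdicComplete_compl π (A := A)
  refine eq_zero_of_forall_pow_dvd (algebraMap R (Compl π A) π) fun K => ?_
  obtain ⟨a, y, rfl⟩ := exists_eq_add_pow_mul π K x
  have h1 : algebraMap R (Compl π A) π ^ (K + 1) ∣ algebraMap A (Compl π A)
      (algebraMap R A π * a) := by
    refine ⟨-y, ?_⟩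
    rw [map_mul, ← IsScalarTower.algebraMap_apply]
    linear_combination hx
  obtain ⟨b, hb⟩ := exists_eq_pow_mul_of_dvd π _ h1
  have h2 : a = algebraMap R A π ^ K * b := by
    rw [← sub_eq_zero]
    refine hreg _ ?_
    rw [mul_sub, hb]
    ring
  refine dvd_add ?_ (Dvd.intro _ rfl)
  rw [h2, map_mul, map_pow, ← IsScalarTower.algebraMap_apply]
  exact Dvd.intro _ rfl

theorem complEnd_algebraMap_base (σ : A →ₐ[R] A) :
    complEnd π σ (algebraMap R (Compl π A) π) = algebraMap R (Compl π A) π := by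
  rw [IsScalarTower.algebraMap_apply R A (Compl π A), complEnd_algebraMap, AlgHom.commutes]

/-- A matrix over `A` which becomes invertible over the completion is invertible, if `π` lies in the
Jacobson radical of `A`. -/
theorem exists_inverse_of_compl (hunit : ∀ a : A, IsUnit (1 + algebraMap R A π * a))
    {ι : Type*} [Fintype ι] [DecidableEq ι] (X : Matrix ι ι A) (Q : Matrix ι ι (Compl π A))
    (hQ : X.map (algebraMap A (Compl π A)) * Q = 1) :
    ∃ Y : Matrix ι ι A, X * Y = 1 ∧ Y * X = 1 := by
  have h1 : algebraMap A (Compl π A) X.det * Q.det = 1 := by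
    have := congrArg Matrix.det hQ
    rw [Matrix.det_mul, Matrix.det_one] at this
    rw [← this, RingHom.map_det]
    rfl
  obtain ⟨a, y, hy⟩ := exists_eq_add_pow_mul π 1 Q.det
  have h2 : algebraMap R (Compl π A) π ^ 1 ∣ algebraMap A (Compl π A) (X.det * a - 1) := by
    refine ⟨-(algebraMap A (Compl π A) X.det * y), ?_⟩
    rw [map_sub, map_mul, map_one, ← h1, hy]
    ring
  obtain ⟨b, hb⟩ := exists_eq_pow_mul_of_dvd π _ h2
  have h3 : IsUnit X.det := by
    refine isUnit_of_mul_isUnit_left (y := a) ?_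
    rw [← add_sub_cancel 1 (X.det * a), hb, pow_one]
    exact hunit b
  exact ⟨X⁻¹, Matrix.mul_nonsing_inv X h3, Matrix.nonsing_inv_mul X h3⟩

end Completion

section WeakCompleteness

variable {R : Type u} [CommRing R]

/-- The inverse of `1 + π z` has linear growth, by induction on the exponent of `π` from the equation
`y = 1 - π z y`. -/
theorem inverse_mem_growth {π : R} {n m c : ℕ} (hc : 0 < c) {z y : MvPowerSeries (Fin n) R}
    (hz : z ∈ growth π n m c) (h : (1 + π • z) * y = 1) : y ∈ growth π n 0 (m + c) := by
  classical
  rw [mem_growth_iff (by omega)]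
  intro α j
  induction j using Nat.strong_induction_on generalizing α with
  | _ j ih =>
    intro hα
    have hα0 : α ≠ 0 := by
      rintro rfl
      simp at hα
    have h1 : y = 1 - π • (z * y) := by
      rw [← h, add_mul, one_mul, smul_mul_assoc, add_sub_cancel_right]
    rw [h1, map_sub, map_smul, MvPowerSeries.coeff_one, if_neg hα0, zero_sub, dvd_neg, smul_eq_mul,
      pow_succ', MvPowerSeries.coeff_mul]
    refine mul_dvd_mul_left _ (Finset.dvd_sum fun x hx => ?_)
    have hdeg : x.1.degree + x.2.degree = α.degree := by
      rw [← map_add, Finset.HasAntidiagonal.mem_antidiagonal.mp hx]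
    have hex : ∃ k, x.1.degree ≤ m + c * k := ⟨x.1.degree, by nlinarith⟩
    obtain ⟨a, ha, hmin⟩ : ∃ a, x.1.degree ≤ m + c * a ∧ ∀ b < a, ¬ x.1.degree ≤ m + c * b :=
      ⟨Nat.find hex, Nat.find_spec hex, fun b hb => Nat.find_min hex hb⟩
    have h2 : π ^ a ∣ MvPowerSeries.coeff x.1 z := by
      rcases a with _ | a
      · simp
      · exact coeff_dvd_of_mem_growth hz x.1 a (not_le.mp (hmin a (Nat.lt_succ_self a)))
    by_cases haj : j ≤ a
    · exact Dvd.dvd.mul_right ((pow_dvd_pow π haj).trans h2) _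
    · obtain ⟨b, rfl⟩ : ∃ b, j = a + (b + 1) := ⟨j - a - 1, by omega⟩
      rw [pow_add]
      refine mul_dvd_mul h2 (ih b (by omega) x.2 ?_)
      have e1 : (m + c) * (a + (b + 1)) = m * a + c * a + (m + c) * b + m + c := by ring
      have e2 : 0 ≤ m * a := Nat.zero_le _
      omega

/-- The element `π` lies in the Jacobson radical of the weakly complete algebra `A`. -/
theorem isUnit_one_add [IsLocalRing R] {π : R} (hπ : ¬ IsUnit π) {n r : ℕ}
    (g : Fin r → MvPolynomial (Fin n) R) (a : DaggerAlg π g) :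
    IsUnit (1 + algebraMap R (DaggerAlg π g) π * a) := by
  obtain ⟨z, rfl⟩ : ∃ z : Dagger π n, DaggerAlg.mk π g z = a :=
    Ideal.Quotient.mkₐ_surjective R _ a
  obtain ⟨m, c, hm, hc, hz⟩ := z.2
  have h1 : IsUnit (1 + π • (z : MvPowerSeries (Fin n) R)) := by
    rw [MvPowerSeries.isUnit_iff_constantCoeff, map_add, map_one]
    refine (IsLocalRing.isUnit_or_isUnit_of_add_one (add_neg_cancel_right (1 : R)
      (MvPowerSeries.constantCoeff (π • (z : MvPowerSeries (Fin n) R))))).resolve_right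
        fun h => hπ ?_
    rw [MvPowerSeries.constantCoeff_smul, smul_eq_mul, IsUnit.neg_iff] at h
    exact isUnit_of_mul_isUnit_left h
  obtain ⟨y, hy⟩ := h1.exists_right_inv
  have hy' := mem_dagger_of_mem_growth (Nat.add_pos_left hm c) (Nat.add_pos_left hm c)
    (growth_mono (Nat.zero_le (m + c)) le_rfl (inverse_mem_growth hc hz hy))
  refine IsUnit.of_mul_eq_one (DaggerAlg.mk π g ⟨y, hy'⟩) ?_
  rw [← map_one (DaggerAlg.mk π g), ← AlgHom.commutes (DaggerAlg.mk π g), ← map_mul, ← map_add,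
    ← map_mul]
  congr 1
  apply Subtype.ext
  rw [← Algebra.smul_def]
  exact hy

end WeakCompleteness

/-! ### Bases adapted to a slope filtration -/

section Adapted

variable {S : Type u} [CommRing S] {ϖ : S} {σ : S →+* S} {M : Type v} [AddCommGroup M] [Module S M]
  {φ : M →ₛₗ[σ] M} (F : OrdinaryFiltration ϖ φ)

/-- The steps of the filtration have bases inducing bases of the graded pieces. -/
theorem exists_basis_fil (l : ℕ) :
    ∃ (ι : Type v) (bl : ι → ℕ) (b : Module.Basis ι S (F.fil l)), (∀ x, bl x < l) ∧
      (∀ x, (b x : M) ∈ F.fil (bl x + 1)) ∧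
      (∀ (l' : ℕ) (y : F.fil l), (y : M) ∈ F.fil l' → ∀ x, l' ≤ bl x → b.repr y x = 0) ∧
      ∀ l' < l, ∃ β : Module.Basis {x // bl x = l'} S (F.Gr l'),
        ∀ (y : F.fil l) (hy : (y : M) ∈ F.fil (l' + 1)) (x : {x // bl x = l'}),
          b.repr y x = β.repr (Submodule.mkQ _ ⟨(y : M), hy⟩) x := by
  induction l with
  | zero =>
    have : Subsingleton (F.fil 0) := by
      rw [F.fil_zero]; infer_instance
    exact ⟨PEmpty, fun x => x.elim, Module.Basis.empty _, fun x => x.elim, fun x => x.elim,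
      fun _ _ _ x => x.elim, fun l' h => absurd h (Nat.not_lt_zero _)⟩
  | succ l ih =>
    obtain ⟨ι, bl, b, hbl, hb, hrepr, hgr⟩ := ih
    have hle : F.fil l ≤ F.fil (l + 1) := F.mono (Nat.le_succ l)
    have := F.gr_free l
    let γ := Module.Free.chooseBasis S (F.Gr l)
    let bW : Module.Basis ι S ((F.fil l).submoduleOf (F.fil (l + 1))) :=
      b.map (Submodule.submoduleOfEquivOfLe hle).symm
    have hW : ∀ (y : F.fil (l + 1)) (hy : (y : M) ∈ F.fil l) (i : ι),
        (bW.sumQuot γ).repr y (Sum.inl i) = b.repr ⟨y, hy⟩ i := fun y hy i => by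
      rw [Module.Basis.sumQuot_repr_inl_of_mem bW γ y hy i]
      rfl
    let bl' : ι ⊕ Module.Free.ChooseBasisIndex S (F.Gr l) → ℕ := Sum.elim bl fun _ => l
    refine ⟨_, bl', bW.sumQuot γ, ?_, ?_, ?_, ?_⟩
    · rintro (i | j)
      · exact (hbl i).trans (Nat.lt_succ_self l)
      · exact Nat.lt_succ_self l
    · rintro (i | j)
      · rw [Module.Basis.sumQuot_inl]
        exact hb i
      · exact (bW.sumQuot γ (Sum.inr j)).2
    · rintro l' y hy (i | j) hl'
      · have hyl : (y : M) ∈ F.fil l := F.mono (hl'.trans (hbl i).le) hy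
        rw [hW y hyl]
        exact hrepr l' ⟨y, hyl⟩ hy i hl'
      · exact Module.Basis.sumQuot_repr_inr_of_mem bW γ y (F.mono hl' hy) j
    · intro l' hl'
      rcases Nat.lt_succ_iff_lt_or_eq.mp hl' with h | rfl
      · obtain ⟨β, hβ⟩ := hgr l' h
        let e : {x // bl x = l'} ≃ {x // bl' x = l'} := Equiv.ofBijective
          (fun x => ⟨Sum.inl x.1, x.2⟩) ⟨fun x y hxy =>
            Subtype.ext (Sum.inl_injective (Subtype.ext_iff.mp hxy)), by
            rintro ⟨i | j, hx⟩
            · exact ⟨⟨i, hx⟩, rfl⟩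
            · exact absurd hx (ne_of_gt h)⟩
        refine ⟨β.reindex e, fun y hy x => ?_⟩
        obtain ⟨x, rfl⟩ := e.surjective x
        have hyl : (y : M) ∈ F.fil l := F.mono h hy
        rw [Module.Basis.repr_reindex_apply, e.symm_apply_apply]
        exact (hW y hyl x.1).trans (hβ ⟨y, hyl⟩ hy x)
      · let e : Module.Free.ChooseBasisIndex S (F.Gr l') ≃ {x // bl' x = l'} := Equiv.ofBijective
          (fun x => ⟨Sum.inr x, rfl⟩) ⟨fun x y hxy =>
            Sum.inr_injective (Subtype.ext_iff.mp hxy), by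
            rintro ⟨i | j, hx⟩
            · exact absurd hx (ne_of_lt (hbl i))
            · exact ⟨j, rfl⟩⟩
        refine ⟨γ.reindex e, fun y hy x => ?_⟩
        obtain ⟨x, rfl⟩ := e.surjective x
        rw [Module.Basis.repr_reindex_apply, e.symm_apply_apply]
        exact Module.Basis.sumQuot_repr_inr bW γ y x

/-- In a suitable basis the matrix of an ordinary `σ`-module is block triangular, with diagonal
blocks the matrices of the graded pieces multiplied by powers of `ϖ`. -/
theorem exists_adapted_basis [Nontrivial S] [Module.Finite S M] (i : ℕ) :
    ∃ (d J : ℕ) (bl : Fin d → ℕ) (b : Module.Basis (Fin d) S M), i < J ∧ (∀ x, bl x < J) ∧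
      (sigmaMatrix b φ).BlockTriangular bl ∧
      ∀ l < J, ∃ β : Module.Basis {x // bl x = l} S (F.Gr l), ∀ x y : {x // bl x = l},
        sigmaMatrix b φ x y = ϖ ^ l * sigmaMatrix β (F.grEnd l) x y := by
  classical
  obtain ⟨J, hiJ, hJ⟩ : ∃ J, i < J ∧ F.fil J = ⊤ := by
    obtain ⟨s, hs⟩ := Module.Finite.fg_top (R := S) (M := M)
    have : ∃ N, ∀ x ∈ s, x ∈ F.fil N := by
      have h1 : ∀ x : M, ∃ N, x ∈ F.fil N := fun x => by
        have : x ∈ ⨆ i, F.fil i := F.iSup_fil ▸ Submodule.mem_top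
        exact (Submodule.mem_iSup_of_directed _ F.mono.directed_le).mp this
      choose N hN using h1
      exact ⟨s.sup N, fun x hx => F.mono (Finset.le_sup hx) (hN x)⟩
    obtain ⟨N, hN⟩ := this
    refine ⟨max N (i + 1), by omega, top_le_iff.mp ?_⟩
    rw [← hs, Submodule.span_le]
    exact fun x hx => F.mono (le_max_left _ _) (hN x hx)
  obtain ⟨ι, bl, b, hbl, hb, hrepr, hgr⟩ := exists_basis_fil F J
  let f : F.fil J ≃ₗ[S] M := (LinearEquiv.ofEq _ _ hJ).trans Submodule.topEquiv
  let b' := b.map f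
  have : Finite ι := Module.Finite.finite_basis b'
  obtain ⟨d, ⟨e⟩⟩ := Finite.exists_equiv_fin ι
  have hmem : ∀ x, b' x ∈ F.fil (bl x + 1) := hb
  have hmat : ∀ x y, sigmaMatrix (b'.reindex e) φ x y =
      b.repr (f.symm (φ (b' (e.symm y)))) (e.symm x) := fun x y => by
    rw [sigmaMatrix, Module.Basis.repr_reindex_apply, Module.Basis.reindex_apply]
    rfl
  have hf : ∀ y : M, ((f.symm y : F.fil J) : M) = y := fun y => rfl
  refine ⟨d, J, fun x => bl (e.symm x), b'.reindex e, hiJ, fun x => hbl _, fun x y hxy => ?_,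
    fun l hl => ?_⟩
  · rw [hmat]
    exact hrepr (bl (e.symm y) + 1) _ (F.stable _ _ (hmem _)) _ hxy
  · obtain ⟨β, hβ⟩ := hgr l hl
    let e' : {x // bl x = l} ≃ {x : Fin d // bl (e.symm x) = l} :=
      e.subtypeEquiv fun x => by rw [e.symm_apply_apply]
    have he' : ∀ x, ((e'.symm x : {x // bl x = l}) : ι) = e.symm x := fun x => rfl
    have hmem' : ∀ x : {x // bl x = l}, b' x ∈ F.fil (l + 1) := fun x => by
      have := hmem x
      rwa [x.2] at this
    have hβ' : ∀ x : {x // bl x = l}, β x = Submodule.mkQ _ ⟨b' x, hmem' x⟩ := fun x => by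
      apply β.repr.injective
      ext z
      have h1 := hβ (b x) (hmem' x) z
      refine Eq.trans ?_ h1
      rw [Module.Basis.repr_self, Module.Basis.repr_self, Finsupp.single_apply,
        Finsupp.single_apply]
      exact if_congr Subtype.ext_iff rfl rfl
    refine ⟨β.reindex e', fun x y => ?_⟩
    have hy := hmem' (e'.symm y)
    rw [hmat, ← he', ← he', hβ (f.symm (φ (b' (e'.symm y)))) (F.stable _ _ hy) (e'.symm x)]
    have h2 := F.map_mk l ⟨b' (e'.symm y), hy⟩
    rw [← hβ'] at h2
    refine (congrArg (fun z => β.repr z (e'.symm x)) h2).trans ?_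
    rw [map_smul, sigmaMatrix, Module.Basis.repr_reindex_apply, Module.Basis.reindex_apply]
    rfl

/-- The matrix of a unit root `σ`-module is invertible. -/
theorem exists_sigmaMatrix_mul_eq_one {U : Type*} [AddCommGroup U] [Module S U] {ψ : U →ₛₗ[σ] U}
    (h : IsUnitRoot ψ) {κ : Type*} [Fintype κ] [DecidableEq κ] (β : Module.Basis κ S U) :
    ∃ X : Matrix κ κ S, sigmaMatrix β ψ * X = 1 := by
  have h1 : ∀ t : Twist σ ⊗[S] U, ∃ x : κ → S, linearization ψ t = ∑ j, x j • ψ (β j) := by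
    intro t
    induction t using TensorProduct.induction_on with
    | zero => exact ⟨0, by simp⟩
    | add t t' ht ht' =>
      obtain ⟨x, hx⟩ := ht
      obtain ⟨x', hx'⟩ := ht'
      refine ⟨x + x', ?_⟩
      rw [map_add, hx, hx', ← Finset.sum_add_distrib]
      exact Finset.sum_congr rfl fun j _ => (add_smul _ _ _).symm
    | tmul a u =>
      refine ⟨fun j => (show S from a) * σ (β.repr u j), ?_⟩
      change (show S from a) • ψ u = _
      conv_lhs => rw [← β.sum_repr u]
      rw [map_sum, Finset.smul_sum]
      exact Finset.sum_congr rfl fun j _ => by rw [ψ.map_smulₛₗ, smul_smul]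
  have h2 : ∀ i, ∃ x : κ → S, β i = ∑ j, x j • ψ (β j) := fun i => by
    obtain ⟨t, ht⟩ := h.2 (β i)
    obtain ⟨x, hx⟩ := h1 t
    exact ⟨x, by rw [← ht, hx]⟩
  choose x hx using h2
  refine ⟨Matrix.of fun j i => x i j, ?_⟩
  ext l i
  have := congrArg (fun u => β.repr u l) (hx i)
  simp only [map_sum, map_smul, Finsupp.finsetSum_apply, Finsupp.smul_apply, smul_eq_mul,
    Module.Basis.repr_self, Finsupp.single_apply] at this
  rw [Matrix.mul_apply, Matrix.one_apply]
  refine Eq.trans ?_ (this.symm.trans (if_congr eq_comm rfl rfl))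
  exact Finset.sum_congr rfl fun j _ => mul_comm _ _

end Adapted

/-! ### Approximation of the change of basis -/

section Approximation

variable {R : Type u} [CommRing R] (π : R) {A : Type u} [CommRing A] [Algebra R A]
  {ι : Type*}

/-- The block diagonal part of a matrix. -/
def blockDiagPart {S : Type*} [Zero S] (bl : ι → ℕ) (M : Matrix ι ι S) : Matrix ι ι S :=
  Matrix.of fun i j => if bl i = bl j then M i j else 0

theorem blockDiag_blockDiagPart {S : Type*} [CommRing S] (bl : ι → ℕ) (M : Matrix ι ι S) :
    BlockDiag (blockDiagPart bl M) bl := fun _ _ hij => if_neg hij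

theorem exists_matrix_eq_add_pow_smul (K : ℕ) (X : Matrix ι ι (Compl π A)) :
    ∃ (X₀ : Matrix ι ι A) (V : Matrix ι ι (Compl π A)),
      X = X₀.map (algebraMap A (Compl π A)) + algebraMap R (Compl π A) π ^ K • V := by
  choose a y h using fun i j => exists_eq_add_pow_mul π K (X i j)
  exact ⟨Matrix.of a, Matrix.of y, Matrix.ext fun i j => h i j⟩

variable [Fintype ι] [DecidableEq ι]

/-- A right inverse of a block diagonal matrix may be taken to be block diagonal. -/
theorem BlockDiag.mul_blockDiagPart {S : Type*} [CommRing S] {bl : ι → ℕ} {Φ Ψ : Matrix ι ι S}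
    (hΦ : BlockDiag Φ bl) (h : Φ * Ψ = 1) : Φ * blockDiagPart bl Ψ = 1 := by
  refine Matrix.ext fun i j => ?_
  rw [← h, Matrix.mul_apply]
  by_cases hij : bl i = bl j
  · rw [Matrix.mul_apply]
    refine Finset.sum_congr rfl fun l _ => ?_
    by_cases hil : bl i = bl l
    · rw [blockDiagPart, Matrix.of_apply, if_pos (hil.symm.trans hij)]
    · rw [hΦ i l hil, zero_mul, zero_mul]
  · rw [h, Matrix.one_apply_ne (by rintro rfl; exact hij rfl)]
    refine Finset.sum_eq_zero fun l _ => ?_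
    by_cases hil : bl i = bl l
    · rw [blockDiagPart, Matrix.of_apply, if_neg fun h => hij (hil.trans h), mul_zero]
    · rw [hΦ i l hil, zero_mul]

/-- A `σ`-module over the completion which is defined over `A` has, after a change of the basis over
`A`, a matrix which is close to its matrix in any given basis. -/
theorem exists_approximation (hunit : ∀ a : A, IsUnit (1 + algebraMap R A π * a)) (σ : A →ₐ[R] A)
    (P₀ : Matrix ι ι A) {P' X Q : Matrix ι ι (Compl π A)} (hXQ : X * Q = 1)
    (h : P₀.map (algebraMap A (Compl π A)) * X.map (complEnd π σ) = X * P') (K : ℕ) :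
    ∃ (P₁ : Matrix ι ι A) (V : Matrix ι ι (Compl π A)), P₁.map (algebraMap A (Compl π A)) *
        (1 + algebraMap R (Compl π A) π ^ (K + 1) • V.map (complEnd π σ)) =
      (1 + algebraMap R (Compl π A) π ^ (K + 1) • V) * P' := by
  have := isAdicComplete_compl π (A := A)
  set ϖ := algebraMap R (Compl π A) π with hϖ
  let c := algebraMap A (Compl π A)
  let s := complEnd π σ
  -- `X₀` is an approximation of the change of basis `X`, and is invertible over `A`
  obtain ⟨X₀, V', hX⟩ := exists_matrix_eq_add_pow_smul π (K + 1) X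
  obtain ⟨Q', -, hQ'⟩ := exists_mul_eq_one ϖ (-(ϖ ^ K • (Q * V')))
  have hQX : Q * X = 1 := mul_eq_one_comm.mp hXQ
  have hX₀ : X₀.map c = X * (1 + ϖ • -(ϖ ^ K • (Q * V'))) := by
    rw [mul_add, mul_one, smul_neg, smul_smul, ← pow_succ', mul_neg, Matrix.mul_smul,
      ← Matrix.mul_assoc, hXQ, one_mul]
    nth_rw 1 [hX]
    abel
  obtain ⟨Y, hXY, hYX⟩ := exists_inverse_of_compl π hunit X₀ (Q' * Q) (by
    change X₀.map c * _ = 1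
    rw [hX₀, Matrix.mul_assoc, ← Matrix.mul_assoc _ Q' Q, hQ', one_mul, hXQ])
  have hYX' : Y.map c * X₀.map c = 1 := by
    have := congrArg c.mapMatrix hYX
    rwa [map_mul, map_one] at this
  have hXV : X = X₀.map c * (1 + ϖ ^ (K + 1) • (Y.map c * V')) := by
    have hXY' : X₀.map c * Y.map c = 1 := mul_eq_one_comm.mp hYX'
    rw [mul_add, mul_one, Matrix.mul_smul, ← Matrix.mul_assoc, hXY', one_mul]
    exact hX
  have hsϖ : s ϖ = ϖ := complEnd_algebraMap_base π σ
  have hXs : X.map s = (X₀.map σ).map c * (1 + ϖ ^ (K + 1) • (Y.map c * V').map s) := by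
    have h1 := congrArg s.mapMatrix hXV
    rw [map_mul, map_add, map_one] at h1
    have h2 : s.mapMatrix (X₀.map c) = (X₀.map σ).map c :=
      Matrix.ext fun i j => complEnd_algebraMap π σ _
    have h3 : s.mapMatrix (ϖ ^ (K + 1) • (Y.map c * V')) =
        ϖ ^ (K + 1) • (Y.map c * V').map s := by
      refine Matrix.ext fun i j => ?_
      change s (ϖ ^ (K + 1) * _) = ϖ ^ (K + 1) * s _
      rw [map_mul, map_pow, hsϖ]
    rw [h2, h3] at h1
    exact h1
  refine ⟨Y * P₀ * X₀.map σ, Y.map c * V', ?_⟩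
  have hmap : (Y * P₀ * X₀.map σ).map c = Y.map c * P₀.map c * (X₀.map σ).map c := by
    change c.mapMatrix _ = c.mapMatrix _ * c.mapMatrix _ * c.mapMatrix _
    rw [map_mul, map_mul]
  change (Y * P₀ * X₀.map σ).map c * (1 + ϖ ^ (K + 1) • (Y.map c * V').map s) = _
  rw [hmap, Matrix.mul_assoc, ← hXs, Matrix.mul_assoc]
  have h' : P₀.map c * X.map s = X * P' := h
  rw [h', ← Matrix.mul_assoc]
  nth_rw 1 [hXV]
  rw [← Matrix.mul_assoc (Y.map c), hYX', one_mul]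

end Approximation

/-! ### Rescaling of the basis -/

section Scaling

variable {R : Type u} [CommRing R] (π : R) {A : Type u} [CommRing A] [Algebra R A]
  {ι : Type*} [Fintype ι] [DecidableEq ι] {bl : ι → ℕ}

/-- The entries of a matrix which is close to a block triangular one, after a rescaling of the
basis which turns the entries above the diagonal blocks highly divisible. -/
theorem exists_scaled_entry {S : Type*} [CommRing S] (ϖ : S) {J a b : ℕ} (ha : a < J) {x p y : S}
    (hx : x = p + ϖ ^ ((J + 1) * J + 1) * y) (h1 : b < a → p = 0) {e : S}
    (h2 : a = b → p = ϖ ^ a * e) :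
    ∃ z, x * ϖ ^ (J * b) = ϖ ^ ((J + 1) * a) * ((if a = b then e else 0) + ϖ * z) := by
  rcases lt_trichotomy a b with h | rfl | h
  · rw [if_neg h.ne]
    obtain ⟨d, hd⟩ : ∃ d, J * b = (J + 1) * a + 1 + d := by
      refine ⟨J * b - ((J + 1) * a + 1), ?_⟩
      have : J * (a + 1) ≤ J * b := Nat.mul_le_mul_left J h
      have : J * (a + 1) = J * a + J := by ring
      have : (J + 1) * a = J * a + a := by ring
      omega
    refine ⟨x * ϖ ^ d, ?_⟩
    rw [hd, pow_add, pow_add]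
    ring
  · rw [if_pos rfl, hx, h2 rfl]
    obtain ⟨d, hd⟩ : ∃ d, (J + 1) * J + 1 = a + 1 + d := by
      refine ⟨(J + 1) * J + 1 - (a + 1), ?_⟩
      have : (J + 1) * J = J * J + J := by ring
      omega
    refine ⟨ϖ ^ d * y, ?_⟩
    have : (J + 1) * a = J * a + a := by ring
    rw [hd, this, pow_add, pow_add, pow_add]
    ring
  · rw [if_neg h.ne', hx, h1 h]
    obtain ⟨d, hd⟩ : ∃ d, (J + 1) * J + 1 = (J + 1) * a + 1 + d := by
      refine ⟨(J + 1) * J + 1 - ((J + 1) * a + 1), ?_⟩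
      have : (J + 1) * a ≤ (J + 1) * J := Nat.mul_le_mul_left _ ha.le
      omega
    refine ⟨ϖ ^ d * y * ϖ ^ (J * b), ?_⟩
    rw [hd, pow_add, pow_add]
    ring

/-- After a rescaling of the basis, the matrix of an ordinary and overconvergent `σ`-module is a
product of a diagonal matrix of powers of `π`, an invertible block diagonal matrix, and a matrix
congruent to `1` modulo `π`, all with entries in `A`. -/
theorem exists_scaling (hreg : ∀ a : A, algebraMap R A π * a = 0 → a = 0)
    (hunit : ∀ a : A, IsUnit (1 + algebraMap R A π * a)) (σ : A →ₐ[R] A) {J : ℕ}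
    (hJ : ∀ i, bl i < J) (P : Matrix ι ι A) {V P' B C : Matrix ι ι (Compl π A)}
    (hP' : P'.BlockTriangular bl) (hB : BlockDiag B bl) (hBC : B * C = 1)
    (hPB : ∀ i j, bl i = bl j → P' i j = algebraMap R (Compl π A) π ^ bl i * B i j)
    (h : P.map (algebraMap A (Compl π A)) *
        (1 + algebraMap R (Compl π A) π ^ ((J + 1) * J + 1) • V.map (complEnd π σ)) =
      (1 + algebraMap R (Compl π A) π ^ ((J + 1) * J + 1) • V) * P') :
    ∃ (Φ Ψ Z : Matrix ι ι A) (V' P'' : Matrix ι ι (Compl π A)), BlockDiag Φ bl ∧ BlockDiag Ψ bl ∧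
      Φ * Ψ = 1 ∧ Ψ * Φ = 1 ∧ P''.BlockTriangular bl ∧
      (∀ i j, bl i = bl j → P'' i j = algebraMap R (Compl π A) π ^ bl i * B i j) ∧
      Matrix.diagonal (fun i => algebraMap R (Compl π A) π ^ bl i) *
          Φ.map (algebraMap A (Compl π A)) *
          (1 + algebraMap R (Compl π A) π • Z.map (algebraMap A (Compl π A))) *
          (1 + algebraMap R (Compl π A) π • V'.map (complEnd π σ)) =
        (1 + algebraMap R (Compl π A) π • V') * P'' := by
  have := isAdicComplete_compl π (A := A)
  have hregS := regular_compl π hreg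
  set ϖ := algebraMap R (Compl π A) π with hϖ
  let c := algebraMap A (Compl π A)
  let s := complEnd π σ
  have hsϖ : s ϖ = ϖ := complEnd_algebraMap_base π σ
  have hcπ : c (algebraMap R A π) = ϖ := (IsScalarTower.algebraMap_apply R A (Compl π A) π).symm
  have hP : P.map c = P' + ϖ ^ ((J + 1) * J + 1) • (V * P' - P.map c * V.map s) := by
    have h' : P.map c * (1 + ϖ ^ ((J + 1) * J + 1) • V.map s) =
      (1 + ϖ ^ ((J + 1) * J + 1) • V) * P' := h
    rw [Matrix.mul_add, Matrix.mul_one, Matrix.add_mul, Matrix.one_mul, Matrix.smul_mul,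
      Matrix.mul_smul] at h'
    rw [smul_sub, ← add_sub_assoc, ← h', add_sub_cancel_right]
  -- the entries of the rescaled matrix
  have hentry : ∀ i j, ∃ z, c (P i j) * ϖ ^ (J * bl j) =
      ϖ ^ ((J + 1) * bl i) * ((if bl i = bl j then B i j else 0) + ϖ * z) := fun i j =>
    exists_scaled_entry ϖ (hJ i) (congrFun (congrFun hP i) j) (fun hij => hP' hij) (hPB i j)
  choose z hz using hentry
  -- an element of `A` which is divisible by a power of `π` in the completion is so in `A`
  have hG : ∀ i j, ∃ g : A, c g = (if bl i = bl j then B i j else 0) + ϖ * z i j := fun i j => by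
    obtain ⟨g, hg⟩ := exists_eq_pow_mul_of_dvd π ((J + 1) * bl i)
      (a := P i j * algebraMap R A π ^ (J * bl j)) (by
        refine ⟨(if bl i = bl j then B i j else 0) + ϖ * z i j, ?_⟩
        rw [map_mul, map_pow, ← IsScalarTower.algebraMap_apply]
        exact hz i j)
    refine ⟨g, ?_⟩
    rw [← sub_eq_zero]
    refine eq_zero_of_pow_mul_eq_zero hregS ((J + 1) * bl i) _ ?_
    have h1 := congrArg c hg
    rw [map_mul, map_mul, map_pow, map_pow, hcπ, hz] at h1
    rw [mul_sub, ← h1, sub_self]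
  choose G hG using hG
  have hG' : ∀ i j, ∃ g : A, bl i ≠ bl j → G i j = algebraMap R A π * g := fun i j => by
    by_cases hij : bl i = bl j
    · exact ⟨0, fun h => absurd hij h⟩
    · obtain ⟨g, hg⟩ := exists_eq_pow_mul_of_dvd π 1 (a := G i j) ⟨z i j, by
        have := hG i j
        rwa [if_neg hij, zero_add, ← pow_one ϖ] at this⟩
      exact ⟨g, fun _ => by rw [hg, pow_one]⟩
  choose G' hG' using hG'
  let Φ := blockDiagPart bl (Matrix.of G)
  have hΦ : BlockDiag Φ bl := blockDiag_blockDiagPart bl _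
  have hΦB : Φ.map c = B * (1 + ϖ • (C * blockDiagPart bl (Matrix.of z))) := by
    rw [mul_add, mul_one, Matrix.mul_smul, ← Matrix.mul_assoc, hBC, one_mul]
    refine Matrix.ext fun i j => ?_
    simp only [Φ, blockDiagPart, Matrix.map_apply, Matrix.of_apply, Matrix.add_apply,
      Matrix.smul_apply, smul_eq_mul]
    split_ifs with hij
    · rw [hG, if_pos hij]
    · rw [map_zero, hB i j hij, mul_zero, add_zero]
  obtain ⟨Q, -, hQ⟩ := exists_mul_eq_one ϖ (C * blockDiagPart bl (Matrix.of z))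
  obtain ⟨Y, hΦY, -⟩ := exists_inverse_of_compl π hunit Φ (Q * C) (by
    change Φ.map c * _ = 1
    rw [hΦB, Matrix.mul_assoc, ← Matrix.mul_assoc _ Q C, hQ, one_mul, hBC])
  have hΦΨ := hΦ.mul_blockDiagPart hΦY
  set Ψ := blockDiagPart bl Y
  let Z₀ : Matrix ι ι A := Matrix.of fun i j => if bl i = bl j then 0 else G' i j
  have hGΦ : Matrix.of G = Φ * (1 + algebraMap R A π • (Ψ * Z₀)) := by
    rw [mul_add, mul_one, Matrix.mul_smul, ← Matrix.mul_assoc, hΦΨ, one_mul]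
    refine Matrix.ext fun i j => ?_
    simp only [Φ, Z₀, blockDiagPart, Matrix.of_apply, Matrix.add_apply, Matrix.smul_apply,
      smul_eq_mul]
    split_ifs with hij
    · rw [mul_zero, add_zero]
    · rw [zero_add, hG' i j hij]
  -- conjugation by `diag(ϖ ^ (J * bl))`, carried out without division: `1 + ϖ ^ ((J + 1) * J + 1) V`
  -- becomes `1 + ϖ V'`, and the block triangular `P'` becomes `P''`; the truncated difference in the
  -- exponent of `P''` matters only where `P'` vanishes
  let V' : Matrix ι ι (Compl π A) := Matrix.of fun i j =>
    ϖ ^ ((J + 1) * J - J * bl i + J * bl j) * V i j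
  let P'' : Matrix ι ι (Compl π A) := Matrix.of fun i j => ϖ ^ (J * bl j - J * bl i) * P' i j
  refine ⟨Φ, Ψ, Ψ * Z₀, V', P'', hΦ, blockDiag_blockDiagPart bl _, hΦΨ, mul_eq_one_comm.mp hΦΨ,
    fun i j hij => ?_, fun i j hij => ?_, ?_⟩
  · change ϖ ^ _ * P' i j = 0
    rw [hP' hij, mul_zero]
  · change ϖ ^ (J * bl j - J * bl i) * P' i j = _
    rw [hij, Nat.sub_self, pow_zero, one_mul, hPB i j hij, hij]
  · let D : Matrix ι ι (Compl π A) := Matrix.diagonal fun i => ϖ ^ (J * bl i)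
    let Λ : Matrix ι ι (Compl π A) := Matrix.diagonal fun i => ϖ ^ bl i
    have hGc : (Matrix.of G).map c = Φ.map c * (1 + ϖ • (Ψ * Z₀).map c) := by
      have h1 := congrArg c.mapMatrix hGΦ
      rw [map_mul, map_add, map_one] at h1
      have h2 : c.mapMatrix (algebraMap R A π • (Ψ * Z₀)) = ϖ • (Ψ * Z₀).map c := by
        refine Matrix.ext fun i j => ?_
        change c (algebraMap R A π * _) = ϖ * c _
        rw [map_mul, hcπ]
      rw [h2] at h1
      exact h1
    have h1 : D * (Λ * (Matrix.of G).map c) = P.map c * D := by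
      refine Matrix.ext fun i j => ?_
      rw [Matrix.diagonal_mul, Matrix.diagonal_mul, Matrix.mul_diagonal, Matrix.map_apply,
        Matrix.map_apply, Matrix.of_apply, hz, hG, ← mul_assoc, ← pow_add]
      congr 2
      ring
    have h2 : D * (1 + ϖ • V') = (1 + ϖ ^ ((J + 1) * J + 1) • V) * D := by
      rw [Matrix.mul_add, Matrix.add_mul, Matrix.one_mul, Matrix.mul_one]
      congr 1
      refine Matrix.ext fun i j => ?_
      rw [Matrix.diagonal_mul, Matrix.mul_diagonal]
      change ϖ ^ (J * bl i) * (ϖ * (ϖ ^ ((J + 1) * J - J * bl i + J * bl j) * V i j)) =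
        ϖ ^ ((J + 1) * J + 1) * V i j * ϖ ^ (J * bl j)
      have hle : J * bl i ≤ (J + 1) * J := by nlinarith [hJ i]
      have e : (J + 1) * J + 1 + J * bl j = J * bl i + 1 + ((J + 1) * J - J * bl i + J * bl j) := by
        omega
      calc ϖ ^ (J * bl i) * (ϖ * (ϖ ^ ((J + 1) * J - J * bl i + J * bl j) * V i j))
          = ϖ ^ (J * bl i + 1 + ((J + 1) * J - J * bl i + J * bl j)) * V i j := by ring
        _ = _ := by rw [← e, pow_add _ _ (J * bl j)]; ring
    have h3 : D * P'' = P' * D := by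
      refine Matrix.ext fun i j => ?_
      rw [Matrix.diagonal_mul, Matrix.mul_diagonal]
      change ϖ ^ (J * bl i) * (ϖ ^ (J * bl j - J * bl i) * P' i j) = P' i j * ϖ ^ (J * bl j)
      by_cases hij : bl j < bl i
      · rw [hP' hij, mul_zero, mul_zero, zero_mul]
      · have e : J * bl i + (J * bl j - J * bl i) = J * bl j :=
          Nat.add_sub_cancel' (Nat.mul_le_mul_left J (not_lt.mp hij))
        rw [← mul_assoc, ← pow_add, e, mul_comm]
    have h4 : D * (1 + ϖ • V'.map s) = (1 + ϖ ^ ((J + 1) * J + 1) • V.map s) * D := by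
      have h5 := congrArg s.mapMatrix h2
      rw [map_mul, map_mul, map_add, map_add, map_one] at h5
      have hD : s.mapMatrix D = D := by
        rw [RingHom.mapMatrix_apply, Matrix.diagonal_map (map_zero s)]
        congr 1
        funext i
        rw [map_pow, hsϖ]
      have h6 : ∀ (n : ℕ) (M : Matrix ι ι (Compl π A)),
          s.mapMatrix (ϖ ^ n • M) = ϖ ^ n • M.map s := fun n M => by
        refine Matrix.ext fun i j => ?_
        change s (ϖ ^ n * _) = ϖ ^ n * s _
        rw [map_mul, map_pow, hsϖ]
      have h7 := h6 1 V'
      rw [pow_one] at h7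
      rwa [hD, h6, h7] at h5
    have h8 : D * (Λ * Φ.map c * (1 + ϖ • (Ψ * Z₀).map c) * (1 + ϖ • V'.map s)) =
        D * ((1 + ϖ • V') * P'') := by
      calc D * (Λ * Φ.map c * (1 + ϖ • (Ψ * Z₀).map c) * (1 + ϖ • V'.map s))
          = D * (Λ * (Matrix.of G).map c) * (1 + ϖ • V'.map s) := by
            rw [hGc]; simp only [Matrix.mul_assoc]
        _ = P.map c * (D * (1 + ϖ • V'.map s)) := by rw [h1, Matrix.mul_assoc]
        _ = P.map c * (1 + ϖ ^ ((J + 1) * J + 1) • V.map s) * D := by rw [h4, Matrix.mul_assoc]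
        _ = (1 + ϖ ^ ((J + 1) * J + 1) • V) * P' * D := by rw [← h]
        _ = (1 + ϖ ^ ((J + 1) * J + 1) • V) * (D * P'') := by rw [h3, Matrix.mul_assoc]
        _ = D * ((1 + ϖ • V') * P'') := by rw [← Matrix.mul_assoc, ← h2, Matrix.mul_assoc]
    have h9 := sub_eq_zero.mpr h8
    rw [← mul_sub] at h9
    refine sub_eq_zero.mp ?_
    refine Matrix.ext fun i j => ?_
    have h10 := congrFun (congrFun h9 i) j
    rw [Matrix.diagonal_mul] at h10
    exact eq_zero_of_pow_mul_eq_zero hregS _ _ h10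

end Scaling

/-! ### The matrices of an overconvergent `σ`-module and of its graded pieces -/

section ChangeOfBasis

variable {S : Type u} [CommRing S] {σ : S →+* S} {M : Type*} [AddCommGroup M] [Module S M]

/-- The effect of a change of basis on the matrix of a `σ`-linear endomorphism. -/
theorem sigmaMatrix_mul_toMatrix_map {ι κ : Type*} [Fintype ι] [Fintype κ] (b : Module.Basis ι S M)
    (b' : Module.Basis κ S M) (φ : M →ₛₗ[σ] M) :
    sigmaMatrix b φ * (b.toMatrix b').map σ = b.toMatrix b' * sigmaMatrix b' φ := by
  refine Matrix.ext fun i j => ?_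
  have h1 : b.repr (φ (b' j)) i = ∑ k, b.repr (φ (b k)) i * σ (b.repr (b' j) k) := by
    conv_lhs => rw [← b.sum_repr (b' j), map_sum, map_sum, Finsupp.finsetSum_apply]
    refine Finset.sum_congr rfl fun k _ => ?_
    rw [LinearMap.map_smulₛₗ, map_smul, Finsupp.smul_apply, smul_eq_mul, mul_comm]
  have h2 := congrFun (b'.toMatrix_mulVec_repr b (φ (b' j))) i
  exact h1.symm.trans h2.symm

theorem cls_sigmaMatrix_eq {R : Type*} [CommRing R] (π : R) [Algebra R S] {ι κ : Type} [Fintype ι]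
    [Fintype κ] [DecidableEq ι] [DecidableEq κ] (b : Module.Basis ι S M) (b' : Module.Basis κ S M)
    (φ : M →ₛₗ[σ] M) :
    cls σ (NuclearMatrix.ofFinite π (sigmaMatrix b φ)) =
      cls σ (NuclearMatrix.ofFinite π (sigmaMatrix b' φ)) := by
  refine cls_ofFinite_eq σ (b.toMatrix b') (b'.toMatrix b) (b.toMatrix_mul_toMatrix_flip b')
    (b'.toMatrix_mul_toMatrix_flip b) ?_
  rw [Matrix.mul_assoc, sigmaMatrix_mul_toMatrix_map, ← Matrix.mul_assoc,
    b'.toMatrix_mul_toMatrix_flip b, Matrix.one_mul]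

theorem BlockDiag.exists_mul_eq_one {ι : Type*} [Fintype ι] [DecidableEq ι] {bl : ι → ℕ}
    {B : Matrix ι ι S} (hB : BlockDiag B bl)
    (h : ∀ i, ∃ C, B.toSquareBlock bl (bl i) * C = 1) : ∃ C, B * C = 1 := by
  have hdet : IsUnit B.det := by
    rw [Matrix.BlockTriangular.det (b := bl) fun i j hij => hB i j (ne_of_gt hij)]
    refine IsUnit.prod_iff.mpr fun l hl => ?_
    obtain ⟨i, -, rfl⟩ := Finset.mem_image.mp hl
    obtain ⟨C, hC⟩ := h i
    exact IsUnit.of_mul_eq_one _ (by rw [← Matrix.det_mul, hC, Matrix.det_one])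
  exact ⟨B⁻¹, Matrix.mul_nonsing_inv B hdet⟩

/-- The matrix of a base change of a `σ`-module, in a basis which need not be defined over `A`. -/
theorem IsOverconvergent.exists_matrix {R : Type u} [CommRing R] {π : R} {A : Type u} [CommRing A]
    [Algebra R A] [Nontrivial (Compl π A)] {σ : A →ₐ[R] A} {M : Type*} [AddCommGroup M]
    [Module (Compl π A) M] {φ : M →ₛₗ[complEnd π σ] M} (h : IsOverconvergent π σ φ) {ι : Type*}
    [Fintype ι] [DecidableEq ι] (b : Module.Basis ι (Compl π A) M) :
    ∃ (P : Matrix ι ι A) (X Q : Matrix ι ι (Compl π A)), X * Q = 1 ∧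
      P.map (algebraMap A (Compl π A)) * X.map (complEnd π σ) = X * sigmaMatrix b φ := by
  obtain ⟨M₀, _, _, _, _, φ₀, e, he⟩ := h
  let b₀ := Module.Free.chooseBasis A M₀
  let b₁ := ((b₀.baseChange (Compl π A)).map e)
  let f := b₁.indexEquiv b
  let b₂ := b₁.reindex f
  refine ⟨sigmaMatrix (b₀.reindex f) φ₀, b₂.toMatrix b, b.toMatrix b₂,
    b₂.toMatrix_mul_toMatrix_flip b, ?_⟩
  rw [← sigmaMatrix_mul_toMatrix_map]
  congr 1
  refine Matrix.ext fun i j => ?_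
  have h1 : b₂ j = e (1 ⊗ₜ b₀ (f.symm j)) := by
    simp [b₂, b₁]
  have h2 : φ (b₂ j) = e (1 ⊗ₜ φ₀ (b₀ (f.symm j))) := by rw [h1, he]
  change algebraMap A (Compl π A) ((b₀.reindex f).repr (φ₀ ((b₀.reindex f) j)) i) =
    b₂.repr (φ (b₂ j)) i
  rw [h2]
  simp [b₂, b₁, Algebra.smul_def]

/-- The matrix of the direct sum of the graded pieces of an ordinary `σ`-module, in a basis adapted
to the filtration. -/
theorem exists_graded_matrix {ϖ : S} {M : Type v} [AddCommGroup M] [Module S M] {φ : M →ₛₗ[σ] M}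
    (F : OrdinaryFiltration ϖ φ) [Nontrivial S] [Module.Finite S M] (i : ℕ) :
    ∃ (d J : ℕ) (bl : Fin d → ℕ) (b : Module.Basis (Fin d) S M) (B C : Matrix (Fin d) (Fin d) S)
      (β : Module.Basis {x // bl x = i} S (F.Gr i)),
      (∀ x, bl x < J) ∧ (sigmaMatrix b φ).BlockTriangular bl ∧ BlockDiag B bl ∧ B * C = 1 ∧
      (∀ x y, bl x = bl y → sigmaMatrix b φ x y = ϖ ^ bl x * B x y) ∧
      ∀ x y : {x // bl x = i}, B x y = sigmaMatrix β (F.grEnd i) x y := by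
  obtain ⟨d, J, bl, b, hi, hJ, htri, hgr⟩ := exists_adapted_basis F i
  choose β hβ using hgr
  let B : Matrix (Fin d) (Fin d) S := fun x y =>
    if h : bl y = bl x then sigmaMatrix (β (bl x) (hJ x)) (F.grEnd (bl x)) ⟨x, rfl⟩ ⟨y, h⟩ else 0
  have hB : BlockDiag B bl := fun x y hxy => dif_neg (Ne.symm hxy)
  have hBβ : ∀ (l : ℕ) (hl : l < J) (x y : {x // bl x = l}),
      B x y = sigmaMatrix (β l hl) (F.grEnd l) x y := by
    rintro l hl ⟨x, rfl⟩ ⟨y, hy⟩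
    exact dif_pos hy
  obtain ⟨C, hC⟩ := hB.exists_mul_eq_one fun x => by
    obtain ⟨X, hX⟩ := exists_sigmaMatrix_mul_eq_one (F.unitRoot (bl x)) (β (bl x) (hJ x))
    refine ⟨X, ?_⟩
    rw [← hX]
    congr 1
    exact Matrix.ext fun y z => hBβ (bl x) (hJ x) y z
  refine ⟨d, J, bl, b, B, C, β i hi, hJ, htri, hB, hC, fun x y hxy => ?_, hBβ i hi⟩
  exact (hβ (bl x) (hJ x) ⟨x, rfl⟩ ⟨y, hxy.symm⟩).trans
    (congrArg _ (hBβ (bl x) (hJ x) ⟨x, rfl⟩ ⟨y, hxy.symm⟩).symm)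

end ChangeOfBasis

/-! ### Lifts to series of polynomials -/

section Lifting

open PowerSeries

variable {R : Type u} [CommRing R] (π : R) {n r : ℕ} (g : Fin r → MvPolynomial (Fin n) R)

/-- Finitely many elements of `A` are given by series of polynomials with a common bound for the
growth of the degrees. -/
theorem exists_series_of_daggerAlg [IsAdicComplete (Ideal.span {π}) R]
    [IsAdicComplete (Ideal.span {algebraMap R (Compl π (DaggerAlg π g)) π})
      (Compl π (DaggerAlg π g))]
    {I : Type*} [Finite I] (a : I → DaggerAlg π g) :
    ∃ (m c : ℕ) (f : I → (MvPolynomial (Fin n) R)⟦X⟧), ∀ i, f i ∈ (degreeFil R n).series m c ∧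
      evalAt (algebraMap R (Compl π (DaggerAlg π g)) π) (PowerSeries.map (polyMap π g) (f i)) =
        algebraMap (DaggerAlg π g) (Compl π (DaggerAlg π g)) (a i) := by
  have h : ∀ i, ∃ (m c : ℕ) (f : (MvPolynomial (Fin n) R)⟦X⟧), f ∈ (degreeFil R n).series m c ∧
      evalAt (algebraMap R (Compl π (DaggerAlg π g)) π) (PowerSeries.map (polyMap π g) f) =
        algebraMap (DaggerAlg π g) (Compl π (DaggerAlg π g)) (a i) := fun i => by
    obtain ⟨⟨z, m, c, hm, hc, hz⟩, hza⟩ := Ideal.Quotient.mkₐ_surjective R _ (a i)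
    obtain ⟨f, hf, rfl⟩ := exists_polySum_eq π hz
    refine ⟨m, c, f, hf, ?_⟩
    rw [← algebraMap_polySum π g hm hc hf]
    exact congrArg _ hza
  choose m c f hf hfa using h
  obtain ⟨m', hm'⟩ := (Set.finite_range m).bddAbove
  obtain ⟨c', hc'⟩ := (Set.finite_range c).bddAbove
  exact ⟨m', c', f, fun i => ⟨(degreeFil R n).series_mono (hm' ⟨i, rfl⟩) (hc' ⟨i, rfl⟩) (hf i),
    hfa i⟩⟩

end Lifting

/-- The completion of `A` is not zero if the reduction of `A` is not zero. -/
theorem nontrivial_compl {R : Type u} [CommRing R] {k : Type u} [CommRing k] [Algebra R k]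
    (π : R) (hk : algebraMap R k π = 0) {A : Type u} [CommRing A] [Algebra R A]
    [Nontrivial (k ⊗[R] A)] : Nontrivial (Compl π A) := by
  by_contra h
  rw [not_nontrivial_iff_subsingleton] at h
  obtain ⟨b, hb⟩ := exists_eq_pow_mul_of_dvd π 1 (a := (1 : A)) ⟨0, Subsingleton.elim _ _⟩
  refine one_ne_zero (α := k ⊗[R] A) ?_
  rw [Algebra.TensorProduct.one_def, hb, pow_one, ← Algebra.smul_def, TensorProduct.tmul_smul,
    TensorProduct.smul_tmul', Algebra.smul_def, hk, zero_mul, TensorProduct.zero_tmul]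

end HodgeNewton

end

open HodgeNewton TensorProduct in
theorem mainTheorem2 {p : ℕ} [Fact p.Prime]
    {R : Type*} [CommRing R] [IsDomain R] [IsDiscreteValuationRing R] [CharZero R]
    [Algebra ℤ_[p] R] [Module.Finite ℤ_[p] R]
    (π : R) (hπ : Irreducible π)
    {n r : ℕ} (g : Fin r → MvPolynomial (Fin n) R)
    (hflat : Module.Flat R (DaggerAlg π g))
    (hsmooth : Algebra.Smooth (IsLocalRing.ResidueField R)
      (IsLocalRing.ResidueField R ⊗[R] DaggerAlg π g))
    (hconn : ConnectedSpace (PrimeSpectrum (IsLocalRing.ResidueField R ⊗[R] DaggerAlg π g)))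
    (σ : DaggerAlg π g →ₐ[R] DaggerAlg π g)
    (hσ : IsFrobeniusLift π (Nat.card (IsLocalRing.ResidueField R)) σ)
    {M : Type*} [AddCommGroup M] [Module (Compl π (DaggerAlg π g)) M]
    [Module.Free (Compl π (DaggerAlg π g)) M] [Module.Finite (Compl π (DaggerAlg π g)) M]
    (φ : M →ₛₗ[complEnd π σ] M) (hover : IsOverconvergent π σ φ)
    (F : OrdinaryFiltration (algebraMap R (Compl π (DaggerAlg π g)) π) φ)
    (i : ℕ) {ι : Type} [Finite ι] (b : Module.Basis ι (Compl π (DaggerAlg π g)) (F.Gr i)) :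
    ∃ (C : ℕ → NuclearMatrix π (Compl π (DaggerAlg π g))) (ε : ℕ → ℤˣ) (hC : OrdTendsto C),
      (∀ k, IsOverconvergentMatrix g (C k)) ∧
      cls (complEnd π σ) (NuclearMatrix.ofFinite π (sigmaMatrix b (F.grEnd i))) =
        signedSum (complEnd π σ) C ε hC := by
  classical
  have := Fintype.ofFinite ι
  have := isAdicComplete_span (p := p) hπ
  have := isAdicComplete_compl π (A := DaggerAlg π g)
  have hreg : ∀ a : DaggerAlg π g, algebraMap R _ π * a = 0 → a = 0 := fun a ha =>
    Module.Flat.isSMulRegular_of_nonZeroDivisors (mem_nonZeroDivisors_of_ne_zero hπ.ne_zero)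
      (show π • a = π • 0 by rw [Algebra.smul_def, ha, smul_zero])
  have hunit := isUnit_one_add hπ.not_isUnit g
  have : Nontrivial (IsLocalRing.ResidueField R ⊗[R] DaggerAlg π g) :=
    PrimeSpectrum.nonempty_iff_nontrivial.mp hconn.toNonempty
  have : Nontrivial (Compl π (DaggerAlg π g)) :=
    nontrivial_compl (k := IsLocalRing.ResidueField R) π
      ((IsLocalRing.residue_eq_zero_iff π).mpr hπ.not_isUnit)
  obtain ⟨d, J, bl, b', B, B', β, hJ, htri, hB, hBB', hdiag, hβ⟩ := exists_graded_matrix F i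
  obtain ⟨P₀, X, Q, hXQ, hP₀⟩ := hover.exists_matrix b'
  -- the precision needed for the rescaling
  obtain ⟨P, V, hPV⟩ := exists_approximation π hunit σ P₀ hXQ hP₀ ((J + 1) * J)
  obtain ⟨Φ, Ψ, Z, V', P'', hΦ, hΨ, hΦΨ, hΨΦ, hP'', hPB, heq⟩ :=
    exists_scaling π hreg hunit σ hJ P htri hB hBB' hdiag hPV
  obtain ⟨m, c, f, hf⟩ := exists_series_of_daggerAlg π g
    fun x : Fin 3 × Fin d × Fin d => (![Φ, Ψ, Z] x.1) x.2.1 x.2.2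
  let c' := algebraMap (DaggerAlg π g) (Compl π (DaggerAlg π g))
  have hcone : ∀ {Y Y' : Matrix (Fin d) (Fin d) (DaggerAlg π g)}, Y * Y' = 1 →
      Y.map c' * Y'.map c' = 1 := fun h => by
    have := congrArg c'.mapMatrix h
    rwa [map_mul, map_one] at this
  have hcblock : ∀ {Y : Matrix (Fin d) (Fin d) (DaggerAlg π g)}, BlockDiag Y bl →
      BlockDiag (Y.map c') bl := fun h x y hxy => by
    rw [Matrix.map_apply, h x y hxy, map_zero]
  obtain ⟨m', c₁, G, W, W', hG, hW, hW', hcls⟩ := exists_cls_eq_sub (D := degreeFil R n) π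
    (polyMap π g) (complEnd π σ) (regular_compl π hreg) (complEnd_algebraMap_base π σ) bl i
    (Φ' := fun x y => f (0, x, y)) (Ψ' := fun x y => f (1, x, y)) (Z' := fun x y => f (2, x, y))
    (fun x y => (hf _).1) (fun x y => (hf _).1) (fun x y => (hf _).1)
    (Φ := Φ.map c') (Ψ := Ψ.map c') (Z := Z.map c') (V := V') (P' := P'')
    (B := sigmaMatrix β (F.grEnd i))
    (fun x y => (hf (0, x, y)).2) (fun x y => (hf (1, x, y)).2) (fun x y => (hf (2, x, y)).2)
    (hcblock hΦ) (hcblock hΨ) (hcone hΦΨ) (hcone hΨΦ) hP''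
    (fun x y => by rw [hPB x y (x.2.trans y.2.symm), hβ, x.2]) heq
  obtain ⟨C, ε, hC, hCM, hsum⟩ := exists_signedSum_eq_sub (complEnd π σ)
    (wordMatrix π (fun a => baseChange (polyMap π g) (G a))
      (fun i j => baseChange (polyMap π g) (W i j))
      (fun a => baseChange_mem _ (hG a)) (fun i j => baseChange_mem _ (hW i j)))
    (wordMatrix π (fun a => baseChange (polyMap π g) (G a))
      (fun i j => baseChange (polyMap π g) (W' i j))
      (fun a => baseChange_mem _ (hG a)) (fun i j => baseChange_mem _ (hW' i j)))
  refine ⟨C, ε, hC, fun k => ?_, ?_⟩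
  · rcases hCM k with h | h | h
    · rw [h]
      exact isOverconvergent_wordMatrix π g G W hG hW
    · rw [h]
      exact isOverconvergent_wordMatrix π g G W' hG hW'
    · rw [h]
      exact isOverconvergent_empty π g
  · rw [← hsum, ← hcls]
    exact cls_sigmaMatrix_eq π b β (F.grEnd i)
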